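/- Let $\omega=e^{2\pi i/3}$, $\mu_1=\frac{-1+\sqrt5}{2}$, $\mu_2=\frac{-1-\sqrt5}{2}$, and let $G\subset \mathrm{PGL}_3(\mathbb C)$ be the group of projective transformations of $\mathbb P^2(\mathbb C)$ generated by the classes of the matrices $$\begin{pmatrix}1&0&0\\0&-1&0\\0&0&-1\end{pmatrix},\quad \begin{pmatrix}0&1&0\\0&0&1\\1&0&0\end{pmatrix},\quad \frac12\begin{pmatrix}-1&\mu_2&\mu_1\\ \mu_2&\mu_1&-1\\ \mu_1&-1&\mu_2\end{pmatrix},\quad \begin{pmatrix}-1&0&0\\0&0&-\omega\\0&-\omega^2&0\end{pmatrix}.$$ The Wiman configuration is the set of all lines in $\mathbb P^2(\mathbb C)$ that are fixed pointwise by some element of order $2$ of $G$. The multiplicity of a point is the number of lines of the configuration passing through it, and $Z$ denotes the set of all points of multiplicity at least $2$. For an ideal $I$ of a Noetherian ring $R$ and $m\ge 0$, the $m$-th symbolic power of $I$ is $I^{(m)}=\bigcap_{Q\in \mathrm{Ass}(I)}\left(I^mR_Q\cap R\right)$, where $\mathrm{Ass}(I)$ is the set of associated primes of $R/I$ and $I^mR_Q\cap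 R$ is the preimage of $I^mR_Q$ under $R\to R_Q$. Theorem (Wiman configuration). The group $G$ has order $360$. The Wiman configuration consists of exactly $45$ lines; the set $Z$ of their intersection points has exactly $201$ elements, namely $120$ points of multiplicity $3$, $45$ points of multiplicity $4$ and $36$ points of multiplicity $5$. If $I\subset\mathbb C[x_0,x_1,x_2]$ is the ideal of $Z$, i.e. the ideal of all polynomials vanishing at every vector of $\mathbb C^3$ that represents a point of $Z$ (the radical homogeneous ideal of $Z$), then $$I^{(3)}\nsubseteq I^2 .$$ -/

import Mathlib

open scoped MatrixGroups LinearAlgebra.Projectivization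

noncomputable section

/-- The `m`-th symbolic power `I^(m) = ⋂_{Q ∈ Ass(I)} (I^m R_Q ∩ R)` of an ideal `I` of a Noetherian
ring `R`, where `Ass(I)` is the set of associated primes of the `R`-module `R ⧸ I`. -/
def symbolicPower {R : Type*} [CommRing R] [IsNoetherianRing R] (I : Ideal R) (m : ℕ) : Ideal R :=
  ⨅ (Q : Ideal R) (_ : Q ∈ associatedPrimes R (R ⧸ I)) (_ : Q.IsPrime),
    ((I ^ m).map (algebraMap R (Localization.AtPrime Q))).comap
      (algebraMap R (Localization.AtPrime Q))

/-- The complex projective plane. -/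
abbrev ComplexPlane : Type := ℙ ℂ (Fin 3 → ℂ)

/-- The ideal in `ℂ[x₀, x₁, x₂]` of a set `Z` of points of the projective plane: the polynomials
that vanish at every vector representing a point of `Z`. -/
def projectiveIdeal (Z : Set ComplexPlane) : Ideal (MvPolynomial (Fin 3) ℂ) :=
  MvPolynomial.vanishingIdeal ℂ {v : Fin 3 → ℂ | ∃ P ∈ Z, v ∈ P.submodule}

namespace Wiman

/-- A primitive cube root of unity. -/
def ω : ℂ := Complex.exp (2 * Real.pi * Complex.I / 3)

/-- The square root of five, as a complex number. -/
def sqrtFive : ℂ := ((Real.sqrt 5 : ℝ) : ℂ)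

/-- `(√5 - 1) / 2`. -/
def μ₁ : ℂ := (sqrtFive - 1) / 2

/-- `(-√5 - 1) / 2`. -/
def μ₂ : ℂ := (-sqrtFive - 1) / 2

def M₁ : Matrix (Fin 3) (Fin 3) ℂ := !![1, 0, 0; 0, -1, 0; 0, 0, -1]

def M₂ : Matrix (Fin 3) (Fin 3) ℂ := !![0, 1, 0; 0, 0, 1; 1, 0, 0]

def M₃ : Matrix (Fin 3) (Fin 3) ℂ :=
  !![-1 / 2, μ₂ / 2, μ₁ / 2; μ₂ / 2, μ₁ / 2, -1 / 2; μ₁ / 2, -1 / 2, μ₂ / 2]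

def M₄ : Matrix (Fin 3) (Fin 3) ℂ := !![-1, 0, 0; 0, 0, -ω; 0, -ω ^ 2, 0]

theorem sqrtFive_sq : sqrtFive ^ 2 = 5 := by
  unfold sqrtFive
  rw [← Complex.ofReal_pow, Real.sq_sqrt (by norm_num)]
  norm_num

theorem ω_pow_three : ω ^ 3 = 1 := by
  unfold ω
  rw [← Complex.exp_nat_mul]
  convert Complex.exp_two_pi_mul_I using 2
  push_cast
  ring

theorem det_M₁ : M₁.det = 1 := by
  simp [M₁, Matrix.det_fin_three]

theorem det_M₂ : M₂.det = 1 := by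
  simp [M₂, Matrix.det_fin_three]

theorem det_M₃ : M₃.det = 1 := by
  simp only [M₃, Matrix.det_fin_three, μ₁, μ₂, Matrix.of_apply, Matrix.cons_val]
  linear_combination (3 / 16 : ℂ) * sqrtFive_sq

theorem det_M₄ : M₄.det = 1 := by
  simp only [M₄, Matrix.det_fin_three, Matrix.of_apply, Matrix.cons_val]
  linear_combination ω_pow_three

/-- The element of `PGL₃(ℂ)` given by a matrix of determinant `1`. -/
def toPGL (M : Matrix (Fin 3) (Fin 3) ℂ) (h : M.det = 1) : PGL(3, ℂ) :=
  Matrix.SpecialLinearGroup.toPGL ⟨M, h⟩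

/-- The reflection group of the Wiman configuration, as a group of projective transformations of
the plane: `M₁`, `M₂`, `M₃` generate the icosahedral group, and `M₄` enlarges it to the Valentiner
group (of order `360` in `PGL₃(ℂ)`). -/
def group : Subgroup PGL(3, ℂ) :=
  Subgroup.closure {toPGL M₁ det_M₁, toPGL M₂ det_M₂, toPGL M₃ det_M₃, toPGL M₄ det_M₄}

/-- The lines of the Wiman configuration: those lines of the plane (two-dimensional subspaces of
`ℂ³`) that are fixed pointwise by some involution in the group. -/
def lines : Set (Submodule ℂ (Fin 3 → ℂ)) :=
  {L | Module.finrank ℂ L = 2 ∧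
    ∃ τ ∈ group, orderOf τ = 2 ∧ ∀ P : ComplexPlane, P.submodule ≤ L → τ • P = P}

/-- The number of lines of the configuration that pass through the point `P`. -/
def multiplicity (P : ComplexPlane) : ℕ :=
  {L ∈ lines | P.submodule ≤ L}.ncard

/-- The points where at least two lines of the configuration meet. -/
def points : Set ComplexPlane :=
  {P | 2 ≤ multiplicity P}

end Wiman

end

/-! The group permutes six conics `q_i` with symmetric matrices `Q_i`, up to cube roots of unity, so
the sums of `q_i ^ 3` and of `q_i ^ 6` are invariant forms of degrees 6 and 12. Up to scalars their
gradients are A = P X and B = Q X, with the symmetric matrices P = ∑ q_i² Q_i and Q = ∑ q_i⁵ Q_i.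
The vector g = A × B has components of degree 16, and these turn out to generate I.

The reason is equivariance. On a mirror g is a multiple of the centre of the reflection, so g
vanishes wherever two mirrors meet. The vector (P g) × (Q g) is parallel to X, vanishes on all
mirrors and has degree 46 = 45 + 1. Hence it equals c F X with c ≠ 0, where F is the product of the
45 mirror equations (`exists_sylvesterForm_eq`); in particular every zero of g lies on a mirror.
Each mirror carries at least 16 intersection points, so degree 16 leaves room for no further zeros
and makes these simple. The derivatives of g along two mirrors through a point are then independent,
and g generates I locally. The syzygies of the minors of a 3 × 2 matrix exclude an associated prime
at the origin, so I = (g) globally (`projectiveIdeal_points`).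

F lies in the third symbolic power because at least three mirrors pass through every point
(`mirrorProduct_mem_symbolicPower`). That F is not in I² is an argument about Sylvester forms
(`sylvester_notMem_sq`). Suppose F = gᵀ M g and choose a general constant vector t. Modulo a = t·A
and b = t·B the vector g is proportional to t, and a component of g that cancels there allows g to
be replaced by t in the equation (P g) × (Q g) = F y. Taking the cross product with X then writes 1
as a combination of the variables.

For the counts, the action on the conics identifies the group with the alternating group on six
letters, which has 45 involutions. The 45 explicit reflections are therefore all of them. The
incidences are computed exactly in ℤ[μ₁, ω], where equality is decidable. -/

namespace TernaryForms

open MvPolynomial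
open scoped Matrix

/-! ### Cross products and quadratic expressions over a commutative ring. -/

section CommRing

variable {R : Type*} [CommRing R]

theorem cross_eq_zero_iff (v w : Fin 3 → R) : v ⨯₃ w = 0 ↔ ∀ i j, v i * w j = v j * w i := by
  rw [cross_apply]
  constructor
  · intro h
    have h0 := congrFun h 0
    have h1 := congrFun h 1
    have h2 := congrFun h 2
    simp only [Matrix.cons_val, Pi.zero_apply] at h0 h1 h2
    intro i j
    fin_cases i <;> fin_cases j <;> simp only [Fin.zero_eta, Fin.mk_one, Fin.reduceFinMk]
    · linear_combination h2
    · linear_combination -h1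
    · linear_combination -h2
    · linear_combination h0
    · linear_combination h1
    · linear_combination -h0
  · intro h
    funext i
    fin_cases i <;> simp [h]

/-- A denominator-free form of the fact that a vector parallel to two independent vectors is zero.
-/
theorem dotProduct_cross_mul (u A B : Fin 3 → R) (hA : u ⨯₃ A = 0) (hB : u ⨯₃ B = 0) (i j : Fin 3) :
    u i * (A ⨯₃ B) j = 0 := by
  rw [cross_eq_zero_iff] at hA hB
  have key : ∀ a b c : Fin 3, u c * (A a * B b - A b * B a) = 0 := fun a b c => by
    linear_combination B b * hA c a - B a * hA c b + A a * hB b c * 0 + A c * hB a b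
  rw [cross_apply]
  fin_cases j <;> simp [key]

/-- The expression is quadratic in the vector. Together with the next lemma this lets `g` be
exchanged for a constant vector modulo an ideal in which the two are proportional. -/
theorem smul_cross_mulVec (P Q : Matrix (Fin 3) (Fin 3) R) (g t : Fin 3 → R) (r s : R)
    (h : r • g = s • t) : r ^ 2 • ((P *ᵥ g) ⨯₃ (Q *ᵥ g)) = s ^ 2 • ((P *ᵥ t) ⨯₃ (Q *ᵥ t)) := by
  have e : ∀ (r : R) (g : Fin 3 → R),
      r ^ 2 • ((P *ᵥ g) ⨯₃ (Q *ᵥ g)) = (P *ᵥ (r • g)) ⨯₃ (Q *ᵥ (r • g)) := fun r g => by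
    simp [Matrix.mulVec_smul, smul_smul, sq]
  rw [e, e, h]

theorem sq_mul_dotProduct (M : Matrix (Fin 3) (Fin 3) R) (g t : Fin 3 → R) (r s : R)
    (h : r • g = s • t) : r ^ 2 * (g ⬝ᵥ M *ᵥ g) = s ^ 2 * (t ⬝ᵥ M *ᵥ t) := by
  have e : ∀ (r : R) (g : Fin 3 → R),
      r ^ 2 * (g ⬝ᵥ M *ᵥ g) = (r • g) ⬝ᵥ M *ᵥ (r • g) := fun r g => by
    simp [Matrix.mulVec_smul, sq, mul_assoc]
  rw [e, e, h]

theorem map_cross {R' : Type*} [CommRing R'] (f : R →+* R') (v w : Fin 3 → R) :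
    f ∘ (v ⨯₃ w) = (f ∘ v) ⨯₃ (f ∘ w) := by
  funext i
  simp only [cross_apply, Function.comp_apply]
  fin_cases i <;> simp

/-- Elements of the square of an ideal are quadratic forms in its generators. -/
theorem exists_quadratic_of_mem_sq {g : Fin 3 → R} {F : R} (hF : F ∈ Ideal.span (Set.range g) ^ 2) :
    ∃ M : Matrix (Fin 3) (Fin 3) R, F = g ⬝ᵥ M *ᵥ g := by
  rw [sq] at hF
  refine Submodule.mul_induction_on hF ?_ ?_
  · intro p hp q hq
    obtain ⟨c, rfl⟩ := (Submodule.mem_span_range_iff_exists_fun R).1 hp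
    obtain ⟨d, rfl⟩ := (Submodule.mem_span_range_iff_exists_fun R).1 hq
    refine ⟨Matrix.vecMulVec c d, ?_⟩
    simp [Matrix.mulVec, dotProduct, Matrix.vecMulVec, Fin.sum_univ_three]
    ring
  · rintro p q ⟨M, rfl⟩ ⟨N, rfl⟩
    exact ⟨M + N, by rw [Matrix.add_mulVec, dotProduct_add]⟩

end CommRing

/-! ### Syzygies of the maximal minors over a factorial domain. -/

section Domain

variable {R : Type*} [CommRing R] [IsDomain R] [UniqueFactorizationMonoid R]

/-- A vector parallel to a primitive vector is a multiple of it. -/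
theorem exists_eq_smul_of_cross_eq_zero {v g : Fin 3 → R} (hg : ∀ d, (∀ i, d ∣ g i) → IsUnit d)
    (h : v ⨯₃ g = 0) : ∃ r : R, v = r • g := by
  classical
  rw [cross_eq_zero_iff] at h
  obtain ⟨j, hj⟩ : ∃ j, g j ≠ 0 := by
    by_contra! h0
    exact not_isUnit_zero (hg 0 fun i => by rw [h0 i])
  let := UniqueFactorizationMonoid.toGCDMonoid R
  -- Parallelism gives v_j g_i = v_i g_j, so g_j divides v_j times the gcd of the g_i, and that gcd
  -- is a unit.
  have hd : g j ∣ v j := by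
    have h1 : g j ∣ gcd (gcd (v j * g 0) (v j * g 1)) (v j * g 2) :=
      dvd_gcd (dvd_gcd ⟨v 0, by rw [h]; ring⟩ ⟨v 1, by rw [h]; ring⟩)
        ⟨v 2, by rw [h]; ring⟩
    have h2 : Associated (gcd (gcd (v j * g 0) (v j * g 1)) (v j * g 2))
        (v j * gcd (gcd (g 0) (g 1)) (g 2)) :=
      ((gcd_mul_left' _ _ _).gcd (Associated.refl _)).trans (gcd_mul_left' _ _ _)
    have h3 : IsUnit (gcd (gcd (g 0) (g 1)) (g 2)) := by
      refine hg _ fun i => ?_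
      fin_cases i
      · exact (gcd_dvd_left _ _).trans (gcd_dvd_left _ _)
      · exact (gcd_dvd_left _ _).trans (gcd_dvd_right _ _)
      · exact gcd_dvd_right _ _
    exact h3.dvd_mul_right.1 (h1.trans h2.dvd)
  obtain ⟨r, hr⟩ := hd
  refine ⟨r, funext fun i => mul_left_cancel₀ hj ?_⟩
  have := h i j
  rw [hr] at this
  simp only [Pi.smul_apply, smul_eq_mul]
  linear_combination this

/-- The syzygies of the maximal minors of a `3 × 2` matrix whose minors have no common factor
are generated by its columns. -/
theorem exists_eq_of_dotProduct_cross_eq_zero {A B r : Fin 3 → R}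
    (hg : ∀ d, (∀ i, d ∣ (A ⨯₃ B) i) → IsUnit d) (h : r ⬝ᵥ A ⨯₃ B = 0) :
    ∃ α β : R, r = α • A + β • B := by
  -- Cramer's rule: if r = α A + β B, then r × B = α (A × B) and A × r = β (A × B). The coefficients
  -- are read off from these two equations.
  have h1 : (r ⨯₃ B) ⨯₃ (A ⨯₃ B) = 0 := by
    rw [cross_cross_eq_smul_sub_smul]
    simp [dot_cross_self, h]
  have h2 : (A ⨯₃ r) ⨯₃ (A ⨯₃ B) = 0 := by
    rw [cross_cross_eq_smul_sub_smul]
    simp [dot_self_cross, h]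
  obtain ⟨α, hα⟩ := exists_eq_smul_of_cross_eq_zero hg h1
  obtain ⟨β, hβ⟩ := exists_eq_smul_of_cross_eq_zero hg h2
  refine ⟨α, β, ?_⟩
  obtain ⟨j, hj⟩ : ∃ j, (A ⨯₃ B) j ≠ 0 := by
    by_contra! h0
    exact not_isUnit_zero (hg 0 fun i => by rw [h0 i])
  have hB : (r - α • A - β • B) ⨯₃ B = 0 := by
    simp [hα, cross_self]
  have hA : (r - α • A - β • B) ⨯₃ A = 0 := by
    rw [← cross_anticomm]
    simp [hβ, cross_self]
  funext i
  have := dotProduct_cross_mul _ _ _ hA hB i j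
  have := (mul_eq_zero.1 this).resolve_right hj
  simp only [Pi.sub_apply] at this
  simp only [Pi.add_apply]
  linear_combination this

end Domain

/-! ### The Koszul complex of the three variables. -/

section Field

variable {k : Type*} [Field k]

local notation "S" => MvPolynomial (Fin 3) k

theorem isUnit_of_dvd_X (d : S) (h : ∀ i, d ∣ (X i : S)) : IsUnit d := by
  have hX := X_prime (R := k) (i := (0 : Fin 3))
  by_contra hd
  have h0 : (X 0 : S) ∣ d := ((hX.irreducible.dvd_iff.1 (h 0)).resolve_left hd).dvd
  simpa using X_dvd_X.1 (h0.trans (h 1))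

theorem exists_eq_smul_X {v : Fin 3 → S} (h : v ⨯₃ X = 0) : ∃ r : S, v = r • X :=
  exists_eq_smul_of_cross_eq_zero isUnit_of_dvd_X h

/-- Exactness of the Koszul complex of the three variables. -/
theorem exists_eq_cross_X {v : Fin 3 → S} (h : v ⬝ᵥ X = 0) : ∃ n : Fin 3 → S, v = n ⨯₃ X := by
  rw [dotProduct, Fin.sum_univ_three] at h
  have hmem : X 2 * v 2 ∈ Ideal.span (X '' ({0, 1} : Set (Fin 3)) : Set S) := by
    have : X 2 * v 2 = (-v 0) * X 0 + (-v 1) * X 1 := by linear_combination h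
    rw [this]
    exact add_mem (Ideal.mul_mem_left _ _ (Ideal.subset_span ⟨0, by simp, rfl⟩))
      (Ideal.mul_mem_left _ _ (Ideal.subset_span ⟨1, by simp, rfl⟩))
  -- The ideal (X₀, X₁) is monomial, so the factor X₂ cancels monomial by monomial.
  have hmem' : v 2 ∈ Ideal.span (X '' ({0, 1} : Set (Fin 3)) : Set S) := by
    rw [mem_ideal_span_X_image] at hmem ⊢
    intro m hm
    obtain ⟨i, hi, hne⟩ := hmem (Finsupp.single 2 1 + m) (by
      rw [mem_support_iff] at hm ⊢
      rwa [coeff_X_mul])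
    refine ⟨i, hi, ?_⟩
    rcases hi with rfl | rfl <;> simpa using hne
  rw [Set.image_pair, Ideal.mem_span_pair] at hmem'
  obtain ⟨a, b, hab⟩ := hmem'
  have h1 : (X 0 : S) ∣ X 1 * (v 1 + b * X 2) := ⟨-(v 0 + a * X 2), by
    linear_combination h + X 2 * hab⟩
  have h2 := (X_prime.dvd_or_dvd h1).resolve_left fun h => by simpa using X_dvd_X.1 h
  obtain ⟨c, hc⟩ := h2
  have h3 : v 0 + a * X 2 = -c * X 1 := by
    refine mul_left_cancel₀ (X_ne_zero (R := k) (0 : Fin 3)) ?_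
    linear_combination h + X 2 * hab - X 1 * hc
  refine ⟨![b, -a, c], ?_⟩
  rw [cross_apply]
  funext i
  fin_cases i
  · simp; linear_combination h3
  · simp; linear_combination hc
  · simp; linear_combination -hab

end Field

end TernaryForms

namespace TernaryForms

open MvPolynomial
open scoped Matrix

/-! ### Saturation with respect to the variables. -/

section Depth

variable {k : Type*} [Field k]

local notation "S" => MvPolynomial (Fin 3) k

theorem cross_X_cross_X (r : Fin 3 → S) : X ⬝ᵥ (r ⨯₃ X) = 0 := dot_cross_self _ _

/-- The cofactors r_i in X_i e = d r_i form a vector parallel to X, and its ratio to X is the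
cofactor of e. -/
theorem mem_span_singleton_of_X_mul {d e : S} (h : ∀ i, X i * e ∈ Ideal.span {d}) :
    e ∈ Ideal.span {d} := by
  simp only [Ideal.mem_span_singleton] at h ⊢
  by_cases hd : d = 0
  · subst hd
    have := h 0
    rw [zero_dvd_iff, mul_eq_zero] at this
    rw [this.resolve_left (X_ne_zero _)]
  choose r hr using h
  obtain ⟨ρ, hρ⟩ : ∃ ρ : S, r = ρ • X := by
    refine exists_eq_smul_X ((cross_eq_zero_iff _ _).2 fun i j => mul_left_cancel₀ hd ?_)
    linear_combination X i * hr j - X j * hr i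
  refine ⟨ρ, mul_left_cancel₀ (X_ne_zero (R := k) (0 : Fin 3)) ?_⟩
  rw [hr 0, hρ]
  simp
  ring

/-- The maximal ideal at the origin is not associated to a complete intersection of two forms. -/
theorem mem_span_pair_of_X_mul {a b e : S} (hab : IsRelPrime a b) (hb : b ≠ 0)
    (h : ∀ i, X i * e ∈ Ideal.span {a, b}) : e ∈ Ideal.span {a, b} := by
  simp only [Ideal.mem_span_pair] at h ⊢
  choose r s hrs using h
  -- Comparing X_j (X_i e) with X_i (X_j e) puts a (r_i X_j - r_j X_i) into (b); coprimality removes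
  -- a.
  have hdvd : ∀ i j, b ∣ r i * X j - r j * X i := fun i j => by
    refine (IsRelPrime.dvd_of_dvd_mul_right hab.symm (?_ : b ∣ _ * a))
    exact ⟨s j * X i - s i * X j, by linear_combination X j * hrs i - X i * hrs j⟩
  have hc : ∀ i, b ∣ (r ⨯₃ X) i := fun i => by
    rw [cross_apply]
    fin_cases i
    · exact hdvd 1 2
    · simpa using! hdvd 2 0
    · exact hdvd 0 1
  choose κ hκ using hc
  have hκ' : r ⨯₃ X = b • κ := funext hκ
  -- The pair (r, s) may be changed by the trivial relation (b ν, -a ν). Koszul exactness supplies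
  -- the ν for which both corrected vectors are multiples of X.
  obtain ⟨ν, hν⟩ : ∃ ν, κ = ν ⨯₃ X := by
    refine exists_eq_cross_X (mul_left_cancel₀ hb ?_)
    rw [← smul_eq_mul, ← smul_dotProduct, ← hκ', dotProduct_comm, cross_X_cross_X, mul_zero]
  obtain ⟨ρ, hρ⟩ : ∃ ρ : S, r - b • ν = ρ • X := by
    refine exists_eq_smul_X ?_
    simp [hκ', hν]
  obtain ⟨σ, hσ⟩ : ∃ σ : S, s + a • ν = σ • X := by
    refine exists_eq_smul_X ((cross_eq_zero_iff _ _).2 fun i j => mul_left_cancel₀ hb ?_)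
    have e1 := congrFun hρ i
    have e2 := congrFun hρ j
    simp only [Pi.sub_apply, Pi.add_apply, Pi.smul_apply, smul_eq_mul] at e1 e2 ⊢
    linear_combination X j * hrs i - X i * hrs j - a * X j * e1 + a * X i * e2
  refine ⟨ρ, σ, mul_left_cancel₀ (X_ne_zero (R := k) (0 : Fin 3)) ?_⟩
  have e1 := congrFun hρ 0
  have e2 := congrFun hσ 0
  simp only [Pi.sub_apply, Pi.add_apply, Pi.smul_apply, smul_eq_mul] at e1 e2
  linear_combination hrs 0 - a * e1 - b * e2

/-- The maximal ideal at the origin is not associated to the ideal of the maximal minors of a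
`3 × 2` matrix whose minors have no common factor. -/
theorem mem_span_minors_of_X_mul {A B : Fin 3 → S} (hg : ∀ d, (∀ i, d ∣ (A ⨯₃ B) i) → IsUnit d)
    {e : S} (h : ∀ i, X i * e ∈ Ideal.span (Set.range (A ⨯₃ B))) :
    e ∈ Ideal.span (Set.range (A ⨯₃ B)) := by
  have hmem : ∀ f : S, f ∈ Ideal.span (Set.range (A ⨯₃ B)) ↔
      ∃ c : Fin 3 → S, c ⬝ᵥ (A ⨯₃ B) = f := fun f =>
    Submodule.mem_span_range_iff_exists_fun S
  simp only [hmem] at h ⊢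
  choose r hr using h
  -- X_j r_i - X_i r_j is a syzygy of the minors, hence a combination of the two columns.
  have hsyz : ∀ i j, ∃ α β : S, (X j : S) • r i - (X i : S) • r j = α • A + β • B := fun i j => by
    refine exists_eq_of_dotProduct_cross_eq_zero hg ?_
    rw [sub_dotProduct, smul_dotProduct, smul_dotProduct, hr, hr]
    simp only [smul_eq_mul]
    ring
  obtain ⟨j, hj⟩ : ∃ j, (A ⨯₃ B) j ≠ 0 := by
    by_contra! h0
    exact not_isUnit_zero (hg 0 fun i => by rw [h0 i])
  have hind : ∀ α β : S, α • A + β • B = 0 → α = 0 ∧ β = 0 := fun α β hαβ => by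
    constructor
    · have : α • (A ⨯₃ B) = 0 := by
        have := congrArg (fun v => v ⨯₃ B) hαβ
        simpa [cross_self] using this
      exact (mul_eq_zero.1 (congrFun this j)).resolve_right hj
    · have : β • (A ⨯₃ B) = 0 := by
        have := congrArg (fun v => A ⨯₃ v) hαβ
        simpa [cross_self] using this
      exact (mul_eq_zero.1 (congrFun this j)).resolve_right hj
  obtain ⟨α₀, β₀, h₀⟩ := hsyz 1 2
  obtain ⟨α₁, β₁, h₁⟩ := hsyz 2 0
  obtain ⟨α₂, β₂, h₂⟩ := hsyz 0 1
  -- The columns are independent, so the coefficients satisfy the Koszul cycle condition. They are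
  -- therefore boundaries, and subtracting ν_i A + ξ_i B from r_i leaves X_i ρ.
  obtain ⟨hα, hβ⟩ := hind (X 0 * α₀ + X 1 * α₁ + X 2 * α₂) (X 0 * β₀ + X 1 * β₁ + X 2 * β₂) (by
    have : (X 0 * α₀ + X 1 * α₁ + X 2 * α₂) • A + (X 0 * β₀ + X 1 * β₁ + X 2 * β₂) • B =
        (X 0 : S) • (α₀ • A + β₀ • B) + (X 1 : S) • (α₁ • A + β₁ • B) +
          (X 2 : S) • (α₂ • A + β₂ • B) := by module
    rw [this, ← h₀, ← h₁, ← h₂]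
    module)
  obtain ⟨ν, hν⟩ : ∃ ν, ![α₀, α₁, α₂] = ν ⨯₃ X := exists_eq_cross_X (by
    rw [dotProduct, Fin.sum_univ_three]; simp; linear_combination hα)
  obtain ⟨ξ, hξ⟩ : ∃ ξ, ![β₀, β₁, β₂] = ξ ⨯₃ X := exists_eq_cross_X (by
    rw [dotProduct, Fin.sum_univ_three]; simp; linear_combination hβ)
  have hpar : ∀ i j l, X j * (r i l - ν i * A l - ξ i * B l) =
      X i * (r j l - ν j * A l - ξ j * B l) := by
    rw [cross_apply] at hν hξ
    have a0 := congrFun hν 0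
    have a1 := congrFun hν 1
    have a2 := congrFun hν 2
    have b0 := congrFun hξ 0
    have b1 := congrFun hξ 1
    have b2 := congrFun hξ 2
    simp only [Matrix.cons_val] at a0 a1 a2 b0 b1 b2
    intro i j l
    have c0 := congrFun h₀ l
    have c1 := congrFun h₁ l
    have c2 := congrFun h₂ l
    simp only [Pi.sub_apply, Pi.add_apply, Pi.smul_apply, smul_eq_mul] at c0 c1 c2
    have d0 : X 2 * (r 1 l - ν 1 * A l - ξ 1 * B l) = X 1 * (r 2 l - ν 2 * A l - ξ 2 * B l) := by
      linear_combination c0 + A l * a0 + B l * b0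
    have d1 : X 0 * (r 2 l - ν 2 * A l - ξ 2 * B l) = X 2 * (r 0 l - ν 0 * A l - ξ 0 * B l) := by
      linear_combination c1 + A l * a1 + B l * b1
    have d2 : X 1 * (r 0 l - ν 0 * A l - ξ 0 * B l) = X 0 * (r 1 l - ν 1 * A l - ξ 1 * B l) := by
      linear_combination c2 + A l * a2 + B l * b2
    fin_cases i <;> fin_cases j <;>
      first
        | rfl | exact d0 | exact d1 | exact d2 | exact d0.symm | exact d1.symm | exact d2.symm
  have hρ : ∀ l, ∃ ρ : S, (fun i => r i l - ν i * A l - ξ i * B l) = ρ • X := fun l => by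
    refine exists_eq_smul_X ((cross_eq_zero_iff _ _).2 fun i j => ?_)
    linear_combination hpar i j l
  choose ρ hρ using hρ
  refine ⟨ρ, mul_left_cancel₀ (X_ne_zero (R := k) (0 : Fin 3)) ?_⟩
  have hr0 : r 0 = ν 0 • A + ξ 0 • B + (X 0 : S) • ρ := by
    funext l
    have := congrFun (hρ l) 0
    simp only [Pi.add_apply, Pi.smul_apply, smul_eq_mul] at this ⊢
    linear_combination this
  rw [← hr 0, hr0, add_dotProduct, add_dotProduct, smul_dotProduct, smul_dotProduct,
    smul_dotProduct, dot_self_cross, dot_cross_self]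
  simp

end Depth

theorem eval_smul_of_isHomogeneous {R : Type*} [CommRing R] {p : MvPolynomial (Fin 3) R} {n : ℕ}
    (hp : p.IsHomogeneous n) (s : R) (v : Fin 3 → R) : eval (s • v) p = s ^ n * eval v p := by
  rw [eval_eq', eval_eq', Finset.mul_sum]
  refine Finset.sum_congr rfl fun d hd => ?_
  have hd' : ∑ i, d i = n := by
    have := hp (mem_support_iff.1 hd)
    simpa [Finsupp.weight_apply, Finsupp.sum_fintype] using this
  simp only [Pi.smul_apply, smul_eq_mul, mul_pow, Finset.prod_mul_distrib, Finset.prod_pow_eq_pow_sum,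
    hd']
  ring

/-! ### Consequences of the Nullstellensatz. -/

section Nullstellensatz

variable {k : Type*} [Field k] [IsAlgClosed k]

local notation "S" => MvPolynomial (Fin 3) k

/-- An element lies in an ideal as soon as it does so away from the origin, if the maximal ideal at
the origin is not associated to the ideal. -/
theorem mem_of_forall_eval_eq_zero {a : Ideal S} {f : S}
    (h : ∀ v : Fin 3 → k, (∀ s, s * f ∈ a → eval v s = 0) → v = 0)
    (hsat : ∀ e, (∀ i, X i * e ∈ a) → e ∈ a) : f ∈ a := by
  by_contra hf
  obtain ⟨Q, hQ, hle⟩ := exists_le_isAssociatedPrime_of_isNoetherianRing S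
    (Ideal.Quotient.mk a f) (by rwa [Ne, Ideal.Quotient.eq_zero_iff_mem])
  rw [isAssociatedPrime_iff] at hQ
  obtain ⟨hprime, y, hy⟩ := hQ
  obtain ⟨e, rfl⟩ := Ideal.Quotient.mk_surjective y
  have hcolon : ∀ s g : S, s ∈ (⊥ : Submodule S (S ⧸ a)).colon {Ideal.Quotient.mk a g} ↔
      s * g ∈ a := fun s g => by
    rw [Submodule.mem_colon_singleton, Submodule.mem_bot, ← Ideal.Quotient.eq_zero_iff_mem,
      map_mul]
    rfl
  -- The annihilator of the class of f has no zero other than the origin, so its radical contains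
  -- the variables. They then lie in the associated prime Q above it, and an element with
  -- annihilator Q contradicts saturation.
  have hX : ∀ i, (X i : S) ∈ Q := fun i => by
    have : (X i : S) ∈ vanishingIdeal k (zeroLocus k ((⊥ : Submodule S (S ⧸ a)).colon
        {Ideal.Quotient.mk a f})) := by
      rw [mem_vanishingIdeal_iff]
      intro v hv
      rw [h v fun s hs => by simpa [aeval_eq_eval] using hv s ((hcolon s f).2 hs)]
      simp
    rw [vanishingIdeal_zeroLocus_eq_radical] at this
    exact (Ideal.IsPrime.radical_le_iff hprime).2 hle this
  have he : e ∈ a := hsat e fun i => (hcolon _ _).1 (hy ▸ hX i)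
  refine hprime.ne_top ((Ideal.eq_top_iff_one Q).2 ?_)
  rw [hy, hcolon, one_mul]
  exact he

/-- Two polynomials that vanish at the origin of three-space have another common zero. -/
theorem exists_common_zero {a b : S} (ha : eval 0 a = 0) (hb : eval 0 b = 0) :
    ∃ v : Fin 3 → k, v ≠ 0 ∧ eval v a = 0 ∧ eval v b = 0 := by
  by_contra! hno
  -- A common factor vanishing only at the origin would generate a saturated ideal with no other
  -- zeros, hence the unit ideal.
  have hsing : ∀ d : S, eval 0 d = 0 → d ∣ a → d ∣ b → False := fun d hd hda hdb => by
    have h1 : (1 : S) ∈ Ideal.span {d} := by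
      refine mem_of_forall_eval_eq_zero (fun v hv => ?_) fun e => mem_span_singleton_of_X_mul
      by_contra hv0
      have hdv : eval v d = 0 := hv d (by simp)
      obtain ⟨a', rfl⟩ := hda
      obtain ⟨b', rfl⟩ := hdb
      exact hno v hv0 (by simp [hdv]) (by simp [hdv])
    obtain ⟨c, hc⟩ := Ideal.mem_span_singleton.1 h1
    have := congrArg (eval 0) hc
    rw [map_mul, hd, zero_mul, map_one] at this
    exact one_ne_zero this
  by_cases hb0 : b = 0
  · exact hsing a ha dvd_rfl (hb0 ▸ dvd_zero a)
  obtain ⟨a', b', d, hrel, rfl, rfl⟩ := UniqueFactorizationMonoid.exists_reduced_factors' a b hb0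
  rw [map_mul, mul_eq_zero] at ha hb
  have hd : eval 0 d ≠ 0 := fun h => hsing d h (dvd_mul_right _ _) (dvd_mul_right _ _)
  replace ha := ha.resolve_left hd
  replace hb := hb.resolve_left hd
  have h1 : (1 : S) ∈ Ideal.span {a', b'} := by
    refine mem_of_forall_eval_eq_zero (fun v hv => ?_) fun e =>
      mem_span_pair_of_X_mul hrel (right_ne_zero_of_mul hb0)
    by_contra hv0
    refine hno v hv0 ?_ ?_
    · rw [map_mul, hv a' (by rw [mul_one]; exact Ideal.subset_span (by simp)), mul_zero]
    · rw [map_mul, hv b' (by rw [mul_one]; exact Ideal.subset_span (by simp)), mul_zero]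
  obtain ⟨c, c', hc⟩ := Ideal.mem_span_pair.1 h1
  have := congrArg (eval 0) hc
  rw [map_add, map_mul, map_mul, ha, hb, mul_zero, mul_zero, map_one, add_zero] at this
  exact zero_ne_one this

/-- A factor of a homogeneous polynomial that does not vanish at the origin is constant. -/
theorem isUnit_of_dvd_of_isHomogeneous {d a : S} {n : ℕ} (ha : a.IsHomogeneous n) (ha0 : a ≠ 0)
    (hda : d ∣ a) (hd : eval 0 d ≠ 0) : IsUnit d := by
  obtain ⟨e, rfl⟩ := hda
  have key : ∀ v : Fin 3 → k, eval v (d * e) ≠ 0 → eval v d = eval 0 d := by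
    intro v hv
    -- Restriction to the ray through v turns the product into a nonzero monomial. Its factor is
    -- then also a monomial up to a unit, and it is constant because it does not vanish at 0.
    let φ : S →ₐ[k] Polynomial k := aeval fun i => Polynomial.C (v i) * Polynomial.X
    have hφ : ∀ (p : S) (s : k), (φ p).eval s = eval (s • v) p := fun p s => by
      have : ((Polynomial.aeval s).comp φ : S →ₐ[k] k) = aeval (s • v) := by
        refine algHom_ext fun i => ?_
        simp only [AlgHom.comp_apply, φ, aeval_X, map_mul, Polynomial.aeval_C, Polynomial.aeval_X,
          Pi.smul_apply, smul_eq_mul, Algebra.algebraMap_self, RingHom.id_apply]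
        exact mul_comm _ _
      simpa [aeval_eq_eval] using! congrArg (fun f : S →ₐ[k] k => f p) this
    have hmul : φ d * φ e = Polynomial.C (eval v (d * e)) * Polynomial.X ^ n := by
      refine Polynomial.funext fun s => ?_
      rw [← map_mul, hφ, eval_smul_of_isHomogeneous ha, Polynomial.eval_mul, Polynomial.eval_C,
        Polynomial.eval_pow, Polynomial.eval_X, mul_comm]
    have hdvd : φ d ∣ Polynomial.X ^ n := by
      have hu : IsUnit (Polynomial.C (eval v (d * e))) := Polynomial.isUnit_C.2 hv.isUnit
      exact hu.dvd_mul_left.1 ⟨_, hmul.symm⟩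
    obtain ⟨i, -, hi⟩ := (dvd_prime_pow Polynomial.prime_X _).1 hdvd
    obtain ⟨u, hu⟩ := hi.symm
    obtain ⟨c, -, hc⟩ := Polynomial.isUnit_iff.1 u.isUnit
    rw [← hc] at hu
    have h0 : eval 0 d = (φ d).eval 0 := by rw [hφ, zero_smul]
    have hi0 : i = 0 := by
      by_contra hi0
      rw [h0, ← hu] at hd
      simp [hi0] at hd
    have h1 : eval v d = (φ d).eval 1 := by rw [hφ, one_smul]
    rw [h0, h1, ← hu, hi0]
    simp
  -- Multiplication by the form covers the vectors where it vanishes and the ray argument does not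
  -- apply.
  have hprod : (d - C (eval 0 d)) * (d * e) = 0 := by
    refine MvPolynomial.funext fun v => ?_
    rw [map_mul, map_sub, eval_C, map_zero]
    by_cases hv : eval v (d * e) = 0
    · rw [hv, mul_zero]
    · rw [key v hv, sub_self, zero_mul]
  rw [sub_eq_zero.1 ((mul_eq_zero.1 hprod).resolve_right ha0)]
  exact (Ne.isUnit hd).map C

end Nullstellensatz

end TernaryForms

/-! ### The Sylvester form is not in the square of the ideal. -/

namespace TernaryForms

open MvPolynomial
open scoped Matrix

variable {k : Type*} [Field k] [IsAlgClosed k]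

local notation "S" => MvPolynomial (Fin 3) k

theorem mul_sub_mul_mem_of_cross_mem {R : Type*} [CommRing R] {I : Ideal R} {v w : Fin 3 → R}
    (h : ∀ i, (v ⨯₃ w) i ∈ I) (i j : Fin 3) : v i * w j - v j * w i ∈ I := by
  have h0 : (Ideal.Quotient.mk I ∘ v) ⨯₃ (Ideal.Quotient.mk I ∘ w) = 0 := by
    rw [← map_cross]
    exact _root_.funext fun i => Ideal.Quotient.eq_zero_iff_mem.2 (h i)
  have := (cross_eq_zero_iff _ _).1 h0 i j
  rw [← Ideal.Quotient.eq_zero_iff_mem, map_sub, map_mul, map_mul, sub_eq_zero]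
  exact this

/-- A common factor vanishing at the origin would meet the plane with normal `c` outside the origin,
contrary to `hc`. Other factors of forms are constant. -/
theorem isUnit_of_forall_dvd {g : Fin 3 → S} {n : ℕ} (hg : ∀ i, (g i).IsHomogeneous n)
    (hne : g ≠ 0) {c : Fin 3 → k}
    (hc : ∀ v : Fin 3 → k, (∀ i, eval v (g i) = 0) → c ⬝ᵥ v = 0 → v = 0) (d : S)
    (hd : ∀ i, d ∣ g i) : IsUnit d := by
  obtain ⟨j, hj⟩ := Function.ne_iff.1 hne
  refine isUnit_of_dvd_of_isHomogeneous (hg j) hj (hd j) fun hd0 => ?_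
  obtain ⟨v, hv, h1, h2⟩ := exists_common_zero (b := ∑ i, C (c i) * X i) hd0 (by simp)
  refine hv (hc v (fun i => ?_) (by simpa [dotProduct] using h2))
  obtain ⟨e, he⟩ := hd i
  rw [he, map_mul, h1, zero_mul]

theorem exists_dotProduct_ne_zero {ι : Type*} [Finite ι] (u : ι → Fin 3 → k)
    (hu : ∀ i, u i ≠ 0) : ∃ t : Fin 3 → k, t ≠ 0 ∧ ∀ i, t ⬝ᵥ u i ≠ 0 := by
  have := Fintype.ofFinite ι
  have h1 : ∀ i, (∑ j, C (u i j) * X j : S) ≠ 0 := fun i h => hu i (by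
    funext j
    have := congrArg (coeff (Finsupp.single j 1)) h
    simpa [coeff_sum, coeff_C_mul, coeff_X, Finsupp.single_left_inj] using this)
  -- A product of nonzero linear forms does not vanish everywhere. The factor `X 0` forces t ≠ 0
  -- even when the index type is empty.
  have h2 : (X 0 * ∏ i, ∑ j, C (u i j) * X j : S) ≠ 0 :=
    mul_ne_zero (X_ne_zero _) (Finset.prod_ne_zero_iff.2 fun i _ => h1 i)
  obtain ⟨t, ht⟩ : ∃ t, eval t (X 0 * ∏ i, ∑ j, C (u i j) * X j : S) ≠ 0 := by
    by_contra! h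
    exact h2 (MvPolynomial.funext fun t => by rw [h t, map_zero])
  rw [map_mul, map_prod] at ht
  refine ⟨t, fun h => left_ne_zero_of_mul ht (by simp [h]), fun i hi => ?_⟩
  refine Finset.prod_ne_zero_iff.1 (right_ne_zero_of_mul ht) i (Finset.mem_univ i) ?_
  rw [← hi, dotProduct]
  simp [mul_comm]

/-- Let `A = P X` and `B = Q X` be the columns of a `3 × 2` matrix, let `g = A × B` be its maximal
minors, and let `F` be a polynomial such that the vector `(P g) × (Q g)` is a multiple of `F`
(so that `F` is the Sylvester form of the Rees algebra of the ideal of the minors). Then `F` does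
not belong to the square of the ideal of the minors. -/
theorem sylvester_notMem_sq {P Q : Matrix (Fin 3) (Fin 3) S} (hP : P.IsSymm) (hQ : Q.IsSymm)
    {A B g : Fin 3 → S} (hA : A = P *ᵥ X) (hB : B = Q *ᵥ X) (hg : g = A ⨯₃ B) {n m : ℕ}
    (hAn : ∀ i, (A i).IsHomogeneous n) (hBm : ∀ i, (B i).IsHomogeneous m)
    {t : Fin 3 → k} (ht : t ≠ 0)
    (hgen : ∀ v : Fin 3 → k, (∀ i, eval v (g i) = 0) → t ⬝ᵥ (fun i => eval v (A i)) = 0 →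
      t ⬝ᵥ (fun i => eval v (B i)) = 0 → v = 0)
    {F : S} (hF : F ≠ 0) {y : Fin 3 → S} (hw : (P *ᵥ g) ⨯₃ (Q *ᵥ g) = F • y) :
    F ∉ Ideal.span (Set.range g) ^ 2 := by
  intro hmem
  obtain ⟨M, hM⟩ := exists_quadratic_of_mem_sq hmem
  obtain ⟨l, hl⟩ := Function.ne_iff.1 ht
  let T : Fin 3 → S := fun i => C (t i)
  let a : S := T ⬝ᵥ A
  let b : S := T ⬝ᵥ B
  -- Modulo (a, b) this says that g is parallel to the constant vector T.
  have hTg : T ⨯₃ g = b • A - a • B := by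
    rw [hg, cross_cross_eq_smul_sub_smul', dotProduct_comm A T]
  have hcomp : ∀ i, T l * g i - g l * T i ∈ Ideal.span {a, b} := by
    have hc : ∀ i, b * A i - a * B i ∈ Ideal.span {a, b} := fun i =>
      Ideal.mem_span_pair.2 ⟨-B i, A i, by ring⟩
    have hc' : ∀ i, (T ⨯₃ g) i ∈ Ideal.span {a, b} := fun i => by rw [hTg]; exact hc i
    intro i
    rw [mul_comm (g l)]
    exact mul_sub_mul_mem_of_cross_mem hc' l i
  -- Since T_l ≠ 0, the proportionality makes all of g vanish where a, b and g_l do. So these three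
  -- have only the origin in common, and g_l cancels modulo (a, b).
  have heval : ∀ v : Fin 3 → k, eval v a = 0 → eval v b = 0 → eval v (g l) = 0 → v = 0 := by
    intro v ha hb hgl
    refine hgen v (fun i => ?_) ?_ ?_
    · obtain ⟨c, d, hcd⟩ := Ideal.mem_span_pair.1 (hcomp i)
      have := congrArg (eval v) hcd
      simp only [map_add, map_mul, map_sub, ha, hb, hgl, T, eval_C] at this
      have h2 : t l * eval v (g i) = 0 := by linear_combination -this
      exact (mul_eq_zero.1 h2).resolve_left hl
    · rw [← ha]
      simp [a, T, dotProduct]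
    · rw [← hb]
      simp [b, T, dotProduct]
  have hzero : ∀ (N : Matrix (Fin 3) (Fin 3) S) i, eval 0 ((N *ᵥ X) i) = 0 := fun N i => by
    simp [Matrix.mulVec, dotProduct]
  have hA0 : ∀ i, eval 0 (A i) = 0 := fun i => by rw [hA]; exact hzero P i
  have hB0 : ∀ i, eval 0 (B i) = 0 := fun i => by rw [hB]; exact hzero Q i
  have ha0 : eval 0 a = 0 := by
    simp only [a, dotProduct, map_sum, map_mul, hA0, mul_zero, Finset.sum_const_zero]
  have hb0 : eval 0 b = 0 := by
    simp only [b, dotProduct, map_sum, map_mul, hB0, mul_zero, Finset.sum_const_zero]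
  have hg0 : eval 0 (g l) = 0 := by
    have := congrFun (map_cross (eval (0 : Fin 3 → k)) A B) l
    rw [Function.comp_apply, ← hg] at this
    rw [this, show ⇑(eval (0 : Fin 3 → k)) ∘ A = 0 from _root_.funext hA0]
    simp
  have hhom : ∀ (V : Fin 3 → S) (n : ℕ), (∀ i, (V i).IsHomogeneous n) →
      (T ⬝ᵥ V).IsHomogeneous n := fun V n hV => by
    refine IsHomogeneous.sum _ _ _ fun i _ => ?_
    simpa using (isHomogeneous_C (Fin 3) (t i)).mul (hV i)
  have hcop : ∀ d : S, d ∣ a → d ∣ b → eval 0 d ≠ 0 := by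
    intro d hda hdb hd0
    obtain ⟨v, hv, h1, h2⟩ := exists_common_zero hd0 hg0
    refine hv (heval v ?_ ?_ h2)
    · obtain ⟨e, he⟩ := hda
      rw [he, map_mul, h1, zero_mul]
    · obtain ⟨e, he⟩ := hdb
      rw [he, map_mul, h1, zero_mul]
  have hrel : IsRelPrime a b := by
    intro d hda hdb
    by_cases ha : a = 0
    · by_cases hb : b = 0
      · exact absurd (map_zero _) (hcop 0 (by rw [ha]) (by rw [hb]))
      · exact isUnit_of_dvd_of_isHomogeneous (hhom B m hBm) hb hdb (hcop d hda hdb)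
    · exact isUnit_of_dvd_of_isHomogeneous (hhom A n hAn) ha hda (hcop d hda hdb)
  have ha : a ≠ 0 := fun h => hcop b (h ▸ dvd_zero b) dvd_rfl hb0
  have hb : b ≠ 0 := fun h => hcop a dvd_rfl (h ▸ dvd_zero a) ha0
  -- This is the equation (P g) × (Q g) = F y with g replaced by T and F by its quadratic expression
  -- in T. Multiplied by g_l², it lies in (a, b).
  let E : Fin 3 → S := (P *ᵥ T) ⨯₃ (Q *ᵥ T) - (T ⬝ᵥ M *ᵥ T) • y
  have hE : ∀ i, E i ∈ Ideal.span {a, b} := by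
    intro i
    refine mem_of_forall_eval_eq_zero (fun v hv => ?_) fun e => mem_span_pair_of_X_mul hrel hb
    have e1 : eval v a = 0 := hv a (Ideal.mul_mem_right _ _ (Ideal.subset_span (by simp)))
    have e2 : eval v b = 0 := hv b (Ideal.mul_mem_right _ _ (Ideal.subset_span (by simp)))
    have e3 : eval v (g l ^ 2) = 0 := by
      refine hv _ ?_
      rw [← Ideal.Quotient.eq_zero_iff_mem]
      let φ := Ideal.Quotient.mk (Ideal.span {a, b})
      have hφ : φ (T l) • (φ ∘ g) = φ (g l) • (φ ∘ T) := by
        funext j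
        have := Ideal.Quotient.eq_zero_iff_mem.2 (hcomp j)
        rw [map_sub, map_mul, map_mul, sub_eq_zero] at this
        simpa using this
      have hmv : ∀ (N : Matrix (Fin 3) (Fin 3) S) (V : Fin 3 → S),
          φ ∘ (N *ᵥ V) = N.map φ *ᵥ (φ ∘ V) := fun N V =>
        _root_.funext fun i => RingHom.map_mulVec φ N V i
      have h1 := smul_cross_mulVec (P.map φ) (Q.map φ) _ _ _ _ hφ
      have h2 := sq_mul_dotProduct (M.map φ) _ _ _ _ hφ
      rw [← hmv, ← hmv, ← hmv, ← hmv, ← map_cross, ← map_cross, hw] at h1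
      rw [← hmv, ← hmv, ← RingHom.map_dotProduct, ← RingHom.map_dotProduct, ← hM] at h2
      have h3 := congrFun h1 i
      simp only [Pi.smul_apply, Function.comp_apply, smul_eq_mul, map_mul] at h3
      change φ _ = 0
      simp only [E, Pi.sub_apply, Pi.smul_apply, smul_eq_mul, map_mul, map_sub, map_pow]
      linear_combination -h3 + φ (y i) * h2
    rw [map_pow] at e3
    exact heval v e1 e2 (pow_eq_zero_iff two_ne_zero |>.1 e3)
  have hgA : ∀ (N : Matrix (Fin 3) (Fin 3) S), N.IsSymm → ∀ V, X ⬝ᵥ (N *ᵥ V) = V ⬝ᵥ (N *ᵥ X) :=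
    fun N hN V => by
      rw [Matrix.dotProduct_mulVec, ← Matrix.mulVec_transpose, hN.eq, dotProduct_comm]
  -- By symmetry of P and Q, X·(P g) = g·A and X·(Q g) = g·B. Both vanish because g = A × B.
  have hXy : X ⨯₃ y = 0 := by
    have h1 : X ⨯₃ ((P *ᵥ g) ⨯₃ (Q *ᵥ g)) = 0 := by
      rw [cross_cross_eq_smul_sub_smul', hgA Q hQ, dotProduct_comm (P *ᵥ g), hgA P hP, ← hA, ← hB,
        hg, dotProduct_comm, dot_cross_self, dotProduct_comm, dot_self_cross]
      simp
    rw [hw, map_smul] at h1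
    exact (smul_eq_zero.1 h1).resolve_left hF
  have hXE : X ⨯₃ E = b • (P *ᵥ T) - a • (Q *ᵥ T) := by
    have hXa : X ⬝ᵥ (P *ᵥ T) = a := by rw [hgA P hP, ← hA]
    have hXb : X ⬝ᵥ (Q *ᵥ T) = b := by rw [hgA Q hQ, ← hB]
    simp only [E]
    rw [map_sub, map_smul, hXy, smul_zero, sub_zero, cross_cross_eq_smul_sub_smul', hXb,
      dotProduct_comm, hXa]
  simp only [Ideal.mem_span_pair] at hE
  choose c d hcd using hE
  have hE' : E = a • c + b • d := by
    funext i
    rw [← hcd]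
    simp [mul_comm]
  -- Inserting E = a c + b d gives b (P T - X × d) = a (Q T + X × c), and b is coprime to a.
  have hdvd : ∀ i, a ∣ (P *ᵥ T - X ⨯₃ d) i := by
    intro i
    refine IsRelPrime.dvd_of_dvd_mul_left hrel ⟨(Q *ᵥ T + X ⨯₃ c) i, ?_⟩
    rw [hE', map_add, map_smul, map_smul] at hXE
    have := congrFun hXE i
    simp only [Pi.sub_apply, Pi.add_apply, Pi.smul_apply, smul_eq_mul] at this ⊢
    linear_combination -this
  choose κ hκ using hdvd
  -- The product with X removes X × d and turns P T into a. Cancelling a leaves X·κ = 1, which is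
  -- impossible at the origin.
  have h1 : a = a * (X ⬝ᵥ κ) := by
    have h2 : X ⬝ᵥ (P *ᵥ T - X ⨯₃ d) = X ⬝ᵥ (a • κ) := congrArg _ (_root_.funext hκ)
    rw [dotProduct_sub, dot_self_cross, sub_zero, dotProduct_smul, hgA P hP, ← hA] at h2
    exact h2
  have h2 : X ⬝ᵥ κ = 1 := (mul_left_cancel₀ ha ((mul_one a).trans h1)).symm
  have h3 := congrArg (eval 0) h2
  simp [dotProduct] at h3

end TernaryForms

namespace TernaryForms

open MvPolynomial
open scoped Matrix

/-! ### Restriction of forms to lines. -/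

section Along

variable {k : Type*} [Field k]

local notation "S" => MvPolynomial (Fin 3) k

/-- The restriction of a polynomial to the parametrized line `p + s v`. -/
noncomputable def along (p v : Fin 3 → k) : S →ₐ[k] Polynomial k :=
  aeval fun i => Polynomial.C (p i) + Polynomial.C (v i) * Polynomial.X

theorem eval_along (p v : Fin 3 → k) (f : S) (s : k) :
    (along p v f).eval s = eval (p + s • v) f := by
  have : ((Polynomial.aeval s).comp (along p v) : S →ₐ[k] k) = aeval (p + s • v) := by
    refine algHom_ext fun i => ?_
    simp only [AlgHom.comp_apply, along, aeval_X, map_add, map_mul, Polynomial.aeval_C,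
      Polynomial.aeval_X, Pi.add_apply, Pi.smul_apply, smul_eq_mul, Algebra.algebraMap_self,
      RingHom.id_apply, mul_comm]
  have h2 := congrArg (fun f' : S →ₐ[k] k => f' f) this
  rw [← coe_aeval_eq_eval, ← Polynomial.coe_aeval_eq_eval]
  exact h2

theorem natDegree_along_le (p v : Fin 3 → k) {f : S} {n : ℕ} (hf : f.IsHomogeneous n) :
    (along p v f).natDegree ≤ n := by
  have := aeval_natDegree_le (n := 1) f hf.totalDegree_le
    (fun i => Polynomial.C (p i) + Polynomial.C (v i) * Polynomial.X) fun i => by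
      rw [add_comm]
      exact Polynomial.natDegree_linear_le
  rwa [mul_one] at this

variable [Infinite k]

/-- Exchanging `p` and `e` reverses the coefficients of the restricted form, so the value at `e` is
the coefficient of sⁿ. -/
theorem along_ne_zero {p e : Fin 3 → k} {h : S} {n : ℕ} (hh : h.IsHomogeneous n)
    (he : eval e h ≠ 0) : along p e h ≠ 0 := by
  intro h0
  have h1 : along e p h = 0 := by
    by_contra hne
    refine hne (Polynomial.eq_zero_of_infinite_isRoot _ ?_)
    refine Set.Infinite.mono (s := {0}ᶜ) (fun s hs => ?_) (Set.finite_singleton 0).infinite_compl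
    have hs : s ≠ 0 := hs
    have h2 := eval_along p e h s⁻¹
    rw [h0, Polynomial.eval_zero] at h2
    change (along e p h).eval s = 0
    have h3 : e + s • p = s • (p + s⁻¹ • e) := by
      rw [smul_add, smul_smul, mul_inv_cancel₀ hs, one_smul, add_comm]
    rw [eval_along, h3, eval_smul_of_isHomogeneous hh, ← h2, mul_zero]
  have h2 := eval_along e p h 0
  rw [h1, zero_smul, add_zero, Polynomial.eval_zero] at h2
  exact he h2.symm

/-- A form of degree `n` with `n` distinct zeros on a line has no other zeros on it. -/
theorem roots_along {p e : Fin 3 → k} {h : S} {n : ℕ} (hh : h.IsHomogeneous n)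
    (he : eval e h ≠ 0) {R : Finset k} (hR : ∀ s ∈ R, eval (p + s • e) h = 0) (hn : n ≤ R.card) :
    (along p e h).roots = R.val := by
  symm
  refine Multiset.eq_of_le_of_card_le ?_ ?_
  · rw [Multiset.le_iff_subset R.nodup]
    intro s hs
    rw [Polynomial.mem_roots (along_ne_zero hh he), Polynomial.IsRoot, eval_along]
    exact hR s hs
  · exact (Polynomial.card_roots' _).trans ((natDegree_along_le p e hh).trans hn)

/-- With as many distinct roots as the degree allows, every root is simple, including the one at 0.
-/
theorem coeff_one_along_ne_zero {p e : Fin 3 → k} {h : S} {n : ℕ} (hh : h.IsHomogeneous n)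
    (he : eval e h ≠ 0) {R : Finset k} (hR : ∀ s ∈ R, eval (p + s • e) h = 0) (hn : n ≤ R.card)
    (h0 : eval p h = 0) : (along p e h).coeff 1 ≠ 0 := by
  classical
  intro h1
  have hc0 : (along p e h).coeff 0 = 0 := by
    rw [Polynomial.coeff_zero_eq_eval_zero, eval_along, zero_smul, add_zero, h0]
  have hdvd : (Polynomial.X - Polynomial.C 0) ^ 2 ∣ along p e h := by
    rw [map_zero, sub_zero, Polynomial.X_pow_dvd_iff]
    intro d hd
    interval_cases d
    · exact hc0
    · exact h1
  have h2 := (Polynomial.le_rootMultiplicity_iff (along_ne_zero hh he)).2 hdvd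
  rw [← Polynomial.count_roots, roots_along hh he hR hn] at h2
  have := Multiset.nodup_iff_count_le_one.1 R.nodup 0
  lia

end Along

/-! ### Local generators of the ideal of a point. -/

section Local

variable {k : Type*} [Field k]

local notation "S" => MvPolynomial (Fin 3) k

/-- The linear form with given coefficients. -/
noncomputable def linearForm (n : Fin 3 → k) : S := (C ∘ n) ⬝ᵥ X

theorem eval_linearForm (n v : Fin 3 → k) : eval v (linearForm n) = n ⬝ᵥ v := by
  simp [linearForm, dotProduct]

theorem linearForm_isHomogeneous (n : Fin 3 → k) : (linearForm n).IsHomogeneous 1 := by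
  refine IsHomogeneous.sum _ _ _ fun i _ => ?_
  simpa using (isHomogeneous_C (Fin 3) (n i)).mul (isHomogeneous_X k i)

theorem linearForm_ne_zero {n : Fin 3 → k} (hn : n ≠ 0) : linearForm n ≠ 0 := by
  intro h
  refine hn (funext fun i => ?_)
  have := congrArg (eval (Pi.single i 1)) h
  rwa [eval_linearForm, dotProduct_single, mul_one, map_zero] at this

theorem irreducible_linearForm {n : Fin 3 → k} (hn : n ≠ 0) : Irreducible (linearForm n) := by
  have hne := linearForm_ne_zero hn
  refine irreducible_of_totalDegree_eq_one
    ((linearForm_isHomogeneous n).totalDegree hne) fun x hx => ?_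
  obtain ⟨d, hd⟩ := MvPolynomial.exists_coeff_ne_zero hne
  exact (ne_zero_of_dvd_ne_zero hd (hx d)).isUnit

variable [Infinite k]

/-- A polynomial that vanishes on the line where two linear forms vanish belongs to the ideal
of the two forms. -/
theorem mem_span_linearForm_pair {m n : Fin 3 → k} (hmn : m ⨯₃ n ≠ 0) {f : S}
    (hf : ∀ s : k, eval (s • (m ⨯₃ n)) f = 0) :
    f ∈ Ideal.span {linearForm m, linearForm n} := by
  obtain ⟨l, hl⟩ := Function.ne_iff.1 hmn
  rw [Pi.zero_apply] at hl
  set c := m ⨯₃ n with hc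
  have hcomp : ∀ i, C (c l) * X i - C (c i) * X l ∈ Ideal.span {linearForm m, linearForm n} := by
    intro i
    refine mul_sub_mul_mem_of_cross_mem (v := C ∘ c) (w := X) (fun j => ?_) l i
    rw [hc, map_cross, cross_cross_eq_smul_sub_smul]
    refine Ideal.mem_span_pair.2 ⟨C (n j), -C (m j), ?_⟩
    simp [linearForm]
    ring
  let lam : S := C (c l)⁻¹ * X l
  have hX : ∀ i, X i - C (c i) * lam ∈ Ideal.span {linearForm m, linearForm n} := by
    intro i
    have h1 := Ideal.mul_mem_left _ (C (c l)⁻¹) (hcomp i)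
    have h2 : (C (c l)⁻¹ : S) * C (c l) = 1 := by
      rw [← C_mul, inv_mul_cancel₀ hl, C_1]
    have h3 : C (c l)⁻¹ * (C (c l) * X i - C (c i) * X l) = X i - C (c i) * lam := by
      simp only [lam]
      linear_combination X i * h2
    rwa [h3] at h1
  have h0 : along 0 c f = 0 := by
    refine Polynomial.funext fun s => ?_
    rw [eval_along, zero_add, hf, Polynomial.eval_zero]
  rw [← Ideal.Quotient.eq_zero_iff_mem]
  -- Modulo the two forms each X_i equals c_i times `lam`, so the quotient map factors through
  -- restriction to the line spanned by c.
  have hhom : (Ideal.Quotient.mkₐ k (Ideal.span {linearForm m, linearForm n})) =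
      ((Ideal.Quotient.mkₐ k (Ideal.span {linearForm m, linearForm n})).comp
        (Polynomial.aeval lam)).comp (along 0 c) := by
    refine algHom_ext fun i => ?_
    have := Ideal.Quotient.eq_zero_iff_mem.2 (hX i)
    rw [map_sub, sub_eq_zero] at this
    simp only [along, AlgHom.comp_apply, aeval_X, map_mul, Polynomial.aeval_C,
      Polynomial.aeval_X, Pi.zero_apply, map_zero, zero_add]
    rw [map_mul] at this
    exact this
  have := congrArg (fun φ : S →ₐ[k] _ => φ f) hhom
  simp only [AlgHom.comp_apply, h0, map_zero] at this
  exact this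

/-- If the differential of `g` has rank two at the point `m × n`, then the components of `g`
generate the ideal of that point locally. -/
theorem exists_mul_mem_span_range {g : Fin 3 → S} {f : S} {m n u v : Fin 3 → k}
    (hmn : m ⨯₃ n ≠ 0) (hf : ∀ s : k, eval (s • (m ⨯₃ n)) f = 0)
    (hg : ∀ (i : Fin 3) (s : k), eval (s • (m ⨯₃ n)) (g i) = 0) (hu : m ⬝ᵥ u = 0) (hv : n ⬝ᵥ v = 0)
    (hD : (fun j => (along (m ⨯₃ n) u (g j)).coeff 1) ⨯₃
      (fun j => (along (m ⨯₃ n) v (g j)).coeff 1) ≠ 0) :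
    ∃ s : S, eval (m ⨯₃ n) s ≠ 0 ∧ s * f ∈ Ideal.span (Set.range g) := by
  have hgm := fun i => Ideal.mem_span_pair.1 (mem_span_linearForm_pair hmn (hg i))
  choose a b hab using hgm
  obtain ⟨f₁, f₂, rfl⟩ := Ideal.mem_span_pair.1 (mem_span_linearForm_pair hmn hf)
  have hform : ∀ w z : Fin 3 → k, along (m ⨯₃ n) w (linearForm z) =
      Polynomial.C (z ⬝ᵥ m ⨯₃ n) + Polynomial.C (z ⬝ᵥ w) * Polynomial.X := fun w z => by
    refine Polynomial.funext fun s => ?_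
    rw [eval_along, eval_linearForm]
    simp only [dotProduct_add, dotProduct_smul, smul_eq_mul, Polynomial.eval_add,
      Polynomial.eval_C, Polynomial.eval_mul, Polynomial.eval_X]
    ring
  have hcoeff : ∀ (q : S) (w : Fin 3 → k) (t : k),
      (along (m ⨯₃ n) w q * (Polynomial.C t * Polynomial.X)).coeff 1 = eval (m ⨯₃ n) q * t := by
    intro q w t
    have h1 : (along (m ⨯₃ n) w q).coeff 0 = eval (m ⨯₃ n) q := by
      rw [Polynomial.coeff_zero_eq_eval_zero, eval_along, zero_smul, add_zero]
    rw [← mul_assoc, Polynomial.coeff_mul_X, Polynomial.coeff_mul_C, h1]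
  have hDu : (fun j => (along (m ⨯₃ n) u (g j)).coeff 1) =
      (n ⬝ᵥ u) • fun j => eval (m ⨯₃ n) (b j) := by
    funext j
    rw [← hab j, map_add, map_mul, map_mul, hform, hform, hu, dot_self_cross, dot_cross_self]
    simp only [map_zero, zero_mul, add_zero, zero_add, mul_zero]
    rw [hcoeff]
    simp [mul_comm]
  have hDv : (fun j => (along (m ⨯₃ n) v (g j)).coeff 1) =
      (m ⬝ᵥ v) • fun j => eval (m ⨯₃ n) (a j) := by
    funext j
    rw [← hab j, map_add, map_mul, map_mul, hform, hform, hv, dot_self_cross, dot_cross_self]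
    simp only [map_zero, zero_mul, add_zero, zero_add, mul_zero]
    rw [hcoeff]
    simp [mul_comm]
  -- The derivatives along u and v are multiples of the values of b and a at the point. Rank two
  -- therefore makes some minor of the coefficients nonzero, and Cramer's rule expresses both linear
  -- forms through g_i and g_j after multiplication by that minor.
  obtain ⟨i, j, hij⟩ : ∃ i j, eval (m ⨯₃ n) (b i * a j - b j * a i) ≠ 0 := by
    by_contra! h
    refine hD ?_
    rw [hDu, hDv, LinearMap.map_smul₂, map_smul]
    have : (fun j => eval (m ⨯₃ n) (b j)) ⨯₃ (fun j => eval (m ⨯₃ n) (a j)) = 0 := by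
      rw [cross_eq_zero_iff]
      intro i j
      have := h i j
      simp only [map_sub, map_mul] at this
      linear_combination this
    rw [this, smul_zero, smul_zero]
  refine ⟨b i * a j - b j * a i, hij, ?_⟩
  have hmem : ∀ i, g i ∈ Ideal.span (Set.range g) := fun i => Ideal.subset_span ⟨i, rfl⟩
  have : (b i * a j - b j * a i) * (f₁ * linearForm m + f₂ * linearForm n) =
      (f₁ * b i - f₂ * a i) * g j + (f₂ * a j - f₁ * b j) * g i := by
    rw [← hab i, ← hab j]
    ring
  rw [this]
  exact add_mem (Ideal.mul_mem_left _ _ (hmem j)) (Ideal.mul_mem_left _ _ (hmem i))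

end Local

/-! ### Divisibility by products of linear forms. -/

section Divisibility

variable {k : Type*} [Field k] [IsAlgClosed k]

local notation "S" => MvPolynomial (Fin 3) k

/-- A nonzero linear form generates a prime ideal, so the Nullstellensatz gives divisibility without
passing to a power. -/
theorem linearForm_dvd {n : Fin 3 → k} (hn : n ≠ 0) {f : S}
    (h : ∀ v, n ⬝ᵥ v = 0 → eval v f = 0) : linearForm n ∣ f := by
  have := IsAlgClosed.instInfinite (K := k)
  rw [← Ideal.mem_span_singleton]
  have hprime : (Ideal.span {linearForm n}).IsPrime :=
    (Ideal.span_singleton_prime (linearForm_ne_zero hn)).2 (irreducible_linearForm hn).prime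
  rw [← hprime.radical, ← vanishingIdeal_zeroLocus_eq_radical (K := k), mem_vanishingIdeal_iff]
  intro v hv
  have := hv _ (Ideal.mem_span_singleton_self _)
  rw [aeval_eq_eval] at this ⊢
  refine h v ?_
  rw [← eval_linearForm]
  exact this

theorem prod_linearForm_dvd {ι : Type*} [Fintype ι] {n : ι → Fin 3 → k}
    (hn : ∀ i j, i ≠ j → n i ⨯₃ n j ≠ 0) (hn0 : ∀ i, n i ≠ 0) {f : S}
    (h : ∀ i v, n i ⬝ᵥ v = 0 → eval v f = 0) : ∏ i, linearForm (n i) ∣ f := by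
  have := IsAlgClosed.instInfinite (K := k)
  refine Finset.prod_dvd_of_isRelPrime (fun i _ j _ hij => ?_) fun i _ => linearForm_dvd (hn0 i) (h i)
  refine (irreducible_linearForm (hn0 i)).isRelPrime_iff_not_dvd.2 fun hdvd => ?_
  obtain ⟨c, hc⟩ := hdvd
  refine hn i j hij ?_
  have hperp : ∀ v, n i ⬝ᵥ v = 0 → n j ⬝ᵥ v = 0 := fun v hv => by
    have hc : linearForm (n j) = linearForm (n i) * c := hc
    rw [← eval_linearForm, hc, map_mul, eval_linearForm, hv, zero_mul]
  funext l
  have h1 := hperp (n i ⨯₃ Pi.single l 1) (dot_self_cross _ _)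
  rw [triple_product_permutation, triple_product_permutation, single_dotProduct, one_mul] at h1
  rw [← cross_anticomm, Pi.neg_apply, h1, neg_zero, Pi.zero_apply]

end Divisibility

end TernaryForms

/-! ### Exact arithmetic in ℤ[μ₁, ω] and the explicit data. -/

namespace Wiman

open scoped Matrix

/-- Elements `a + b μ₁ + (c + d μ₁) ω` of the ring `ℤ[μ₁, ω]`. -/
structure Eis where
  a : ℤ
  b : ℤ
  c : ℤ
  d : ℤ

namespace Eis

def add (x y : Eis) : Eis := ⟨x.a + y.a, x.b + y.b, x.c + y.c, x.d + y.d⟩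

def sub (x y : Eis) : Eis := ⟨x.a - y.a, x.b - y.b, x.c - y.c, x.d - y.d⟩

def mul (x y : Eis) : Eis :=
  ⟨x.a * y.a + x.b * y.b - (x.c * y.c + x.d * y.d),
    x.a * y.b + x.b * y.a - x.b * y.b - (x.c * y.d + x.d * y.c - x.d * y.d),
    x.a * y.c + x.b * y.d + (x.c * y.a + x.d * y.b) - (x.c * y.c + x.d * y.d),
    x.a * y.d + x.b * y.c - x.b * y.d + (x.c * y.b + x.d * y.a - x.d * y.b) -
      (x.c * y.d + x.d * y.c - x.d * y.d)⟩

/-- Complex conjugation. -/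
def conj (x : Eis) : Eis := ⟨x.a - x.c, x.b - x.d, -x.c, -x.d⟩

def isZero (x : Eis) : Bool := x.a == 0 && x.b == 0 && x.c == 0 && x.d == 0

end Eis

/-- Vectors over `ℤ[μ₁, ω]`. -/
structure EVec where
  x : Eis
  y : Eis
  z : Eis

namespace EVec

def dot (v w : EVec) : Eis := ((v.x.mul w.x).add (v.y.mul w.y)).add (v.z.mul w.z)

def cross (v w : EVec) : EVec :=
  ⟨(v.y.mul w.z).sub (v.z.mul w.y), (v.z.mul w.x).sub (v.x.mul w.z),
    (v.x.mul w.y).sub (v.y.mul w.x)⟩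

def conj (v : EVec) : EVec := ⟨v.x.conj, v.y.conj, v.z.conj⟩

def isZero (v : EVec) : Bool := v.x.isZero && v.y.isZero && v.z.isZero

end EVec

/-- Matrices over `ℤ[μ₁, ω]`, by rows. -/
structure EMat where
  x : EVec
  y : EVec
  z : EVec

namespace EVec

def zero : EVec := ⟨⟨0, 0, 0, 0⟩, ⟨0, 0, 0, 0⟩, ⟨0, 0, 0, 0⟩⟩

def add (v w : EVec) : EVec := ⟨v.x.add w.x, v.y.add w.y, v.z.add w.z⟩

def sub (v w : EVec) : EVec := ⟨v.x.sub w.x, v.y.sub w.y, v.z.sub w.z⟩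

def smul (r : Eis) (v : EVec) : EVec := ⟨r.mul v.x, r.mul v.y, r.mul v.z⟩

end EVec

namespace EMat

def zero : EMat := ⟨.zero, .zero, .zero⟩

def add (M N : EMat) : EMat := ⟨M.x.add N.x, M.y.add N.y, M.z.add N.z⟩

def smul (r : Eis) (M : EMat) : EMat := ⟨M.x.smul r, M.y.smul r, M.z.smul r⟩

def mulVec (M : EMat) (v : EVec) : EVec := ⟨M.x.dot v, M.y.dot v, M.z.dot v⟩

def transpose (M : EMat) : EMat :=
  ⟨⟨M.x.x, M.y.x, M.z.x⟩, ⟨M.x.y, M.y.y, M.z.y⟩, ⟨M.x.z, M.y.z, M.z.z⟩⟩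

def conj (M : EMat) : EMat := ⟨M.x.conj, M.y.conj, M.z.conj⟩

/-- The product `Mᵀ N`. -/
def transposeMul (M N : EMat) : EMat :=
  (⟨N.transpose.mulVec M.transpose.x, N.transpose.mulVec M.transpose.y,
    N.transpose.mulVec M.transpose.z⟩ : EMat)

def isEq (M N : EMat) : Bool :=
  (M.x.sub N.x).isZero && (M.y.sub N.y).isZero && (M.z.sub N.z).isZero

def trace (M : EMat) : Eis := (M.x.x.add M.y.y).add M.z.z

end EMat

/-- Integral multiples of the generating matrices. -/
def gens : List EMat := [
  ⟨⟨⟨1, 0, 0, 0⟩, ⟨0, 0, 0, 0⟩, ⟨0, 0, 0, 0⟩⟩,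
    ⟨⟨0, 0, 0, 0⟩, ⟨-1, 0, 0, 0⟩, ⟨0, 0, 0, 0⟩⟩,
    ⟨⟨0, 0, 0, 0⟩, ⟨0, 0, 0, 0⟩, ⟨-1, 0, 0, 0⟩⟩⟩,
  ⟨⟨⟨0, 0, 0, 0⟩, ⟨1, 0, 0, 0⟩, ⟨0, 0, 0, 0⟩⟩,
    ⟨⟨0, 0, 0, 0⟩, ⟨0, 0, 0, 0⟩, ⟨1, 0, 0, 0⟩⟩,
    ⟨⟨1, 0, 0, 0⟩, ⟨0, 0, 0, 0⟩, ⟨0, 0, 0, 0⟩⟩⟩,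
  ⟨⟨⟨-1, 0, 0, 0⟩, ⟨-1, -1, 0, 0⟩, ⟨0, 1, 0, 0⟩⟩,
    ⟨⟨-1, -1, 0, 0⟩, ⟨0, 1, 0, 0⟩, ⟨-1, 0, 0, 0⟩⟩,
    ⟨⟨0, 1, 0, 0⟩, ⟨-1, 0, 0, 0⟩, ⟨-1, -1, 0, 0⟩⟩⟩,
  ⟨⟨⟨-1, 0, 0, 0⟩, ⟨0, 0, 0, 0⟩, ⟨0, 0, 0, 0⟩⟩,
    ⟨⟨0, 0, 0, 0⟩, ⟨0, 0, 0, 0⟩, ⟨0, 0, -1, 0⟩⟩,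
    ⟨⟨0, 0, 0, 0⟩, ⟨1, 0, 1, 0⟩, ⟨0, 0, 0, 0⟩⟩⟩]

def gen (s : ℕ) : EMat := gens.getD s .zero

/-- The symmetric matrices of the six conics that are permuted by the group. -/
def conics : List EMat := [
  ⟨⟨⟨4, 0, 0, 0⟩, ⟨0, 0, 0, 0⟩, ⟨0, 0, 0, 0⟩⟩,
    ⟨⟨0, 0, 0, 0⟩, ⟨4, 0, 0, 0⟩, ⟨0, 0, 0, 0⟩⟩,
    ⟨⟨0, 0, 0, 0⟩, ⟨0, 0, 0, 0⟩, ⟨4, 0, 0, 0⟩⟩⟩,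
  ⟨⟨⟨4, 0, 0, 0⟩, ⟨0, 0, 0, 0⟩, ⟨0, 0, 0, 0⟩⟩,
    ⟨⟨0, 0, 0, 0⟩, ⟨0, 0, 4, 0⟩, ⟨0, 0, 0, 0⟩⟩,
    ⟨⟨0, 0, 0, 0⟩, ⟨0, 0, 0, 0⟩, ⟨-4, 0, -4, 0⟩⟩⟩,
  ⟨⟨⟨0, 1, 1, 2⟩, ⟨1, 2, -1, 1⟩, ⟨1, -1, 2, 1⟩⟩,
    ⟨⟨1, 2, -1, 1⟩, ⟨1, 1, 0, -1⟩, ⟨-2, -1, -1, -2⟩⟩,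
    ⟨⟨1, -1, 2, 1⟩, ⟨-2, -1, -1, -2⟩, ⟨-1, -2, -1, -1⟩⟩⟩,
  ⟨⟨⟨0, 1, 1, 2⟩, ⟨-1, -2, 1, -1⟩, ⟨-1, 1, -2, -1⟩⟩,
    ⟨⟨-1, -2, 1, -1⟩, ⟨1, 1, 0, -1⟩, ⟨-2, -1, -1, -2⟩⟩,
    ⟨⟨-1, 1, -2, -1⟩, ⟨-2, -1, -1, -2⟩, ⟨-1, -2, -1, -1⟩⟩⟩,
  ⟨⟨⟨-1, -2, -1, -1⟩, ⟨-1, 1, -2, -1⟩, ⟨-2, -1, -1, -2⟩⟩,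
    ⟨⟨-1, 1, -2, -1⟩, ⟨0, 1, 1, 2⟩, ⟨-1, -2, 1, -1⟩⟩,
    ⟨⟨-2, -1, -1, -2⟩, ⟨-1, -2, 1, -1⟩, ⟨1, 1, 0, -1⟩⟩⟩,
  ⟨⟨⟨-1, -2, -1, -1⟩, ⟨1, -1, 2, 1⟩, ⟨2, 1, 1, 2⟩⟩,
    ⟨⟨1, -1, 2, 1⟩, ⟨0, 1, 1, 2⟩, ⟨-1, -2, 1, -1⟩⟩,
    ⟨⟨2, 1, 1, 2⟩, ⟨-1, -2, 1, -1⟩, ⟨1, 1, 0, -1⟩⟩⟩]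

def conic (i : Fin 6) : EMat := conics.getD i .zero

/-- The permutations of the six conics induced by the inverses of the generators. -/
def genPerm : ℕ → Equiv.Perm (Fin 6)
  | 0 => Equiv.swap 2 3 * Equiv.swap 4 5
  | 1 => Equiv.swap 3 4 * Equiv.swap 3 5
  | 2 => Equiv.swap 1 2 * Equiv.swap 4 5
  | _ => Equiv.swap 0 1 * Equiv.swap 4 5

/-- The inverse permutations. -/
def genPermInv : ℕ → Equiv.Perm (Fin 6)
  | 0 => Equiv.swap 4 5 * Equiv.swap 2 3
  | 1 => Equiv.swap 3 5 * Equiv.swap 3 4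
  | 2 => Equiv.swap 4 5 * Equiv.swap 1 2
  | _ => Equiv.swap 4 5 * Equiv.swap 0 1

/-- The scalars with which the generators transform the six conics. -/
def genScalar (s : ℕ) (i : Fin 6) : Eis :=
  (([[⟨1, 0, 0, 0⟩, ⟨1, 0, 0, 0⟩, ⟨1, 0, 0, 0⟩, ⟨1, 0, 0, 0⟩, ⟨1, 0, 0, 0⟩, ⟨1, 0, 0, 0⟩],
    [⟨1, 0, 0, 0⟩, ⟨-1, 0, -1, 0⟩, ⟨0, 0, 1, 0⟩, ⟨1, 0, 0, 0⟩, ⟨0, 0, 1, 0⟩, ⟨-1, 0, -1, 0⟩],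
    [⟨1, 0, 0, 0⟩, ⟨1, 0, 0, 0⟩, ⟨1, 0, 0, 0⟩, ⟨1, 0, 0, 0⟩, ⟨0, 0, 1, 0⟩, ⟨-1, 0, -1, 0⟩],
    [⟨1, 0, 0, 0⟩, ⟨1, 0, 0, 0⟩, ⟨1, 0, 0, 0⟩, ⟨1, 0, 0, 0⟩, ⟨1, 0, 0, 0⟩, ⟨1, 0, 0, 0⟩]] :
    List (List Eis)).getD s []).getD i ⟨0, 0, 0, 0⟩

/-- The squares of the denominators of the generating matrices. -/
def genScale (s : ℕ) : Eis := if s = 2 then ⟨4, 0, 0, 0⟩ else ⟨1, 0, 0, 0⟩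

/-- The centres of the reflections in the group. -/
def centers : List EVec := [
  ⟨⟨1, 0, 0, 0⟩, ⟨0, 0, 0, 0⟩, ⟨0, 0, 0, 0⟩⟩,
  ⟨⟨0, 0, 0, 0⟩, ⟨0, 0, 0, 0⟩, ⟨1, 0, 0, 0⟩⟩,
  ⟨⟨1, 0, 0, 0⟩, ⟨1, 1, 0, 0⟩, ⟨0, -1, 0, 0⟩⟩,
  ⟨⟨0, 0, 0, 0⟩, ⟨1, 0, 0, 0⟩, ⟨0, 0, 0, 0⟩⟩,
  ⟨⟨1, 0, 0, 0⟩, ⟨-1, -1, 0, 0⟩, ⟨-2, -1, 0, 0⟩⟩,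
  ⟨⟨1, 0, 0, 0⟩, ⟨-1, -1, 0, 0⟩, ⟨0, 1, 0, 0⟩⟩,
  ⟨⟨1, 0, 0, 0⟩, ⟨-1, 1, 0, 0⟩, ⟨0, 1, 0, 0⟩⟩,
  ⟨⟨1, 0, 0, 0⟩, ⟨0, 0, 0, -1⟩, ⟨-1, -1, -1, -1⟩⟩,
  ⟨⟨1, 0, 0, 0⟩, ⟨1, 1, 0, 0⟩, ⟨2, 1, 0, 0⟩⟩,
  ⟨⟨1, 0, 0, 0⟩, ⟨0, 0, -2, -1⟩, ⟨1, 1, 1, 1⟩⟩,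
  ⟨⟨1, 0, 0, 0⟩, ⟨-1, 1, 0, 0⟩, ⟨0, -1, 0, 0⟩⟩,
  ⟨⟨1, 0, 0, 0⟩, ⟨0, 0, 0, 1⟩, ⟨1, 1, 1, 1⟩⟩,
  ⟨⟨1, 0, 0, 0⟩, ⟨1, -1, 0, 0⟩, ⟨0, -1, 0, 0⟩⟩,
  ⟨⟨1, 0, 0, 0⟩, ⟨0, 0, 0, 1⟩, ⟨1, -1, 1, -1⟩⟩,
  ⟨⟨1, 0, 0, 0⟩, ⟨1, 1, 0, 0⟩, ⟨0, 1, 0, 0⟩⟩,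
  ⟨⟨1, 0, 0, 0⟩, ⟨0, 0, 2, 1⟩, ⟨-1, -1, -1, -1⟩⟩,
  ⟨⟨1, 0, 0, 0⟩, ⟨1, -1, 0, 0⟩, ⟨0, 1, 0, 0⟩⟩,
  ⟨⟨1, 0, 0, 0⟩, ⟨1, 1, 0, 0⟩, ⟨-2, -1, 0, 0⟩⟩,
  ⟨⟨1, 0, 0, 0⟩, ⟨0, 0, 0, -1⟩, ⟨1, -1, 1, -1⟩⟩,
  ⟨⟨1, 0, 0, 0⟩, ⟨0, 0, -2, -1⟩, ⟨-1, -1, -1, -1⟩⟩,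
  ⟨⟨0, 0, 0, 0⟩, ⟨1, 0, 0, 0⟩, ⟨1, 0, 1, 0⟩⟩,
  ⟨⟨1, 0, 0, 0⟩, ⟨-1, -1, 0, 0⟩, ⟨2, 1, 0, 0⟩⟩,
  ⟨⟨1, 0, 0, 0⟩, ⟨0, 0, 0, -1⟩, ⟨-1, 1, -1, 1⟩⟩,
  ⟨⟨1, 0, 0, 0⟩, ⟨-1, -1, 0, 0⟩, ⟨0, -1, 0, 0⟩⟩,
  ⟨⟨1, 0, 0, 0⟩, ⟨0, 0, 0, 1⟩, ⟨-1, -1, -1, -1⟩⟩,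
  ⟨⟨1, 0, 0, 0⟩, ⟨0, 0, 0, 1⟩, ⟨-1, 1, -1, 1⟩⟩,
  ⟨⟨2, 0, 0, 0⟩, ⟨-1, -1, 0, -1⟩, ⟨1, 0, 1, 1⟩⟩,
  ⟨⟨1, 0, 0, 0⟩, ⟨1, 0, 1, 0⟩, ⟨0, 0, 0, 0⟩⟩,
  ⟨⟨1, 0, 0, 0⟩, ⟨0, 0, 2, 1⟩, ⟨1, 1, 1, 1⟩⟩,
  ⟨⟨1, 0, 0, 0⟩, ⟨0, 0, 0, 0⟩, ⟨0, 0, -1, 0⟩⟩,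
  ⟨⟨1, 0, 0, 0⟩, ⟨0, 0, 0, -1⟩, ⟨1, 1, 1, 1⟩⟩,
  ⟨⟨2, 0, 0, 0⟩, ⟨1, 1, 0, 1⟩, ⟨-1, 0, -1, -1⟩⟩,
  ⟨⟨1, 0, 0, 0⟩, ⟨-1, 0, -1, 0⟩, ⟨-1, 0, 0, 1⟩⟩,
  ⟨⟨1, 0, 0, 0⟩, ⟨0, -1, -1, -1⟩, ⟨0, 0, 1, 0⟩⟩,
  ⟨⟨1, 0, 0, 0⟩, ⟨-1, 0, -1, 0⟩, ⟨0, 0, 0, 0⟩⟩,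
  ⟨⟨1, 0, 0, 0⟩, ⟨-1, 0, -1, 0⟩, ⟨1, 0, 0, -1⟩⟩,
  ⟨⟨1, 0, 0, 0⟩, ⟨0, 0, 0, 0⟩, ⟨0, 0, 1, 0⟩⟩,
  ⟨⟨1, 0, 0, 0⟩, ⟨0, 1, 1, 1⟩, ⟨0, 0, 1, 0⟩⟩,
  ⟨⟨1, 0, 0, 0⟩, ⟨1, 0, 1, 0⟩, ⟨1, 0, 0, -1⟩⟩,
  ⟨⟨1, 0, 0, 0⟩, ⟨0, 1, 1, 1⟩, ⟨0, 0, -1, 0⟩⟩,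
  ⟨⟨1, 0, 0, 0⟩, ⟨1, 0, 1, 0⟩, ⟨-1, 0, 0, 1⟩⟩,
  ⟨⟨0, 0, 0, 0⟩, ⟨1, 0, 0, 0⟩, ⟨-1, 0, -1, 0⟩⟩,
  ⟨⟨1, 0, 0, 0⟩, ⟨0, -1, -1, -1⟩, ⟨0, 0, -1, 0⟩⟩,
  ⟨⟨2, 0, 0, 0⟩, ⟨-1, -1, 0, -1⟩, ⟨-1, 0, -1, -1⟩⟩,
  ⟨⟨2, 0, 0, 0⟩, ⟨1, 1, 0, 1⟩, ⟨1, 0, 1, 1⟩⟩]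

/-- For each centre a generator `s` and an earlier centre that `s` takes to it. -/
def parents : List (ℕ × ℕ) := [(0, 0), (1, 0), (2, 0), (1, 1), (2, 1), (0, 2), (1, 2), (3, 2), (0,
  4), (3, 4), (1, 5), (3, 5), (0, 6), (3, 6), (1, 8), (3, 8), (0, 10), (1, 10), (3, 10), (1, 11),
  (2, 11), (1, 12), (3, 12), (0, 14), (3, 14), (1, 15), (2, 15), (2, 18), (0, 19), (2, 19), (1,
  22), (2, 22), (2, 24), (2, 25), (0, 27), (2, 28), (0, 29), (2, 30), (0, 32), (0, 33), (0, 35),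
  (1, 36), (0, 37), (1, 39), (1, 42)]

/-- For each point where lines of the configuration meet, the list of these lines. -/
def incidence : List (List ℕ) := [
  [0, 1, 29, 36], [0, 2, 5], [0, 3, 27, 34], [0, 4, 8, 10, 16], [0, 6, 12, 17, 21], [0, 7, 11],
  [0, 9, 15, 18, 25], [0, 13, 19, 22, 28], [0, 14, 23], [0, 20, 43, 44], [0, 24, 30],
  [0, 26, 31, 41], [0, 32, 38], [0, 33, 39], [0, 35, 40], [0, 37, 42], [1, 2, 8, 14, 17],
  [1, 3, 20, 41], [1, 4, 5, 21, 23], [1, 6, 10], [1, 7, 18, 22, 30], [1, 9, 19],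
  [1, 11, 13, 24, 25], [1, 12, 16], [1, 15, 28], [1, 26, 43], [1, 27, 38, 40], [1, 31, 44],
  [1, 32, 34, 35], [1, 33, 42], [1, 37, 39], [2, 3, 10, 12, 23], [2, 4, 19, 40], [2, 6, 18, 39],
  [2, 7, 20], [2, 9, 29, 31, 35], [2, 11, 41, 44], [2, 13, 26, 27, 33], [2, 15, 22, 43],
  [2, 16, 21], [2, 24, 42], [2, 25, 34], [2, 28, 36], [2, 30, 38], [2, 32, 37], [3, 4, 17],
  [3, 5, 6, 14, 16], [3, 7, 15, 19, 24], [3, 8, 21], [3, 9, 11, 28, 30], [3, 13, 18], [3, 22, 25],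
  [3, 26, 44], [3, 29, 39, 42], [3, 31, 43], [3, 32, 40], [3, 33, 36, 37], [3, 35, 38],
  [4, 6, 11, 43], [4, 7, 27, 31, 37], [4, 9, 20, 32, 33], [4, 12, 14], [4, 13, 29], [4, 15, 41],
  [4, 18, 36, 42], [4, 22, 44], [4, 24, 28, 39], [4, 25, 38], [4, 26, 35], [4, 30, 34],
  [5, 7, 41, 43], [5, 8, 28, 35], [5, 9, 13, 44], [5, 10, 17], [5, 11, 20], [5, 12, 25, 33],
  [5, 15, 26, 36, 40], [5, 18, 27], [5, 19, 29], [5, 22, 31, 34, 39], [5, 24, 32], [5, 30, 37],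
  [5, 38, 42], [6, 7, 26, 29, 32], [6, 8, 23], [6, 9, 27], [6, 13, 20, 35, 37], [6, 15, 44],
  [6, 19, 34, 38], [6, 22, 41], [6, 24, 36], [6, 25, 30, 40], [6, 28, 42], [6, 31, 33],
  [7, 8, 12, 44], [7, 9, 17, 42], [7, 10, 13, 38], [7, 14, 40], [7, 16, 36], [7, 21, 34],
  [7, 23, 39], [7, 25, 28], [7, 33, 35], [8, 9, 41], [8, 11, 26, 34, 42], [8, 13, 43],
  [8, 15, 20, 38, 39], [8, 18, 32], [8, 19, 30, 33], [8, 22, 36], [8, 24, 27], [8, 25, 29, 37],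
  [8, 31, 40], [9, 10, 34, 40], [9, 12, 43], [9, 14, 21, 38], [9, 16, 39], [9, 22, 24],
  [9, 23, 36], [9, 26, 37], [10, 11, 29], [10, 14, 22, 37], [10, 15, 33], [10, 18, 20],
  [10, 19, 27], [10, 21, 24, 26], [10, 25, 32, 39, 41], [10, 28, 31], [10, 30, 35, 36, 43],
  [10, 42, 44], [11, 12, 31, 36, 38], [11, 14, 33], [11, 15, 21, 37], [11, 16, 22, 32],
  [11, 17, 27], [11, 18, 19], [11, 23, 35], [11, 39, 40], [12, 13, 41], [12, 15, 34],
  [12, 18, 24, 35], [12, 19, 37], [12, 20, 22, 40, 42], [12, 26, 39], [12, 27, 28, 32],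
  [12, 29, 30], [13, 14, 34], [13, 15, 30], [13, 16, 23, 42], [13, 17, 36, 39], [13, 21, 40],
  [13, 31, 32], [14, 15, 29], [14, 18, 26, 28], [14, 19, 32, 36, 44], [14, 20, 24, 31],
  [14, 25, 27, 42, 43], [14, 30, 41], [14, 35, 39], [15, 16, 27, 35], [15, 17, 23, 32],
  [15, 31, 42], [16, 17, 30, 31], [16, 18, 33, 38, 41], [16, 19, 26], [16, 20, 25],
  [16, 24, 29, 40, 44], [16, 28, 34], [16, 37, 43], [17, 18, 29], [17, 19, 20], [17, 22, 35],
  [17, 24, 33, 34, 43], [17, 25, 26], [17, 28, 37, 40, 41], [17, 38, 44], [18, 21, 31],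
  [18, 23, 34, 37, 44], [18, 40, 43], [19, 21, 35, 41, 42], [19, 23, 25, 31], [19, 39, 43],
  [20, 21, 28], [20, 23, 26, 30], [20, 27, 29], [20, 34, 36], [21, 22, 29, 33], [21, 25, 36],
  [21, 27, 30, 39, 44], [21, 32, 43], [22, 23, 27], [22, 26, 38], [23, 24, 41],
  [23, 28, 29, 38, 43], [23, 33, 40], [24, 37, 38], [25, 35, 44], [27, 36, 41], [28, 33, 44],
  [29, 34, 41], [30, 32, 42]]

def center (i : ℕ) : EVec := centers.getD i .zero

/-- The coefficients of the equation of the mirror with a given centre. -/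
def normal (i : ℕ) : EVec := (center i).conj

def point : List ℕ → EVec
  | i :: j :: _ => (normal i).cross (normal j)
  | _ => .zero

/-! ### Finite verifications. -/

theorem conic_check : (List.range 4).all (fun s => (List.finRange 6).all fun i =>
    ((gen s).transposeMul ((conic i).transposeMul (gen s))).isEq
      ((conic (genPermInv s i)).smul ((genScale s).mul (genScalar s i)))) = true := by
  decide +kernel

theorem conic_symm_check : (List.finRange 6).all (fun i =>
    (conic i).transpose.isEq (conic i)) = true := by
  decide +kernel

theorem unitary_check : (List.range 4).all (fun s => ((gen s).conj.transposeMul (gen s)).isEq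
    ((EMat.smul (genScale s) ⟨⟨⟨1, 0, 0, 0⟩, ⟨0, 0, 0, 0⟩, ⟨0, 0, 0, 0⟩⟩,
      ⟨⟨0, 0, 0, 0⟩, ⟨1, 0, 0, 0⟩, ⟨0, 0, 0, 0⟩⟩,
      ⟨⟨0, 0, 0, 0⟩, ⟨0, 0, 0, 0⟩, ⟨1, 0, 0, 0⟩⟩⟩))) = true := by
  decide +kernel

theorem genScalar_check : (List.range 4).all (fun s => (List.finRange 6).all fun i =>
    (((genScalar s i).mul ((genScalar s i).mul (genScalar s i))).sub ⟨1, 0, 0, 0⟩).isZero) =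
      true := by
  decide +kernel

/-- The vanishing patterns of these traces differ from conic to conic, so they recognize a conic up
to scale. The nonzero traces are also what controls the scalars in `toPGL_eq_one`. -/
theorem trace_check : (List.finRange 6).all (fun i => (List.finRange 6).all fun j =>
    ((conic i).transposeMul (conic j)).trace.isZero ==
      decide (i = 0 ∧ j ≠ 0 ∨ i ≠ 0 ∧ j = 0 ∨ i ≠ 0 ∧ i = j)) = true := by
  decide +kernel

/-- The parents form a tree rooted at the centre (1, 0, 0), which puts all the centres in one orbit.
-/
theorem parent_check : (List.range 45).all (fun i => !(center i).isZero && (i == 0 ||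
    Nat.ble ((parents.getD i (0, 0)).2 + 1) i && Nat.ble ((parents.getD i (0, 0)).1 + 1) 4 &&
      (((gen (parents.getD i (0, 0)).1).mulVec (center (parents.getD i (0, 0)).2)).cross
        (center i)).isZero)) = true := by
  decide +kernel

theorem normal_check : (List.range 45).all (fun i => (List.range i).all fun j =>
    !((normal i).cross (normal j)).isZero) = true := by
  decide +kernel

theorem incidence_check : incidence.all (fun l =>
    (List.range 45).filter (fun i => ((normal i).dot (point l)).isZero) == l) = true := by
  decide +kernel

/-- Completeness of the list: no intersection of two mirrors is missing. -/
theorem incidence_pair_check : (List.range 45).all (fun i => (List.range i).all fun j =>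
    incidence.any fun l => l.contains i && l.contains j) = true := by
  decide +kernel

theorem incidence_count_check : (incidence.all fun l => 3 ≤ l.length) ∧
    incidence.length = 201 ∧ incidence.countP (fun l => l.length = 3) = 120 ∧
    incidence.countP (fun l => l.length = 4) = 45 ∧
    incidence.countP (fun l => l.length = 5) = 36 := by
  decide +kernel

theorem incidence_nodup : incidence.Nodup := by
  decide +kernel

/-- The bound 16 is the degree of the components of `jacobianForm`. -/
theorem incidence_line_check : (List.range 45).all (fun i =>
    Nat.ble 16 (incidence.countP fun l => l.contains i)) = true := by
  decide +kernel

def EVec.quad (M : EMat) (v : EVec) : Eis := v.dot (M.mulVec v)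

def Eis.pow (x : Eis) : ℕ → Eis
  | 0 => ⟨1, 0, 0, 0⟩
  | n + 1 => x.mul (x.pow n)

/-- The sum of `q_i(v)ⁿ Q_i` over the six conics. -/
def conicSum (n : ℕ) (v : EVec) : EMat :=
  (List.finRange 6).foldr (fun i N => ((conic i).smul ((EVec.quad (conic i) v).pow n)).add N) .zero

def jacobianVec (v : EVec) : EVec := ((conicSum 2 v).mulVec v).cross ((conicSum 5 v).mulVec v)

def sylvesterVec (v : EVec) : EVec :=
  ((conicSum 2 v).mulVec (jacobianVec v)).cross ((conicSum 5 v).mulVec (jacobianVec v))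

/-- The test vector lies on the mirror x₀ = 0; the group carries nonvanishing to the other mirrors.
-/
theorem jacobianVec_check :
    (jacobianVec ⟨⟨0, 0, 0, 0⟩, ⟨1, 0, 0, 0⟩, ⟨1, 0, 0, 0⟩⟩).isZero = false := by
  decide +kernel

theorem sylvesterVec_check :
    (sylvesterVec ⟨⟨1, 0, 0, 0⟩, ⟨1, 0, 0, 0⟩, ⟨2, 0, 0, 0⟩⟩).isZero = false := by
  decide +kernel

end Wiman

/-! ### Comparison of the exact arithmetic with the complex numbers. -/

namespace Wiman

open scoped Matrix

theorem μ₁_sq : μ₁ ^ 2 = 1 - μ₁ := by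
  unfold μ₁
  linear_combination (1 / 4 : ℂ) * sqrtFive_sq

theorem μ₂_eq : μ₂ = -1 - μ₁ := by
  unfold μ₁ μ₂
  ring

theorem ω_sq : ω ^ 2 = -1 - ω := by
  have h1 : ω ≠ 1 := by
    have := (Complex.isPrimitiveRoot_exp 3 (by norm_num)).ne_one (by norm_num)
    simpa [ω] using this
  have h2 : (ω - 1) * (ω ^ 2 + ω + 1) = 0 := by linear_combination ω_pow_three
  linear_combination (mul_eq_zero.1 h2).resolve_left (sub_ne_zero.2 h1)

theorem im_ω_ne_zero : ω.im ≠ 0 := by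
  intro h
  have h1 := congrArg Complex.re ω_sq
  simp [sq, h] at h1
  nlinarith [sq_nonneg (2 * ω.re + 1)]

theorem conj_ω : starRingEnd ℂ ω = -1 - ω := by
  have h1 : ω * starRingEnd ℂ ω = 1 := by
    rw [Complex.mul_conj, Complex.normSq_eq_norm_sq]
    have : ‖ω‖ = 1 := by
      have h3 := congrArg norm ω_pow_three
      rw [norm_pow, norm_one] at h3
      exact (pow_eq_one_iff_of_nonneg (norm_nonneg _) (by norm_num)).1 h3
    simp [this]
  have h0 : ω ≠ 0 := fun h => by simp [h] at h1
  refine mul_left_cancel₀ h0 ?_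
  rw [h1]
  linear_combination ω_sq

theorem conj_μ₁ : starRingEnd ℂ μ₁ = μ₁ := by
  simp [μ₁, sqrtFive, map_ofNat]

namespace Eis

/-- The complex number represented by an element of `ℤ[μ₁, ω]`. -/
noncomputable def toC (x : Eis) : ℂ := x.a + x.b * μ₁ + (x.c + x.d * μ₁) * ω

theorem toC_add (x y : Eis) : (x.add y).toC = x.toC + y.toC := by
  simp only [toC, add]; push_cast; ring

theorem toC_sub (x y : Eis) : (x.sub y).toC = x.toC - y.toC := by
  simp only [toC, sub]; push_cast; ring

theorem toC_mul (x y : Eis) : (x.mul y).toC = x.toC * y.toC := by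
  simp only [toC, mul]; push_cast
  have h1 := μ₁_sq
  have h2 := ω_sq
  linear_combination (-(x.b * y.b) - (x.b * y.d + x.d * y.b) * ω + x.d * y.d * (1 + ω)) * h1 -
    (x.c + x.d * μ₁) * (y.c + y.d * μ₁) * h2

theorem toC_conj (x : Eis) : x.conj.toC = (starRingEnd ℂ) x.toC := by
  simp only [toC, conj, map_add, map_mul, map_intCast, conj_ω, conj_μ₁]; push_cast; ring

/-- Since ω is not real, the coefficient of ω and the remaining part vanish separately; each is then
settled by the irrationality of √5. -/
theorem toC_eq_zero_iff (x : Eis) : x.toC = 0 ↔ x.isZero = true := by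
  have hirr : ∀ a b : ℤ, (a + b * ((√5 - 1) / 2) : ℝ) = 0 → a = 0 ∧ b = 0 := by
    intro a b h
    have hb : b = 0 := by
      by_contra hb
      have hs : Irrational √5 := by
        simpa using Nat.Prime.irrational_sqrt (p := 5) (by norm_num)
      have hb' : (b : ℝ) ≠ 0 := by exact_mod_cast hb
      refine hs ⟨(b - 2 * a) / b, ?_⟩
      push_cast
      field_simp
      linarith
    subst hb
    simpa using h
  have hre : x.toC = ((x.a + x.b * ((√5 - 1) / 2) : ℝ) : ℂ) +
      ((x.c + x.d * ((√5 - 1) / 2) : ℝ) : ℂ) * ω := by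
    simp only [toC, μ₁, sqrtFive]; push_cast; ring
  simp only [isZero, Bool.and_eq_true, beq_iff_eq]
  constructor
  · intro h
    rw [hre] at h
    have him := congrArg Complex.im h
    rw [Complex.add_im, Complex.ofReal_im, Complex.im_ofReal_mul, zero_add, Complex.zero_im,
      mul_eq_zero] at him
    have h0 := him.resolve_right im_ω_ne_zero
    rw [h0, Complex.ofReal_zero, zero_mul, add_zero] at h
    obtain ⟨h1, h2⟩ := hirr _ _ h0
    obtain ⟨h3, h4⟩ := hirr _ _ (Complex.ofReal_eq_zero.1 h)
    exact ⟨⟨⟨h3, h4⟩, h1⟩, h2⟩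
  · rintro ⟨⟨⟨h1, h2⟩, h3⟩, h4⟩
    simp [toC, h1, h2, h3, h4]

end Eis

namespace EVec

/-- The complex vector represented by a vector over `ℤ[μ₁, ω]`. -/
noncomputable def toC (v : EVec) : Fin 3 → ℂ := ![v.x.toC, v.y.toC, v.z.toC]

theorem toC_add (v w : EVec) : (v.add w).toC = v.toC + w.toC := by
  simp [toC, add, Eis.toC_add]

theorem toC_sub (v w : EVec) : (v.sub w).toC = v.toC - w.toC := by
  simp [toC, sub, Eis.toC_sub]

theorem toC_smul (r : Eis) (v : EVec) : (v.smul r).toC = r.toC • v.toC := by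
  simp [toC, smul, Eis.toC_mul]

theorem toC_dot (v w : EVec) : (v.dot w).toC = v.toC ⬝ᵥ w.toC := by
  simp [toC, dot, Eis.toC_mul, Eis.toC_add, dotProduct, Fin.sum_univ_three]

theorem toC_cross (v w : EVec) : (v.cross w).toC = v.toC ⨯₃ w.toC := by
  simp [toC, cross, Eis.toC_mul, Eis.toC_sub, cross_apply]

theorem toC_conj (v : EVec) : v.conj.toC = star v.toC := by
  funext i
  fin_cases i <;> simp [toC, conj, Eis.toC_conj]

theorem toC_eq_zero_iff (v : EVec) : v.toC = 0 ↔ v.isZero = true := by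
  simp only [isZero, Bool.and_eq_true, ← Eis.toC_eq_zero_iff]
  constructor
  · intro h
    exact ⟨⟨congrFun h 0, congrFun h 1⟩, congrFun h 2⟩
  · rintro ⟨⟨h1, h2⟩, h3⟩
    simp [toC, h1, h2, h3]

theorem toC_zero : zero.toC = 0 := (toC_eq_zero_iff _).2 rfl

end EVec

namespace EMat

/-- The complex matrix represented by a matrix over `ℤ[μ₁, ω]`. -/
noncomputable def toC (M : EMat) : Matrix (Fin 3) (Fin 3) ℂ := .of ![M.x.toC, M.y.toC, M.z.toC]

theorem toC_add (M N : EMat) : (M.add N).toC = M.toC + N.toC := by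
  simp only [toC, add, EVec.toC_add]
  rw [Matrix.of_add_of]
  simp

theorem toC_smul (r : Eis) (M : EMat) : (M.smul r).toC = r.toC • M.toC := by
  simp [toC, smul, EVec.toC_smul, Matrix.smul_of]

theorem toC_mulVec (M : EMat) (v : EVec) : (M.mulVec v).toC = M.toC *ᵥ v.toC := by
  funext i
  fin_cases i
  · exact EVec.toC_dot M.x v
  · exact EVec.toC_dot M.y v
  · exact EVec.toC_dot M.z v

theorem toC_transpose (M : EMat) : M.transpose.toC = M.toCᵀ := by
  ext i j
  fin_cases i <;> fin_cases j <;> rfl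

theorem toC_transposeMul (M N : EMat) : (M.transposeMul N).toC = M.toCᵀ * N.toC := by
  ext i j
  have h : ∀ v : EVec, (N.transpose.mulVec v).toC j = v.toC ⬝ᵥ fun l => N.toC l j := fun v => by
    rw [toC_mulVec, toC_transpose, Matrix.mulVec, dotProduct_comm]
    rfl
  fin_cases i
  · exact h M.transpose.x
  · exact h M.transpose.y
  · exact h M.transpose.z

theorem toC_conj (M : EMat) : M.conj.toC = M.toC.map star := by
  ext i j
  have := fun v : EVec => congrFun (EVec.toC_conj v) j
  fin_cases i <;> exact this _

theorem toC_eq_of_isEq {M N : EMat} (h : M.isEq N = true) : M.toC = N.toC := by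
  simp only [isEq, Bool.and_eq_true, ← EVec.toC_eq_zero_iff, EVec.toC_sub, sub_eq_zero] at h
  rw [toC, toC, h.1.1, h.1.2, h.2]

theorem toC_trace (M : EMat) : M.trace.toC = M.toC.trace := by
  simp [trace, Matrix.trace, Fin.sum_univ_three, Eis.toC_add, toC, EVec.toC]

theorem toC_zero : zero.toC = 0 := by
  ext i j
  fin_cases i <;> simp [toC, zero, EVec.toC_zero]

end EMat

/-- The generators as elements of the special linear group. -/
noncomputable def genSL : ℕ → SL(3, ℂ)
  | 0 => ⟨M₁, det_M₁⟩
  | 1 => ⟨M₂, det_M₂⟩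
  | 2 => ⟨M₃, det_M₃⟩
  | _ => ⟨M₄, det_M₄⟩

/-- The factor `r` clears denominators: 2 for `M₃`, 1 otherwise. That it is real lets it pass
through the conjugate transpose. -/
theorem exists_toC_gen_eq (s : ℕ) (hs : s < 4) :
    ∃ r : ℂ, r ≠ 0 ∧ star r = r ∧ (genScale s).toC = r ^ 2 ∧
      (gen s).toC = r • (genSL s : Matrix (Fin 3) (Fin 3) ℂ) := by
  have hμ := μ₂_eq
  have hω := ω_sq
  interval_cases s
  · refine ⟨1, one_ne_zero, star_one _, by simp [genScale, Eis.toC], ?_⟩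
    have h : gen 0 = ⟨⟨⟨1, 0, 0, 0⟩, ⟨0, 0, 0, 0⟩, ⟨0, 0, 0, 0⟩⟩,
        ⟨⟨0, 0, 0, 0⟩, ⟨-1, 0, 0, 0⟩, ⟨0, 0, 0, 0⟩⟩,
        ⟨⟨0, 0, 0, 0⟩, ⟨0, 0, 0, 0⟩, ⟨-1, 0, 0, 0⟩⟩⟩ := rfl
    rw [h]
    rw [show (genSL 0 : Matrix (Fin 3) (Fin 3) ℂ) = M₁ from rfl]
    ext i j
    fin_cases i <;> fin_cases j <;> simp [EMat.toC, EVec.toC, Eis.toC, M₁]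
  · refine ⟨1, one_ne_zero, star_one _, by simp [genScale, Eis.toC], ?_⟩
    have h : gen 1 = ⟨⟨⟨0, 0, 0, 0⟩, ⟨1, 0, 0, 0⟩, ⟨0, 0, 0, 0⟩⟩,
        ⟨⟨0, 0, 0, 0⟩, ⟨0, 0, 0, 0⟩, ⟨1, 0, 0, 0⟩⟩,
        ⟨⟨1, 0, 0, 0⟩, ⟨0, 0, 0, 0⟩, ⟨0, 0, 0, 0⟩⟩⟩ := rfl
    rw [h]
    rw [show (genSL 1 : Matrix (Fin 3) (Fin 3) ℂ) = M₂ from rfl]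
    ext i j
    fin_cases i <;> fin_cases j <;> simp [EMat.toC, EVec.toC, Eis.toC, M₂]
  · refine ⟨2, two_ne_zero, by simp, by simp [genScale, Eis.toC]; norm_num, ?_⟩
    have h : gen 2 = ⟨⟨⟨-1, 0, 0, 0⟩, ⟨-1, -1, 0, 0⟩, ⟨0, 1, 0, 0⟩⟩,
        ⟨⟨-1, -1, 0, 0⟩, ⟨0, 1, 0, 0⟩, ⟨-1, 0, 0, 0⟩⟩,
        ⟨⟨0, 1, 0, 0⟩, ⟨-1, 0, 0, 0⟩, ⟨-1, -1, 0, 0⟩⟩⟩ := rfl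
    rw [h]
    rw [show (genSL 2 : Matrix (Fin 3) (Fin 3) ℂ) = M₃ from rfl]
    ext i j
    fin_cases i <;> fin_cases j <;> simp [EMat.toC, EVec.toC, Eis.toC, M₃, hμ] <;> ring
  · refine ⟨1, one_ne_zero, star_one _, by simp [genScale, Eis.toC], ?_⟩
    have h : gen 3 = ⟨⟨⟨-1, 0, 0, 0⟩, ⟨0, 0, 0, 0⟩, ⟨0, 0, 0, 0⟩⟩,
        ⟨⟨0, 0, 0, 0⟩, ⟨0, 0, 0, 0⟩, ⟨0, 0, -1, 0⟩⟩,
        ⟨⟨0, 0, 0, 0⟩, ⟨1, 0, 1, 0⟩, ⟨0, 0, 0, 0⟩⟩⟩ := rfl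
    rw [h]
    rw [show (genSL 3 : Matrix (Fin 3) (Fin 3) ℂ) = M₄ from rfl]
    ext i j
    fin_cases i <;> fin_cases j <;> simp [EMat.toC, EVec.toC, Eis.toC, M₄, hω]
    ring

end Wiman

/-! ### The action on the six conics. -/

namespace Wiman

open scoped Matrix
open Equiv

/-- The symmetric matrices of the six conics, as complex matrices. -/
noncomputable def conicMat (i : Fin 6) : Matrix (Fin 3) (Fin 3) ℂ := (conic i).toC

theorem conicMat_isSymm (i : Fin 6) : (conicMat i).IsSymm := by
  have h := List.all_eq_true.1 conic_symm_check i (List.mem_finRange i)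
  have := EMat.toC_eq_of_isEq h
  rwa [EMat.toC_transpose] at this

theorem trace_conicMat_mul (i j : Fin 6) : (conicMat i * conicMat j).trace = 0 ↔
    (i = 0 ∧ j ≠ 0 ∨ i ≠ 0 ∧ j = 0 ∨ i ≠ 0 ∧ i = j) := by
  have h := List.all_eq_true.1 (List.all_eq_true.1 trace_check i (List.mem_finRange i)) j
    (List.mem_finRange j)
  rw [beq_iff_eq] at h
  have h2 : conicMat i * conicMat j = ((conic i).transposeMul (conic j)).toC := by
    rw [EMat.toC_transposeMul]
    conv_lhs => rw [← (conicMat_isSymm i).eq]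
    rfl
  rw [h2, ← EMat.toC_trace, Eis.toC_eq_zero_iff, h, decide_eq_true_iff]

theorem eq_of_smul_conicMat_eq {i j : Fin 6} {c d : ℂ} (hc : c ≠ 0) (hd : d ≠ 0)
    (h : c • conicMat i = d • conicMat j) : i = j := by
  have h1 : ∀ l, (conicMat l * conicMat i).trace = 0 ↔ (conicMat l * conicMat j).trace = 0 := by
    intro l
    have := congrArg (fun M => (conicMat l * M).trace) h
    simp only [Matrix.mul_smul, Matrix.trace_smul, smul_eq_mul] at this
    constructor
    · intro h0
      rw [h0, mul_zero] at this
      exact (mul_eq_zero.1 this.symm).resolve_left hd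
    · intro h0
      rw [h0, mul_zero] at this
      exact (mul_eq_zero.1 this).resolve_left hc
  simp only [trace_conicMat_mul] at h1
  clear h
  revert i j
  decide

theorem conicMat_zero : conicMat 0 = (4 : ℂ) • 1 := by
  have h : conic 0 = ⟨⟨⟨4, 0, 0, 0⟩, ⟨0, 0, 0, 0⟩, ⟨0, 0, 0, 0⟩⟩,
    ⟨⟨0, 0, 0, 0⟩, ⟨4, 0, 0, 0⟩, ⟨0, 0, 0, 0⟩⟩,
    ⟨⟨0, 0, 0, 0⟩, ⟨0, 0, 0, 0⟩, ⟨4, 0, 0, 0⟩⟩⟩ := rfl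
  rw [conicMat, h]
  ext i j
  fin_cases i <;> fin_cases j <;> simp [EMat.toC, EVec.toC, Eis.toC]

theorem conicMat_one : conicMat 1 = Matrix.diagonal ![4, 4 * ω, 4 * ω ^ 2] := by
  have h : conic 1 = ⟨⟨⟨4, 0, 0, 0⟩, ⟨0, 0, 0, 0⟩, ⟨0, 0, 0, 0⟩⟩,
    ⟨⟨0, 0, 0, 0⟩, ⟨0, 0, 4, 0⟩, ⟨0, 0, 0, 0⟩⟩,
    ⟨⟨0, 0, 0, 0⟩, ⟨0, 0, 0, 0⟩, ⟨-4, 0, -4, 0⟩⟩⟩ := rfl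
  rw [conicMat, h, ω_sq]
  ext i j
  fin_cases i <;> fin_cases j <;> simp [EMat.toC, EVec.toC, Eis.toC]
  ring

theorem conicMat_two_ne_zero (j : Fin 3) (hj : j ≠ 0) : conicMat 2 0 j ≠ 0 := by
  fin_cases j
  · exact absurd rfl hj
  · change Eis.toC ⟨1, 2, -1, 1⟩ ≠ 0
    rw [Ne, Eis.toC_eq_zero_iff]
    decide
  · change Eis.toC ⟨1, -1, 2, 1⟩ ≠ 0
    rw [Ne, Eis.toC_eq_zero_iff]
    decide

theorem genPermInv_eq (s : ℕ) : genPermInv s = (genPerm s)⁻¹ := by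
  match s with
  | 0 => decide
  | 1 => decide
  | 2 => decide
  | n + 3 => change Equiv.swap 4 5 * Equiv.swap 0 1 = (Equiv.swap 0 1 * Equiv.swap 4 5)⁻¹; decide

/-- A matrix is unitary and transforms the six conics by a given permutation, up to cube roots of
unity. -/
structure Permutes (T : SL(3, ℂ)) (σ : Perm (Fin 6)) : Prop where
  unitary : (T : Matrix (Fin 3) (Fin 3) ℂ)ᴴ * T = 1
  conics : ∃ z : Fin 6 → ℂ, (∀ i, z i ^ 3 = 1) ∧ ∀ i, (T : Matrix (Fin 3) (Fin 3) ℂ)ᵀ * conicMat i * T =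
    z i • conicMat (σ⁻¹ i)

theorem permutes_gen (s : ℕ) (hs : s < 4) : Permutes (genSL s) (genPerm s) := by
  obtain ⟨r, hr, hrs, hr2, hT⟩ := exists_toC_gen_eq s hs
  have hmem := List.mem_range.2 hs
  have hr2' : r ^ 2 ≠ 0 := pow_ne_zero 2 hr
  refine ⟨?_, fun i => (genScalar s i).toC, fun i => ?_, fun i => ?_⟩
  · have h := EMat.toC_eq_of_isEq (List.all_eq_true.1 unitary_check s hmem)
    rw [EMat.toC_transposeMul, EMat.toC_conj, EMat.toC_smul, hr2, hT] at h
    have h1 : (⟨⟨⟨1, 0, 0, 0⟩, ⟨0, 0, 0, 0⟩, ⟨0, 0, 0, 0⟩⟩,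
        ⟨⟨0, 0, 0, 0⟩, ⟨1, 0, 0, 0⟩, ⟨0, 0, 0, 0⟩⟩,
        ⟨⟨0, 0, 0, 0⟩, ⟨0, 0, 0, 0⟩, ⟨1, 0, 0, 0⟩⟩⟩ : EMat).toC = 1 := by
      ext i j
      fin_cases i <;> fin_cases j <;> simp [EMat.toC, EVec.toC, Eis.toC]
    have h2 : ((r • (genSL s : Matrix (Fin 3) (Fin 3) ℂ)).map star)ᵀ =
        r • (genSL s : Matrix (Fin 3) (Fin 3) ℂ)ᴴ := by
      change (r • (genSL s : Matrix (Fin 3) (Fin 3) ℂ))ᴴ = _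
      rw [Matrix.conjTranspose_smul, hrs]
    rw [h1, h2, Matrix.smul_mul, Matrix.mul_smul, smul_smul, ← sq] at h
    exact smul_right_injective _ hr2' h
  · have h := List.all_eq_true.1 (List.all_eq_true.1 genScalar_check s hmem) i
      (List.mem_finRange i)
    rw [← Eis.toC_eq_zero_iff, Eis.toC_sub, Eis.toC_mul, Eis.toC_mul, sub_eq_zero] at h
    rw [pow_succ', sq, h]
    simp [Eis.toC]
  · have h := EMat.toC_eq_of_isEq (List.all_eq_true.1 (List.all_eq_true.1 conic_check s hmem) i
      (List.mem_finRange i))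
    rw [EMat.toC_transposeMul, EMat.toC_transposeMul, EMat.toC_smul, Eis.toC_mul, hr2, hT] at h
    have hsymm : ((conic i).toC)ᵀ = conicMat i := (conicMat_isSymm i).eq
    rw [hsymm, Matrix.transpose_smul, Matrix.smul_mul, Matrix.mul_smul, Matrix.mul_smul, smul_smul,
      ← sq, mul_smul, genPermInv_eq, ← Matrix.mul_assoc] at h
    exact smul_right_injective _ hr2' h

theorem Permutes.mul {S T : SL(3, ℂ)} {σ τ : Perm (Fin 6)} (hS : Permutes S σ)
    (hT : Permutes T τ) : Permutes (S * T) (σ * τ) := by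
  obtain ⟨y, hy3, hy⟩ := hS.conics
  obtain ⟨z, hz3, hz⟩ := hT.conics
  refine ⟨?_, fun i => y i * z (σ⁻¹ i), fun i => by rw [mul_pow, hy3, hz3, one_mul], fun i => ?_⟩
  · rw [Matrix.SpecialLinearGroup.coe_mul, Matrix.conjTranspose_mul, Matrix.mul_assoc,
      ← Matrix.mul_assoc _ (S : Matrix (Fin 3) (Fin 3) ℂ), hS.unitary, Matrix.one_mul, hT.unitary]
  · rw [Matrix.SpecialLinearGroup.coe_mul, Matrix.transpose_mul, mul_smul, mul_inv_rev,
      Perm.mul_apply, ← hz, ← Matrix.smul_mul, ← Matrix.mul_smul, ← hy]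
    simp only [Matrix.mul_assoc]

theorem Permutes.one : Permutes 1 1 :=
  ⟨by simp, 1, by simp, by simp⟩

theorem coe_mul_inv (T : SL(3, ℂ)) :
    (T : Matrix (Fin 3) (Fin 3) ℂ) * (T⁻¹ : SL(3, ℂ)) = 1 := by
  rw [← Matrix.SpecialLinearGroup.coe_mul, mul_inv_cancel, Matrix.SpecialLinearGroup.coe_one]

theorem coe_inv_mul (T : SL(3, ℂ)) :
    ((T⁻¹ : SL(3, ℂ)) : Matrix (Fin 3) (Fin 3) ℂ) * T = 1 := by
  rw [← Matrix.SpecialLinearGroup.coe_mul, inv_mul_cancel, Matrix.SpecialLinearGroup.coe_one]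

theorem Permutes.inv {T : SL(3, ℂ)} {σ : Perm (Fin 6)} (hT : Permutes T σ) :
    Permutes T⁻¹ σ⁻¹ := by
  obtain ⟨z, hz3, hz⟩ := hT.conics
  have hz0 : ∀ i, z i ≠ 0 := fun i h => by simpa [h] using hz3 i
  refine ⟨?_, fun i => (z (σ i))⁻¹, fun i => by rw [inv_pow, hz3, inv_one], fun i => ?_⟩
  · have h1 : ((T⁻¹ : SL(3, ℂ)) : Matrix (Fin 3) (Fin 3) ℂ) = (T : Matrix (Fin 3) (Fin 3) ℂ)ᴴ := by
      rw [← Matrix.one_mul ((T⁻¹ : SL(3, ℂ)) : Matrix (Fin 3) (Fin 3) ℂ), ← hT.unitary,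
        Matrix.mul_assoc, coe_mul_inv, Matrix.mul_one]
    rw [h1, Matrix.conjTranspose_conjTranspose]
    rw [← h1, coe_mul_inv]
  · have h2 := hz (σ i)
    rw [show σ⁻¹ (σ i) = i from σ.symm_apply_apply i] at h2
    have h3 : conicMat i = (z (σ i))⁻¹ • ((T : Matrix (Fin 3) (Fin 3) ℂ)ᵀ * conicMat (σ i) * T) := by
      rw [h2, smul_smul, inv_mul_cancel₀ (hz0 _), one_smul]
    have h4 : ((T⁻¹ : SL(3, ℂ)) : Matrix (Fin 3) (Fin 3) ℂ)ᵀ * (T : Matrix (Fin 3) (Fin 3) ℂ)ᵀ = 1 := by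
      rw [← Matrix.transpose_mul, coe_mul_inv, Matrix.transpose_one]
    rw [h3, inv_inv, Matrix.mul_smul, Matrix.smul_mul]
    congr 1
    calc _ = (((T⁻¹ : SL(3, ℂ)) : Matrix (Fin 3) (Fin 3) ℂ)ᵀ * (T : Matrix (Fin 3) (Fin 3) ℂ)ᵀ) *
          conicMat (σ i) * ((T : Matrix (Fin 3) (Fin 3) ℂ) * (T⁻¹ : SL(3, ℂ))) := by
          simp only [Matrix.mul_assoc]
      _ = _ := by rw [h4, coe_mul_inv, Matrix.one_mul, Matrix.mul_one]

/-- The group generated by the matrices, together with the permutations of the six conics. -/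
noncomputable def lifts : Subgroup (SL(3, ℂ) × Perm (Fin 6)) :=
  Subgroup.closure {x | ∃ s < 4, x = (genSL s, genPerm s)}

theorem permutes_of_mem {x : SL(3, ℂ) × Perm (Fin 6)} (hx : x ∈ lifts) : Permutes x.1 x.2 := by
  induction hx using Subgroup.closure_induction with
  | mem x hx =>
    obtain ⟨s, hs, rfl⟩ := hx
    exact permutes_gen s hs
  | one => exact Permutes.one
  | mul x y _ _ hx hy => exact hx.mul hy
  | inv x _ hx => exact hx.inv

theorem gen_mem_lifts (s : ℕ) (hs : s < 4) : (genSL s, genPerm s) ∈ lifts :=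
  Subgroup.subset_closure ⟨s, hs, rfl⟩

theorem setOf_gen {α : Type*} (f : ℕ → α) : {x | ∃ s < 4, x = f s} = {f 0, f 1, f 2, f 3} := by
  ext x
  constructor
  · rintro ⟨s, hs, rfl⟩
    interval_cases s <;> simp
  · rintro (rfl | rfl | rfl | rfl)
    exacts [⟨0, by simp, rfl⟩, ⟨1, by simp, rfl⟩, ⟨2, by simp, rfl⟩, ⟨3, by simp, rfl⟩]

theorem group_eq_map : group = lifts.map
    ((Matrix.SpecialLinearGroup.toPGL (n := Fin 3) (R := ℂ)).comp (MonoidHom.fst _ _)) := by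
  rw [lifts, MonoidHom.map_closure, setOf_gen]
  simp only [Set.image_insert_eq, Set.image_singleton]
  rfl

theorem mem_group_iff {τ : PGL(3, ℂ)} :
    τ ∈ group ↔ ∃ x ∈ lifts, Matrix.SpecialLinearGroup.toPGL x.1 = τ := by
  rw [group_eq_map, Subgroup.mem_map]
  rfl

/-- A scalar matrix carries each conic to a multiple of itself, and the traces tell the conics
apart. -/
theorem eq_one_of_toPGL_eq_one {T : SL(3, ℂ)} {σ : Perm (Fin 6)} (h : Permutes T σ)
    (hT : Matrix.SpecialLinearGroup.toPGL T = 1) : σ = 1 := by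
  rw [← MonoidHom.mem_ker, Matrix.SpecialLinearGroup.toPGL_ker,
    Matrix.SpecialLinearGroup.mem_center_iff] at hT
  obtain ⟨r, hr, hrT⟩ := hT
  obtain ⟨z, hz3, hz⟩ := h.conics
  have hr0 : r ≠ 0 := fun h => by simp [h] at hr
  refine inv_eq_one.1 (Equiv.ext fun i => ?_)
  have := hz i
  rw [← hrT] at this
  refine (eq_of_smul_conicMat_eq (c := r * r) (d := z i) (mul_ne_zero hr0 hr0)
    (fun h => by simpa [h] using hz3 i) ?_).symm
  rw [← this]
  simp [← Matrix.smul_one_eq_diagonal, smul_smul]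

/-- `T` is orthogonal up to a scalar because it fixes conic 0, so it commutes with every `conicMat
i` up to a factor. Nonzero traces of products force these factors to have pairwise product 1; being
cube roots of unity, those of conics 1 and 2 are 1. Commuting with the diagonal matrix of conic 1
makes `T` diagonal, and commuting with that of conic 2 makes it scalar. -/
theorem toPGL_eq_one {T : SL(3, ℂ)} (h : Permutes T 1) : Matrix.SpecialLinearGroup.toPGL T = 1 := by
  obtain ⟨z, hz3, hz⟩ := h.conics
  have hz0 : ∀ i, z i ≠ 0 := fun i h => by simpa [h] using hz3 i
  simp only [inv_one, Perm.one_apply] at hz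
  set M := (T : Matrix (Fin 3) (Fin 3) ℂ) with hM
  have h0 : Mᵀ * M = z 0 • 1 := by
    have := hz 0
    rw [conicMat_zero, Matrix.mul_smul, Matrix.mul_one, Matrix.smul_mul, smul_comm] at this
    exact smul_right_injective _ (show (4 : ℂ) ≠ 0 by norm_num) this
  have h0' : M * Mᵀ = z 0 • 1 := by
    have h1 : ((z 0)⁻¹ • Mᵀ) * M = 1 := by
      rw [Matrix.smul_mul, h0, smul_smul, inv_mul_cancel₀ (hz0 0), one_smul]
    have h2 := mul_eq_one_comm.1 h1
    rw [Matrix.mul_smul] at h2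
    rw [← h2, smul_smul, mul_inv_cancel₀ (hz0 0), one_smul]
  have hcomm : ∀ i, conicMat i * M = (z i / z 0) • (M * conicMat i) := by
    intro i
    refine smul_right_injective _ (hz0 0) ?_
    change z 0 • (conicMat i * M) = z 0 • ((z i / z 0) • (M * conicMat i))
    have h1 : M * (Mᵀ * conicMat i * M) = z 0 • (conicMat i * M) := by
      rw [← Matrix.mul_assoc, ← Matrix.mul_assoc, h0', Matrix.smul_mul, Matrix.smul_mul,
        Matrix.one_mul]
    rw [smul_smul, mul_div_cancel₀ _ (hz0 0), ← h1, hz i, Matrix.mul_smul]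
  have hprod : ∀ i j, i ≠ 0 → j ≠ 0 → i ≠ j → (z i / z 0) * (z j / z 0) = 1 := by
    intro i j hi hj hij
    have h1 : conicMat i * conicMat j * M =
        ((z i / z 0) * (z j / z 0)) • (M * (conicMat i * conicMat j)) := by
      rw [Matrix.mul_assoc, hcomm j, Matrix.mul_smul, ← Matrix.mul_assoc, hcomm i,
        Matrix.smul_mul, smul_smul, mul_comm (z j / z 0), Matrix.mul_assoc]
    have h2 : (conicMat i * conicMat j).trace =
        ((z i / z 0) * (z j / z 0)) * (conicMat i * conicMat j).trace := by
      have h3 := congrArg (fun N => (((T⁻¹ : SL(3, ℂ)) : Matrix (Fin 3) (Fin 3) ℂ) * N).trace) h1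
      simp only [Matrix.mul_smul, Matrix.trace_smul, smul_eq_mul] at h3
      rw [← Matrix.mul_assoc _ M, hM, coe_inv_mul, Matrix.one_mul, Matrix.trace_mul_comm,
        Matrix.mul_assoc _ (T : Matrix (Fin 3) (Fin 3) ℂ), coe_mul_inv, Matrix.mul_one] at h3
      exact h3
    have h4 : (conicMat i * conicMat j).trace ≠ 0 := by
      rw [Ne, trace_conicMat_mul]
      tauto
    exact (mul_right_cancel₀ h4 ((one_mul _).trans h2)).symm
  have hcube : ∀ i, (z i / z 0) ^ 3 = 1 := fun i => by rw [div_pow, hz3, hz3, div_one]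
  have h12 := hprod 1 2 (by decide) (by decide) (by decide)
  have h13 := hprod 1 3 (by decide) (by decide) (by decide)
  have h23 := hprod 2 3 (by decide) (by decide) (by decide)
  -- The factors of conics 2 and 3 agree, so this one has square 1 as well as cube 1.
  have l2 : z 2 / z 0 = 1 := by
    have hne : z 1 / z 0 ≠ 0 := div_ne_zero (hz0 _) (hz0 _)
    have e : z 3 / z 0 = z 2 / z 0 := mul_left_cancel₀ hne (h13.trans h12.symm)
    rw [e] at h23
    have := hcube 2
    rwa [pow_succ, sq, h23, one_mul] at this
  have l1 : z 1 / z 0 = 1 := by rwa [l2, mul_one] at h12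
  have c1 := hcomm 1
  have c2 := hcomm 2
  rw [l1, one_smul, conicMat_one] at c1
  rw [l2, one_smul] at c2
  have hω0 : ω ≠ 0 := fun h => by simpa [h] using ω_pow_three
  have hω1 : ω ≠ 1 := fun h => im_ω_ne_zero (by simp [h])
  have hω2 : ω ^ 2 ≠ 1 := fun h => hω1 (by
    have := ω_pow_three
    rwa [pow_succ, h, one_mul] at this)
  have hω12 : ω ^ 2 ≠ ω := fun h => hω1 (mul_left_cancel₀ hω0 (by rw [← sq, h, mul_one]))
  have hoff : ∀ i j, i ≠ j → M i j = 0 := by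
    intro i j hij
    have := congrFun (congrFun c1 i) j
    rw [Matrix.diagonal_mul, Matrix.mul_diagonal, mul_comm, ← sub_eq_zero, ← mul_sub] at this
    refine (mul_eq_zero.1 this).resolve_right (sub_ne_zero.2 ?_)
    fin_cases i <;> fin_cases j <;> simp [hω1, hω2, hω12, hω12.symm] at hij ⊢
  have hdiag : ∀ j, M j j = M 0 0 := by
    intro j
    by_cases hj : j = 0
    · rw [hj]
    have := congrFun (congrFun c2 0) j
    rw [Matrix.mul_apply, Matrix.mul_apply, Finset.sum_eq_single j, Finset.sum_eq_single 0,
      mul_comm] at this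
    · exact mul_right_cancel₀ (conicMat_two_ne_zero j hj) this
    · intro b _ hb
      rw [hoff 0 b hb.symm, zero_mul]
    · simp
    · intro b _ hb
      rw [hoff b j hb, mul_zero]
    · simp
  have hscalar : Matrix.scalar (Fin 3) (M 0 0) = M := by
    ext i j
    by_cases hij : i = j
    · subst hij
      simp [hdiag i]
    · simp [hij, hoff i j hij]
  rw [← MonoidHom.mem_ker, Matrix.SpecialLinearGroup.toPGL_ker,
    Matrix.SpecialLinearGroup.mem_center_iff]
  refine ⟨M 0 0, ?_, hscalar⟩
  have hdet : M.det = 1 := T.2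
  rw [← hscalar] at hdet
  simpa using hdet

end Wiman

/-! ### The group is the alternating group on the six conics. -/

namespace Wiman

open Equiv

/-- A stabilizer chain: words in the generators correct the images of 0, 1 and 2 in turn. What
remains is an even permutation of the last three letters, a power of the 3-cycle `genPerm 1`. -/
theorem closure_genPerm : Subgroup.closure {p | ∃ s < 4, p = genPerm s} = alternatingGroup (Fin 6) := by
  apply le_antisymm
  · rw [Subgroup.closure_le]
    rintro p ⟨s, hs, rfl⟩
    change genPerm s ∈ alternatingGroup (Fin 6)
    rw [Perm.mem_alternatingGroup]
    interval_cases s <;> decide +kernel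
  set H := Subgroup.closure {p | ∃ s < 4, p = genPerm s} with hH
  have m : ∀ s < 4, genPerm s ∈ H := fun s hs => Subgroup.subset_closure ⟨s, hs, rfl⟩
  have m0 := m 0 (by simp)
  have m1 := m 1 (by simp)
  have m2 := m 2 (by simp)
  have m3 := m 3 (by simp)
  have hA : ∀ a : Fin 6, ∃ h ∈ H, h 0 = a := by
    intro a
    fin_cases a
    · exact ⟨1, one_mem H, rfl⟩
    · exact ⟨genPerm 3, m3, by decide +kernel⟩
    · exact ⟨genPerm 2 * genPerm 3, mul_mem m2 m3, by decide +kernel⟩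
    · exact ⟨genPerm 0 * (genPerm 2 * genPerm 3), mul_mem m0 (mul_mem m2 m3), by decide +kernel⟩
    · exact ⟨genPerm 0 * (genPerm 1 * (genPerm 0 * (genPerm 2 * genPerm 3))),
        mul_mem m0 (mul_mem m1 (mul_mem m0 (mul_mem m2 m3))), by decide +kernel⟩
    · exact ⟨genPerm 1 * (genPerm 0 * (genPerm 2 * genPerm 3)),
        mul_mem m1 (mul_mem m0 (mul_mem m2 m3)), by decide +kernel⟩
  have hB : ∀ b : Fin 6, b ≠ 0 → ∃ h ∈ H, h 0 = 0 ∧ h 1 = b := by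
    intro b hb
    fin_cases b
    · exact absurd rfl hb
    · exact ⟨1, one_mem H, rfl, rfl⟩
    · exact ⟨genPerm 2, m2, by decide +kernel⟩
    · exact ⟨genPerm 0 * genPerm 2, mul_mem m0 m2, by decide +kernel⟩
    · exact ⟨genPerm 0 * (genPerm 1 * (genPerm 0 * genPerm 2)),
        mul_mem m0 (mul_mem m1 (mul_mem m0 m2)), by decide +kernel⟩
    · exact ⟨genPerm 1 * (genPerm 0 * genPerm 2),
        mul_mem m1 (mul_mem m0 m2), by decide +kernel⟩
  have hC : ∀ c : Fin 6, c ≠ 0 → c ≠ 1 → ∃ h ∈ H, h 0 = 0 ∧ h 1 = 1 ∧ h 2 = c := by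
    intro c hc0 hc1
    fin_cases c
    · exact absurd rfl hc0
    · exact absurd rfl hc1
    · exact ⟨1, one_mem H, rfl, rfl, rfl⟩
    · exact ⟨genPerm 0, m0, by decide +kernel⟩
    · exact ⟨genPerm 0 * (genPerm 1 * genPerm 0), mul_mem m0 (mul_mem m1 m0), by decide +kernel⟩
    · exact ⟨genPerm 1 * genPerm 0, mul_mem m1 m0, by decide +kernel⟩
  have hD : ∀ r : Perm (Fin 6), (r 0 = 0 ∧ r 1 = 1 ∧ r 2 = 2 ∧ Perm.sign r = 1) →
      (r = 1 ∨ r = genPerm 1 ∨ r = genPerm 1 * genPerm 1) := by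
    decide +kernel
  have hsign : ∀ h ∈ H, Perm.sign h = 1 := by
    intro h hh
    induction hh using Subgroup.closure_induction with
    | mem x hx =>
      obtain ⟨s, hs, rfl⟩ := hx
      interval_cases s <;> decide +kernel
    | one => exact map_one _
    | mul x y _ _ hx hy => rw [map_mul, hx, hy, one_mul]
    | inv x _ hx => rw [map_inv, hx, inv_one]
  intro p hp
  rw [Perm.mem_alternatingGroup] at hp
  obtain ⟨a, ha, ha0⟩ := hA (p 0)
  have hpa : (a⁻¹ * p) 0 = 0 := by rw [Perm.mul_apply, ← ha0]; exact a.symm_apply_apply 0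
  obtain ⟨b, hb, hb0, hb1⟩ := hB ((a⁻¹ * p) 1) fun h => by
    rw [← hpa] at h
    exact absurd ((a⁻¹ * p).injective h) (by decide)
  have hinv : ∀ (f : Perm (Fin 6)) x y, f x = y → f⁻¹ y = x := fun f x y h =>
    h ▸ f.symm_apply_apply x
  have hpb0 : (b⁻¹ * (a⁻¹ * p)) 0 = 0 := by rw [Perm.mul_apply, hpa, hinv b 0 0 hb0]
  have hpb1 : (b⁻¹ * (a⁻¹ * p)) 1 = 1 := by rw [Perm.mul_apply, hinv b 1 _ hb1]
  obtain ⟨c, hc, hc0, hc1, hc2⟩ := hC ((b⁻¹ * (a⁻¹ * p)) 2)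
    (fun h => by
      rw [← hpb0] at h
      exact absurd ((b⁻¹ * (a⁻¹ * p)).injective h) (by decide))
    (fun h => by
      rw [← hpb1] at h
      exact absurd ((b⁻¹ * (a⁻¹ * p)).injective h) (by decide))
  have hr := hD (c⁻¹ * (b⁻¹ * (a⁻¹ * p))) ⟨by rw [Perm.mul_apply, hpb0, hinv c 0 0 hc0],
    by rw [Perm.mul_apply, hpb1, hinv c 1 1 hc1], by rw [Perm.mul_apply, hinv c 2 _ hc2], by
      simp [hsign a ha, hsign b hb, hsign c hc, hp]⟩
  have hmem : c⁻¹ * (b⁻¹ * (a⁻¹ * p)) ∈ H := by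
    rcases hr with h | h | h <;> rw [h]
    exacts [one_mem H, m1, mul_mem m1 m1]
  have : p = a * (b * (c * (c⁻¹ * (b⁻¹ * (a⁻¹ * p))))) := by group
  rw [this]
  exact mul_mem ha (mul_mem hb (mul_mem hc hmem))

theorem lifts_map_snd : lifts.map (MonoidHom.snd _ _) = alternatingGroup (Fin 6) := by
  rw [← closure_genPerm, lifts, MonoidHom.map_closure, setOf_gen, setOf_gen]
  simp only [Set.image_insert_eq, Set.image_singleton]
  rfl

/-- The group of the configuration is the alternating group on the six conics. -/
noncomputable def groupEquiv : group ≃* alternatingGroup (Fin 6) :=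
  let f₁ : lifts →* PGL(3, ℂ) :=
    ((Matrix.SpecialLinearGroup.toPGL (n := Fin 3) (R := ℂ)).comp (MonoidHom.fst _ _)).comp
      lifts.subtype
  let f₂ : lifts →* Perm (Fin 6) := (MonoidHom.snd _ _).comp lifts.subtype
  -- The group and the alternating group are both images of `lifts`, with the same kernel.
  have hker : f₁.ker = f₂.ker := by
    ext x
    rw [MonoidHom.mem_ker, MonoidHom.mem_ker]
    have hx := permutes_of_mem x.2
    constructor
    · exact eq_one_of_toPGL_eq_one hx
    · intro h
      have h : x.1.2 = 1 := h
      rw [h] at hx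
      exact toPGL_eq_one hx
  have h₁ : f₁.range = group := by
    rw [group_eq_map, MonoidHom.range_comp, Subgroup.range_subtype]
  have h₂ : f₂.range = alternatingGroup (Fin 6) := by
    rw [← lifts_map_snd, MonoidHom.range_comp, Subgroup.range_subtype]
  (MulEquiv.subgroupCongr h₁).symm.trans <| (QuotientGroup.quotientKerEquivRange f₁).symm.trans <|
    (QuotientGroup.quotientMulEquivOfEq hker).trans <|
      (QuotientGroup.quotientKerEquivRange f₂).trans (MulEquiv.subgroupCongr h₂)

theorem card_group : Nat.card group = 360 := by
  rw [Nat.card_congr groupEquiv.toEquiv, nat_card_alternatingGroup]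
  simp [Nat.factorial]

theorem card_involutions_alternating :
    (Finset.univ.filter fun p : Perm (Fin 6) => p * p = 1 ∧ p ≠ 1 ∧ Perm.sign p = 1).card = 45 := by
  decide +kernel

theorem ncard_involutions : {τ : PGL(3, ℂ) | τ ∈ group ∧ orderOf τ = 2}.ncard = 45 := by
  rw [← card_involutions_alternating, ← Set.ncard_coe_finset]
  refine Set.ncard_congr (fun τ hτ => (groupEquiv ⟨τ, hτ.1⟩ : Perm (Fin 6))) ?_ ?_ ?_
  · rintro τ ⟨hτ, h2⟩
    have h : orderOf ((groupEquiv ⟨τ, hτ⟩ : alternatingGroup (Fin 6)) : Perm (Fin 6)) = 2 := by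
      rw [Subgroup.orderOf_coe, MulEquiv.orderOf_eq, Subgroup.orderOf_mk, h2]
    rw [orderOf_eq_prime_iff, sq] at h
    simp only [Finset.coe_filter, Finset.mem_univ, true_and, Set.mem_ofPred_eq]
    exact ⟨h.1, h.2, Perm.mem_alternatingGroup.1 (groupEquiv ⟨τ, hτ⟩).2⟩
  · intro σ τ hσ hτ h
    have := groupEquiv.injective (Subtype.ext h)
    exact congrArg Subtype.val this
  · intro p hp
    simp only [Finset.coe_filter, Finset.mem_univ, true_and, Set.mem_ofPred_eq] at hp
    let q : alternatingGroup (Fin 6) := ⟨p, Perm.mem_alternatingGroup.2 hp.2.2⟩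
    refine ⟨groupEquiv.symm q, ⟨(groupEquiv.symm q).2, ?_⟩, ?_⟩
    · rw [Subgroup.orderOf_coe, MulEquiv.orderOf_eq, Subgroup.orderOf_mk, orderOf_eq_prime_iff, sq]
      exact ⟨hp.1, hp.2.1⟩
    · simp [q]

end Wiman

/-! ### Centres, mirrors and intersection points. -/

namespace Wiman

open scoped Matrix
open TernaryForms Equiv

section Field

variable {k : Type*} [Field k]

theorem exists_eq_smul_of_cross {c v : Fin 3 → k} (hc : c ≠ 0) (h : c ⨯₃ v = 0) :
    ∃ s : k, v = s • c := by
  obtain ⟨i, hi⟩ := Function.ne_iff.1 hc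
  rw [Pi.zero_apply] at hi
  refine ⟨v i / c i, funext fun j => ?_⟩
  have := (cross_eq_zero_iff c v).1 h i j
  rw [Pi.smul_apply, smul_eq_mul, div_mul_eq_mul_div, eq_div_iff hi]
  linear_combination this

theorem exists_eq_smul_cross {m n v : Fin 3 → k} (hmn : m ⨯₃ n ≠ 0) (hm : m ⬝ᵥ v = 0)
    (hn : n ⬝ᵥ v = 0) : ∃ s : k, v = s • (m ⨯₃ n) := by
  refine exists_eq_smul_of_cross hmn ?_
  simp only [dotProduct, Fin.sum_univ_three] at hm hn
  funext j
  fin_cases j <;> simp only [cross_apply, Matrix.cons_val, Fin.zero_eta, Fin.mk_one,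
    Fin.reduceFinMk, Pi.zero_apply]
  · linear_combination n 0 * hm - m 0 * hn
  · linear_combination n 1 * hm - m 1 * hn
  · linear_combination n 2 * hm - m 2 * hn

end Field

/-- The centre of a reflection. -/
noncomputable def centerVec (i : ℕ) : Fin 3 → ℂ := (center i).toC

/-- The coefficients of a linear equation of a mirror. -/
noncomputable def normalVec (i : ℕ) : Fin 3 → ℂ := (normal i).toC

/-- A vector that represents a point of the configuration. -/
noncomputable def pointVec (l : List ℕ) : Fin 3 → ℂ := (point l).toC

theorem normalVec_eq (i : ℕ) : normalVec i = star (centerVec i) := EVec.toC_conj _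

theorem centerVec_zero : centerVec 0 = ![1, 0, 0] := by
  have h : center 0 = ⟨⟨1, 0, 0, 0⟩, ⟨0, 0, 0, 0⟩, ⟨0, 0, 0, 0⟩⟩ := rfl
  rw [centerVec, h]
  simp [EVec.toC, Eis.toC]

theorem centerVec_ne_zero {i : ℕ} (hi : i < 45) : centerVec i ≠ 0 := by
  have h := List.all_eq_true.1 parent_check i (List.mem_range.2 hi)
  rw [Bool.and_eq_true] at h
  intro h0
  rw [centerVec, EVec.toC_eq_zero_iff] at h0
  simp [h0] at h

theorem mulVec_injective (T : SL(3, ℂ)) :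
    Function.Injective ((T : Matrix (Fin 3) (Fin 3) ℂ) *ᵥ ·) := by
  intro v w h
  have := congrArg (((T⁻¹ : SL(3, ℂ)) : Matrix (Fin 3) (Fin 3) ℂ) *ᵥ ·) h
  simpa only [Matrix.mulVec_mulVec, coe_inv_mul, Matrix.one_mulVec] using this

theorem mulVec_inv_mulVec (T : SL(3, ℂ)) (v : Fin 3 → ℂ) :
    (T : Matrix (Fin 3) (Fin 3) ℂ) *ᵥ (((T⁻¹ : SL(3, ℂ)) : Matrix (Fin 3) (Fin 3) ℂ) *ᵥ v) = v := by
  rw [Matrix.mulVec_mulVec, coe_mul_inv, Matrix.one_mulVec]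

theorem mulVec_ne_zero (T : SL(3, ℂ)) {v : Fin 3 → ℂ} (hv : v ≠ 0) :
    (T : Matrix (Fin 3) (Fin 3) ℂ) *ᵥ v ≠ 0 := fun h =>
  hv (mulVec_injective T (h.trans (Matrix.mulVec_zero _).symm))

theorem exists_lift (i : ℕ) (hi : i < 45) : ∃ x ∈ lifts, ∃ r : ℂ, r ≠ 0 ∧
    (x.1 : Matrix (Fin 3) (Fin 3) ℂ) *ᵥ ![1, 0, 0] = r • centerVec i := by
  induction i using Nat.strong_induction_on with
  | _ i ih =>
    rcases eq_or_ne i 0 with rfl | hi0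
    · exact ⟨1, one_mem _, 1, one_ne_zero, by simp [centerVec_zero]⟩
    have h := List.all_eq_true.1 parent_check i (List.mem_range.2 hi)
    simp only [Bool.and_eq_true, Bool.or_eq_true, beq_iff_eq, hi0, false_or, Nat.ble_eq] at h
    obtain ⟨-, ⟨hj, hs⟩, hc⟩ := h
    set j := (parents.getD i (0, 0)).2
    set s := (parents.getD i (0, 0)).1
    have hj' : j < i := hj
    obtain ⟨x, hx, r, hr, hxr⟩ := ih j hj' (hj'.trans hi)
    obtain ⟨a, ha, -, -, haT⟩ := exists_toC_gen_eq s hs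
    rw [← EVec.toC_eq_zero_iff, EVec.toC_cross, EMat.toC_mulVec, haT, ← cross_anticomm,
      neg_eq_zero, Matrix.smul_mulVec, map_smul, smul_eq_zero, or_iff_right ha] at hc
    obtain ⟨b, hb⟩ := exists_eq_smul_of_cross (centerVec_ne_zero hi) hc
    have hb0 : b ≠ 0 := by
      rintro rfl
      rw [zero_smul] at hb
      exact mulVec_ne_zero (genSL s) (centerVec_ne_zero (hj'.trans hi)) hb
    refine ⟨(genSL s, genPerm s) * x, mul_mem (gen_mem_lifts s hs) hx, r * b,
      mul_ne_zero hr hb0, ?_⟩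
    rw [Prod.fst_mul, Matrix.SpecialLinearGroup.coe_mul, ← Matrix.mulVec_mulVec, hxr,
      Matrix.mulVec_smul, mul_smul, ← hb]
    rfl

/-- An element of the group that takes the first mirror to a given one. -/
noncomputable def lift (i : ℕ) (hi : i < 45) : SL(3, ℂ) × Perm (Fin 6) :=
  (exists_lift i hi).choose

theorem lift_mem (i : ℕ) (hi : i < 45) : lift i hi ∈ lifts := (exists_lift i hi).choose_spec.1

/-- The lift is unitary and takes (1, 0, 0) to the centre, so it takes the orthogonal complement x₀
= 0 to the mirror. -/
theorem normalVec_dotProduct_eq_zero_iff (i : ℕ) (hi : i < 45) (v : Fin 3 → ℂ) :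
    normalVec i ⬝ᵥ (((lift i hi).1 : Matrix (Fin 3) (Fin 3) ℂ) *ᵥ v) = 0 ↔ v 0 = 0 := by
  obtain ⟨r, hr, h⟩ := (exists_lift i hi).choose_spec.2
  have hU := (permutes_of_mem (lift_mem i hi)).unitary
  have h1 : star (r • centerVec i) ⬝ᵥ (((lift i hi).1 : Matrix (Fin 3) (Fin 3) ℂ) *ᵥ v) = v 0 := by
    rw [← h, Matrix.star_mulVec, ← Matrix.dotProduct_mulVec, Matrix.mulVec_mulVec]
    rw [lift] at hU ⊢
    rw [hU, Matrix.one_mulVec]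
    simp [dotProduct, Fin.sum_univ_three]
  rw [← h1, star_smul, smul_dotProduct, ← normalVec_eq, smul_eq_zero, star_eq_zero, or_iff_right hr]

theorem exists_lift_mulVec_eq (i : ℕ) (hi : i < 45) : ∃ r : ℂ, r ≠ 0 ∧
    ((lift i hi).1 : Matrix (Fin 3) (Fin 3) ℂ) *ᵥ ![1, 0, 0] = r • centerVec i :=
  (exists_lift i hi).choose_spec.2

theorem normalVec_cross_ne_zero {i j : ℕ} (hi : i < 45) (hj : j < 45) (hij : i ≠ j) :
    normalVec i ⨯₃ normalVec j ≠ 0 := by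
  have key : ∀ a b : ℕ, a < 45 → b < a → normalVec a ⨯₃ normalVec b ≠ 0 := by
    intro a b ha hb h0
    have h := List.all_eq_true.1 (List.all_eq_true.1 normal_check a (List.mem_range.2 ha)) b
      (List.mem_range.2 hb)
    rw [normalVec, normalVec, ← EVec.toC_cross, EVec.toC_eq_zero_iff] at h0
    simp [h0] at h
  rcases lt_or_gt_of_ne hij with h | h
  · rw [← cross_anticomm, neg_ne_zero]
    exact key j i hj h
  · exact key i j hi h

theorem normalVec_ne_zero {i : ℕ} (hi : i < 45) : normalVec i ≠ 0 := by
  rw [normalVec_eq, Ne, star_eq_zero]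
  exact centerVec_ne_zero hi

theorem filter_eq_of_mem_incidence {l : List ℕ} (hl : l ∈ incidence) :
    (List.range 45).filter (fun i => ((normal i).dot (point l)).isZero) = l := by
  have := List.all_eq_true.1 incidence_check l hl
  rwa [beq_iff_eq] at this

theorem mem_iff_of_mem_incidence {l : List ℕ} (hl : l ∈ incidence) {i : ℕ} :
    i ∈ l ↔ i < 45 ∧ normalVec i ⬝ᵥ pointVec l = 0 := by
  conv_lhs => rw [← filter_eq_of_mem_incidence hl]
  rw [List.mem_filter, List.mem_range, ← Eis.toC_eq_zero_iff, EVec.toC_dot]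
  rfl

theorem nodup_of_mem_incidence {l : List ℕ} (hl : l ∈ incidence) : l.Nodup := by
  rw [← filter_eq_of_mem_incidence hl]
  exact List.nodup_range.filter _

theorem three_le_length {l : List ℕ} (hl : l ∈ incidence) : 3 ≤ l.length := by
  simpa using List.all_eq_true.1 incidence_count_check.1 l hl

theorem pointVec_ne_zero {l : List ℕ} (hl : l ∈ incidence) : pointVec l ≠ 0 := by
  have h3 := three_le_length hl
  have hnd := nodup_of_mem_incidence hl
  have hlt : ∀ i ∈ l, i < 45 := fun i hi => ((mem_iff_of_mem_incidence hl).1 hi).1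
  match l with
  | [] => simp at h3
  | [_] => simp at h3
  | i :: j :: t =>
    rw [pointVec, point, EVec.toC_cross]
    refine normalVec_cross_ne_zero (hlt i (by simp)) (hlt j (by simp)) ?_
    rintro rfl
    simp at hnd

theorem exists_mem_incidence {i j : ℕ} (hi : i < 45) (hj : j < 45) (hij : i ≠ j) :
    ∃ l ∈ incidence, i ∈ l ∧ j ∈ l := by
  have key : ∀ a b : ℕ, a < 45 → b < a → ∃ l ∈ incidence, a ∈ l ∧ b ∈ l := by
    intro a b ha hb
    have h := List.all_eq_true.1 (List.all_eq_true.1 incidence_pair_check a (List.mem_range.2 ha))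
      b (List.mem_range.2 hb)
    obtain ⟨l, hl, h⟩ := List.any_eq_true.1 h
    rw [Bool.and_eq_true, List.contains_iff_mem, List.contains_iff_mem] at h
    exact ⟨l, hl, h⟩
  rcases lt_or_gt_of_ne hij with h | h
  · obtain ⟨l, hl, h1, h2⟩ := key j i hj h
    exact ⟨l, hl, h2, h1⟩
  · exact key i j hi h

theorem exists_eq_smul_pointVec {i j : ℕ} (hi : i < 45) (hj : j < 45) (hij : i ≠ j)
    {v : Fin 3 → ℂ} (hvi : normalVec i ⬝ᵥ v = 0) (hvj : normalVec j ⬝ᵥ v = 0) :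
    ∃ l ∈ incidence, i ∈ l ∧ j ∈ l ∧ ∃ s : ℂ, v = s • pointVec l := by
  obtain ⟨l, hl, hil, hjl⟩ := exists_mem_incidence hi hj hij
  have hc := normalVec_cross_ne_zero hi hj hij
  obtain ⟨s, hs⟩ := exists_eq_smul_cross hc hvi hvj
  obtain ⟨t, ht⟩ := exists_eq_smul_cross hc ((mem_iff_of_mem_incidence hl).1 hil).2
    ((mem_iff_of_mem_incidence hl).1 hjl).2
  have ht0 : t ≠ 0 := by
    rintro rfl
    exact pointVec_ne_zero hl (by rw [ht, zero_smul])
  exact ⟨l, hl, hil, hjl, s * t⁻¹, by rw [ht, smul_smul, mul_assoc, inv_mul_cancel₀ ht0, mul_one, hs]⟩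

/-- Each list records every mirror through its point, so it can be recovered from the point. -/
theorem eq_of_pointVec_eq_smul {l l' : List ℕ} (hl : l ∈ incidence) (hl' : l' ∈ incidence) {s : ℂ}
    (h : pointVec l = s • pointVec l') : l = l' := by
  have hs : s ≠ 0 := by
    rintro rfl
    exact pointVec_ne_zero hl (by rw [h, zero_smul])
  rw [← filter_eq_of_mem_incidence hl, ← filter_eq_of_mem_incidence hl']
  refine List.filter_congr fun i _ => ?_
  rw [Bool.eq_iff_iff, ← Eis.toC_eq_zero_iff, ← Eis.toC_eq_zero_iff, EVec.toC_dot, EVec.toC_dot]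
  change _ ⬝ᵥ pointVec l = 0 ↔ _ ⬝ᵥ pointVec l' = 0
  rw [h, dotProduct_smul, smul_eq_zero, or_iff_right hs]

end Wiman

/-! ### Reflections, lines and multiplicities. -/

namespace Wiman

open scoped Matrix
open TernaryForms

/-- The plane in `ℂ³` with a given normal vector. -/
noncomputable def plane (n : Fin 3 → ℂ) : Submodule ℂ (Fin 3 → ℂ) :=
  LinearMap.ker (dotProductBilin ℂ ℂ n)

theorem mem_plane {n v : Fin 3 → ℂ} : v ∈ plane n ↔ n ⬝ᵥ v = 0 := Iff.rfl

theorem finrank_plane {n : Fin 3 → ℂ} (hn : n ≠ 0) : Module.finrank ℂ (plane n) = 2 := by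
  have h : (dotProductBilin ℂ ℂ n : Module.Dual ℂ (Fin 3 → ℂ)) ≠ 0 := by
    intro h
    refine hn (dotProduct_eq_zero n fun v => ?_)
    exact LinearMap.congr_fun h v
  have h1 := Module.Dual.finrank_ker_add_one_of_ne_zero h
  rw [Module.finrank_fin_fun] at h1
  have h2 : Module.finrank ℂ (plane n) + 1 = 3 := h1
  omega

theorem exists_not_eq_smul {L : Submodule ℂ (Fin 3 → ℂ)} (hL : Module.finrank ℂ L = 2)
    (v : Fin 3 → ℂ) (hv : v ∈ L) : ∃ w ∈ L, ∀ s : ℂ, w ≠ s • v := by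
  by_contra! h
  have := finrank_le_one (⟨v, hv⟩ : L) fun w => by
    obtain ⟨s, hs⟩ := h w w.2
    exact ⟨s, Subtype.ext hs.symm⟩
  omega

theorem plane_normalVec_injOn {i j : ℕ} (hi : i < 45) (hj : j < 45)
    (h : plane (normalVec i) = plane (normalVec j)) : i = j := by
  by_contra hij
  have hc := normalVec_cross_ne_zero hi hj hij
  have hmem : normalVec i ⨯₃ normalVec j ∈ plane (normalVec i) := dot_self_cross _ _
  obtain ⟨w, hw, hne⟩ := exists_not_eq_smul (finrank_plane (normalVec_ne_zero hi)) _ hmem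
  obtain ⟨s, hs⟩ := exists_eq_smul_cross hc (mem_plane.1 hw) (mem_plane.1 (h ▸ hw))
  exact hne s hs

theorem submodule_mk_le {v : Fin 3 → ℂ} (hv : v ≠ 0) {L : Submodule ℂ (Fin 3 → ℂ)} :
    (Projectivization.mk ℂ v hv).submodule ≤ L ↔ v ∈ L := by
  rw [Projectivization.submodule_mk, Submodule.span_singleton_le_iff_mem]

theorem toPGL_smul_mk (T : SL(3, ℂ)) {v : Fin 3 → ℂ} (hv : v ≠ 0) :
    Matrix.SpecialLinearGroup.toPGL T • Projectivization.mk ℂ v hv =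
      Projectivization.mk ℂ ((T : Matrix (Fin 3) (Fin 3) ℂ) *ᵥ v) (mulVec_ne_zero T hv) := rfl

/-- The reflection in one of the mirrors. -/
noncomputable def reflection (i : ℕ) (hi : i < 45) : PGL(3, ℂ) :=
  Matrix.SpecialLinearGroup.toPGL ((lift i hi).1 * genSL 0 * (lift i hi).1⁻¹)

theorem reflection_mem (i : ℕ) (hi : i < 45) : reflection i hi ∈ group :=
  mem_group_iff.2 ⟨lift i hi * (genSL 0, genPerm 0) * (lift i hi)⁻¹,
    mul_mem (mul_mem (lift_mem i hi) (gen_mem_lifts 0 (by simp))) (inv_mem (lift_mem i hi)), rfl⟩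

theorem genSL_zero_mulVec (v : Fin 3 → ℂ) :
    (genSL 0 : Matrix (Fin 3) (Fin 3) ℂ) *ᵥ v = ![v 0, -v 1, -v 2] := by
  change M₁ *ᵥ v = _
  funext i
  fin_cases i <;> simp [M₁, Matrix.mulVec, dotProduct, Fin.sum_univ_three]

theorem orderOf_reflection (i : ℕ) (hi : i < 45) : orderOf (reflection i hi) = 2 := by
  refine orderOf_eq_prime ?_ fun h => ?_
  · have h0 : genSL 0 * genSL 0 = 1 := by
      ext a b
      change (M₁ * M₁) a b = (1 : Matrix (Fin 3) (Fin 3) ℂ) a b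
      fin_cases a <;> fin_cases b <;> simp [M₁, Matrix.mul_apply, Fin.sum_univ_three]
    rw [reflection, ← map_pow, sq]
    have : (lift i hi).1 * genSL 0 * (lift i hi).1⁻¹ * ((lift i hi).1 * genSL 0 * (lift i hi).1⁻¹) =
        (lift i hi).1 * (genSL 0 * genSL 0) * (lift i hi).1⁻¹ := by group
    rw [this, h0, mul_one, mul_inv_cancel, map_one]
  · rw [reflection, map_mul, map_mul, map_inv, mul_inv_eq_one, mul_eq_left] at h
    exact absurd (eq_one_of_toPGL_eq_one (permutes_gen 0 (by simp)) h) (by decide)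

theorem conj_mulVec_mulVec (T A : SL(3, ℂ)) (u : Fin 3 → ℂ) :
    ((T * A * T⁻¹ : SL(3, ℂ)) : Matrix (Fin 3) (Fin 3) ℂ) *ᵥ
      ((T : Matrix (Fin 3) (Fin 3) ℂ) *ᵥ u) =
      (T : Matrix (Fin 3) (Fin 3) ℂ) *ᵥ ((A : Matrix (Fin 3) (Fin 3) ℂ) *ᵥ u) := by
  rw [Matrix.mulVec_mulVec, ← Matrix.SpecialLinearGroup.coe_mul, inv_mul_cancel_right,
    Matrix.mulVec_mulVec, ← Matrix.SpecialLinearGroup.coe_mul]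

/-- In the coordinates given by the lift the reflection is diag(1, -1, -1), whose fixed points are a
line and the isolated centre. -/
theorem reflection_smul_mk (i : ℕ) (hi : i < 45) {u : Fin 3 → ℂ} (hu : u ≠ 0) :
    reflection i hi • Projectivization.mk ℂ (((lift i hi).1 : Matrix (Fin 3) (Fin 3) ℂ) *ᵥ u)
      (mulVec_ne_zero _ hu) = Projectivization.mk ℂ _ (mulVec_ne_zero (lift i hi).1 hu) ↔
      u 0 = 0 ∨ u 1 = 0 ∧ u 2 = 0 := by
  rw [reflection, toPGL_smul_mk, Projectivization.mk_eq_mk_iff']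
  simp only [conj_mulVec_mulVec, genSL_zero_mulVec, ← Matrix.mulVec_smul,
    (mulVec_injective (lift i hi).1).eq_iff]
  constructor
  · rintro ⟨a, ha⟩
    have h0 : a * u 0 = u 0 := congrFun ha 0
    have h1 : a * u 1 = -u 1 := congrFun ha 1
    have h2 : a * u 2 = -u 2 := congrFun ha 2
    rw [or_iff_not_imp_left]
    intro hu0
    obtain rfl : a = 1 := mul_right_cancel₀ hu0 (h0.trans (one_mul _).symm)
    rw [one_mul, self_eq_neg] at h1 h2
    exact ⟨h1, h2⟩
  · rintro (h0 | ⟨h1, h2⟩)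
    · refine ⟨-1, funext fun j => ?_⟩
      fin_cases j <;> simp [h0]
    · refine ⟨1, funext fun j => ?_⟩
      fin_cases j <;> simp [h1, h2]

theorem eq_plane_of_fixed (i : ℕ) (hi : i < 45) {L : Submodule ℂ (Fin 3 → ℂ)}
    (hL : Module.finrank ℂ L = 2)
    (h : ∀ P : ComplexPlane, P.submodule ≤ L → reflection i hi • P = P) :
    L = plane (normalVec i) := by
  set T := (lift i hi).1
  have hfix : ∀ u : Fin 3 → ℂ, (T : Matrix (Fin 3) (Fin 3) ℂ) *ᵥ u ∈ L →
      u 0 = 0 ∨ u 1 = 0 ∧ u 2 = 0 := by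
    intro u hu
    rcases eq_or_ne u 0 with rfl | hu0
    · exact .inl rfl
    exact (reflection_smul_mk i hi hu0).1 (h _ ((submodule_mk_le _).2 hu))
  refine Submodule.eq_of_le_of_finrank_eq (fun v hv => ?_)
    (hL.trans (finrank_plane (normalVec_ne_zero hi)).symm)
  obtain ⟨u, rfl⟩ : ∃ u, (T : Matrix (Fin 3) (Fin 3) ℂ) *ᵥ u = v := ⟨_, mulVec_inv_mulVec T v⟩
  rw [mem_plane, normalVec_dotProduct_eq_zero_iff]
  by_contra hu0
  obtain ⟨hu1, hu2⟩ := (hfix u hv).resolve_left hu0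
  obtain ⟨w, hw, hne⟩ := exists_not_eq_smul hL _ hv
  obtain ⟨z, rfl⟩ : ∃ u, (T : Matrix (Fin 3) (Fin 3) ℂ) *ᵥ u = w := ⟨_, mulVec_inv_mulVec T w⟩
  have hz : ¬ (z 1 = 0 ∧ z 2 = 0) := by
    rintro ⟨h1, h2⟩
    refine hne (z 0 / u 0) ?_
    rw [← Matrix.mulVec_smul]
    congr 1
    funext j
    fin_cases j
    · exact (div_mul_cancel₀ _ hu0).symm
    · change z 1 = _ * u 1
      rw [h1, hu1, mul_zero]
    · change z 2 = _ * u 2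
      rw [h2, hu2, mul_zero]
  have hz0 := (hfix z hw).resolve_right hz
  -- If L contained the centre, then adding to it another point of L would give a point of L that is
  -- not fixed.
  rcases hfix (u + z) (by rw [Matrix.mulVec_add]; exact add_mem hv hw) with h0 | ⟨h1, h2⟩
  · rw [Pi.add_apply, hz0, add_zero] at h0
    exact hu0 h0
  · rw [Pi.add_apply, hu1, zero_add] at h1
    rw [Pi.add_apply, hu2, zero_add] at h2
    exact hz ⟨h1, h2⟩

theorem reflection_smul_of_le (i : ℕ) (hi : i < 45) (P : ComplexPlane)
    (hP : P.submodule ≤ plane (normalVec i)) : reflection i hi • P = P := by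
  induction P using Projectivization.ind with
  | h v hv =>
    rw [submodule_mk_le] at hP
    set T := (lift i hi).1
    obtain ⟨u, rfl⟩ : ∃ u, (T : Matrix (Fin 3) (Fin 3) ℂ) *ᵥ u = v := ⟨_, mulVec_inv_mulVec T v⟩
    rw [mem_plane, normalVec_dotProduct_eq_zero_iff] at hP
    have hu : u ≠ 0 := by
      rintro rfl
      exact hv (Matrix.mulVec_zero _)
    exact (reflection_smul_mk i hi hu).2 (.inl hP)

/-- The reflections are distinct because their mirrors are, and the group has only 45 involutions.
-/
theorem involutions_eq : {τ : PGL(3, ℂ) | τ ∈ group ∧ orderOf τ = 2} =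
    Set.range fun i : Fin 45 => reflection i i.2 := by
  symm
  have hinj : Function.Injective fun i : Fin 45 => reflection i i.2 := by
    intro i j hij
    have := eq_plane_of_fixed j j.2 (finrank_plane (normalVec_ne_zero i.2)) fun P hP => by
      have hij : reflection i i.2 = reflection j j.2 := hij
      rw [← hij]
      exact reflection_smul_of_le i i.2 P hP
    exact Fin.ext (plane_normalVec_injOn i.2 j.2 this)
  refine Set.eq_of_subset_of_ncard_le ?_ ?_ ?_
  · rintro _ ⟨i, rfl⟩
    exact ⟨reflection_mem i i.2, orderOf_reflection i i.2⟩
  · rw [ncard_involutions, ← Set.image_univ, Set.ncard_image_of_injective _ hinj, Set.ncard_univ,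
      Nat.card_fin]
  · exact Set.finite_of_ncard_ne_zero (by rw [ncard_involutions]; decide)

theorem lines_eq : lines = (fun i => plane (normalVec i)) '' (Finset.range 45 : Set ℕ) := by
  ext L
  constructor
  · rintro ⟨hL, τ, hτ, h2, hfix⟩
    obtain ⟨i, rfl⟩ : τ ∈ Set.range fun i : Fin 45 => reflection i i.2 :=
      involutions_eq ▸ (⟨hτ, h2⟩ : τ ∈ {τ : PGL(3, ℂ) | τ ∈ group ∧ orderOf τ = 2})
    exact ⟨i, by simp, (eq_plane_of_fixed i i.2 hL hfix).symm⟩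
  · rintro ⟨i, hi, rfl⟩
    have hi : i < 45 := by simpa using hi
    exact ⟨finrank_plane (normalVec_ne_zero hi), reflection i hi, reflection_mem i hi,
      orderOf_reflection i hi, reflection_smul_of_le i hi⟩

theorem injOn_plane : Set.InjOn (fun i => plane (normalVec i)) (Finset.range 45 : Set ℕ) := by
  intro i hi j hj h
  exact plane_normalVec_injOn (by simpa using hi) (by simpa using hj) h

theorem ncard_lines : lines.ncard = 45 := by
  rw [lines_eq, injOn_plane.ncard_image, Set.ncard_coe_finset, Finset.card_range]

open Classical in
theorem multiplicity_mk {v : Fin 3 → ℂ} (hv : v ≠ 0) : multiplicity (Projectivization.mk ℂ v hv) =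
    ((Finset.range 45).filter fun i => normalVec i ⬝ᵥ v = 0).card := by
  have h : {L ∈ lines | (Projectivization.mk ℂ v hv).submodule ≤ L} =
      (fun i => plane (normalVec i)) ''
        ((Finset.range 45).filter fun i => normalVec i ⬝ᵥ v = 0 : Finset ℕ) := by
    ext L
    rw [lines_eq]
    constructor
    · rintro ⟨⟨i, hi, rfl⟩, h⟩
      exact ⟨i, Finset.mem_coe.2 (Finset.mem_filter.2 ⟨hi, (submodule_mk_le hv).1 h⟩), rfl⟩
    · rintro ⟨i, hi, rfl⟩
      obtain ⟨h1, h2⟩ := Finset.mem_filter.1 (Finset.mem_coe.1 hi)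
      exact ⟨⟨i, h1, rfl⟩, (submodule_mk_le hv).2 h2⟩
  rw [multiplicity, h, (injOn_plane.mono
    (Finset.coe_subset.2 (Finset.filter_subset _ _))).ncard_image, Set.ncard_coe_finset]

theorem multiplicity_mk_pointVec {l : List ℕ} (hl : l ∈ incidence) :
    multiplicity (Projectivization.mk ℂ (pointVec l) (pointVec_ne_zero hl)) = l.length := by
  classical
  rw [multiplicity_mk, ← List.toFinset_card_of_nodup (nodup_of_mem_incidence hl)]
  congr 1
  ext i
  rw [Finset.mem_filter, Finset.mem_range, List.mem_toFinset, mem_iff_of_mem_incidence hl]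

theorem exists_eq_mk_pointVec {P : ComplexPlane} (hP : 2 ≤ multiplicity P) :
    ∃ l, ∃ hl : l ∈ incidence, P = Projectivization.mk ℂ (pointVec l) (pointVec_ne_zero hl) := by
  classical
  induction P using Projectivization.ind with
  | h v hv =>
    rw [multiplicity_mk] at hP
    obtain ⟨i, hi, j, hj, hij⟩ := Finset.one_lt_card.1 hP
    rw [Finset.mem_filter, Finset.mem_range] at hi hj
    obtain ⟨l, hl, -, -, s, hs⟩ := exists_eq_smul_pointVec hi.1 hj.1 hij hi.2 hj.2
    exact ⟨l, hl, (Projectivization.mk_eq_mk_iff' _ _ _ _ _).2 ⟨s, hs.symm⟩⟩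

/-- `hp` excludes points on fewer than two mirrors, which the list does not contain. -/
theorem ncard_setOf_multiplicity (p : ℕ → Prop) [DecidablePred p] (hp : ∀ m, p m → 2 ≤ m) :
    {P | p (multiplicity P)}.ncard = incidence.countP fun l => p l.length := by
  rw [List.countP_eq_length_filter, ← List.toFinset_card_of_nodup (incidence_nodup.filter _),
    ← Set.ncard_coe_finset]
  symm
  have hmem : ∀ l ∈ ((incidence.filter fun l => p l.length).toFinset : Set (List ℕ)),
      l ∈ incidence ∧ p l.length := by
    intro l hl
    rw [Finset.mem_coe, List.mem_toFinset, List.mem_filter] at hl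
    simpa using hl
  refine Set.ncard_congr (fun l hl => Projectivization.mk ℂ (pointVec l)
    (pointVec_ne_zero (hmem l hl).1)) ?_ ?_ ?_
  · intro l hl
    change p _
    rw [multiplicity_mk_pointVec (hmem l hl).1]
    exact (hmem l hl).2
  · intro l l' hl hl' h
    obtain ⟨s, hs⟩ := (Projectivization.mk_eq_mk_iff' _ _ _ _ _).1 h
    exact eq_of_pointVec_eq_smul (hmem l hl).1 (hmem l' hl').1 hs.symm
  · intro P hP
    have hP : p (multiplicity P) := hP
    obtain ⟨l, hl, rfl⟩ := exists_eq_mk_pointVec (hp _ hP)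
    rw [multiplicity_mk_pointVec hl] at hP
    refine ⟨l, ?_, rfl⟩
    rw [Finset.mem_coe, List.mem_toFinset, List.mem_filter]
    exact ⟨hl, by simpa using hP⟩

theorem ncard_points : points.ncard = 201 := by
  rw [points, ncard_setOf_multiplicity (fun m => 2 ≤ m) fun _ h => h,
    ← incidence_count_check.2.1, List.countP_eq_length]
  intro l hl
  have := three_le_length hl
  simp only [decide_eq_true_eq]
  omega

theorem mem_projectiveIdeal_iff {f : MvPolynomial (Fin 3) ℂ} : f ∈ projectiveIdeal points ↔
    ∀ l ∈ incidence, ∀ s : ℂ, MvPolynomial.eval (s • pointVec l) f = 0 := by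
  rw [projectiveIdeal, MvPolynomial.mem_vanishingIdeal_iff]
  constructor
  · intro h l hl s
    have := h (s • pointVec l) ⟨Projectivization.mk ℂ (pointVec l) (pointVec_ne_zero hl), by
      change 2 ≤ _
      rw [multiplicity_mk_pointVec hl]
      exact le_trans (by simp) (three_le_length hl), by
      rw [Projectivization.submodule_mk]
      exact Submodule.smul_mem _ _ (Submodule.mem_span_singleton_self _)⟩
    simpa using this
  · rintro h v ⟨P, hP, hv⟩
    obtain ⟨l, hl, rfl⟩ := exists_eq_mk_pointVec hP
    rw [Projectivization.submodule_mk, Submodule.mem_span_singleton] at hv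
    obtain ⟨s, rfl⟩ := hv
    simpa using h l hl s

end Wiman

/-! ### Equivariant vector fields and their behaviour on mirrors. -/

namespace Wiman

open scoped Matrix
open TernaryForms

/-- The sum of `q_i(v)ⁿ Q_i` over the six conics. -/
noncomputable def quadSum (n : ℕ) (v : Fin 3 → ℂ) : Matrix (Fin 3) (Fin 3) ℂ :=
  ∑ i, (v ⬝ᵥ (conicMat i *ᵥ v)) ^ n • conicMat i

/-- The cross product of the gradients of two invariant forms. -/
noncomputable def jacobian (v : Fin 3 → ℂ) : Fin 3 → ℂ := (quadSum 2 v *ᵥ v) ⨯₃ (quadSum 5 v *ᵥ v)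

noncomputable def sylvester (v : Fin 3 → ℂ) : Fin 3 → ℂ :=
  (quadSum 2 v *ᵥ jacobian v) ⨯₃ (quadSum 5 v *ᵥ jacobian v)

theorem Eis.toC_pow (x : Eis) (n : ℕ) : (x.pow n).toC = x.toC ^ n := by
  induction n with
  | zero => simp [Eis.pow, Eis.toC]
  | succ n ih => rw [Eis.pow, Eis.toC_mul, ih, pow_succ']

theorem toC_conicSum (n : ℕ) (v : EVec) : (conicSum n v).toC = quadSum n v.toC := by
  have h : ∀ L : List (Fin 6), (L.foldr (fun i N =>
      ((conic i).smul ((EVec.quad (conic i) v).pow n)).add N) EMat.zero).toC =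
      (L.map fun i => (v.toC ⬝ᵥ (conicMat i *ᵥ v.toC)) ^ n • conicMat i).sum := by
    intro L
    induction L with
    | nil => exact EMat.toC_zero
    | cons i L ih =>
      rw [List.foldr_cons, EMat.toC_add, ih, EMat.toC_smul, Eis.toC_pow, EVec.quad, EVec.toC_dot,
        EMat.toC_mulVec, List.map_cons, List.sum_cons, conicMat]
  rw [conicSum, h, quadSum, ← List.ofFn_eq_map, List.sum_ofFn]

theorem toC_jacobianVec (v : EVec) : (jacobianVec v).toC = jacobian v.toC := by
  rw [jacobianVec, jacobian, EVec.toC_cross, EMat.toC_mulVec, EMat.toC_mulVec, toC_conicSum,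
    toC_conicSum]

theorem toC_sylvesterVec (v : EVec) : (sylvesterVec v).toC = sylvester v.toC := by
  rw [sylvesterVec, sylvester, EVec.toC_cross, EMat.toC_mulVec, EMat.toC_mulVec, toC_conicSum,
    toC_conicSum, toC_jacobianVec]

theorem jacobian_ne_zero : jacobian ![0, 1, 1] ≠ 0 := by
  have h := jacobianVec_check
  intro h0
  have h1 : EVec.toC ⟨⟨0, 0, 0, 0⟩, ⟨1, 0, 0, 0⟩, ⟨1, 0, 0, 0⟩⟩ = ![0, 1, 1] := by
    simp [EVec.toC, Eis.toC]
  rw [← h1, ← toC_jacobianVec, EVec.toC_eq_zero_iff, h] at h0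
  exact absurd h0 (by decide)

theorem sylvester_ne_zero : sylvester ![1, 1, 2] ≠ 0 := by
  have h := sylvesterVec_check
  intro h0
  have h1 : EVec.toC ⟨⟨1, 0, 0, 0⟩, ⟨1, 0, 0, 0⟩, ⟨2, 0, 0, 0⟩⟩ = ![1, 1, 2] := by
    simp [EVec.toC, Eis.toC]
  rw [← h1, ← toC_sylvesterVec, EVec.toC_eq_zero_iff, h] at h0
  exact absurd h0 (by decide)

theorem mulVec_cross_transpose_mulVec {R : Type*} [CommRing R] (T : Matrix (Fin 3) (Fin 3) R)
    (a b : Fin 3 → R) : T *ᵥ ((Tᵀ *ᵥ a) ⨯₃ (Tᵀ *ᵥ b)) = T.det • (a ⨯₃ b) := by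
  funext j
  fin_cases j <;>
  · simp [cross_apply, Matrix.mulVec, dotProduct, Fin.sum_univ_three, Matrix.det_fin_three]
    ring

section Equivariance

variable {T : SL(3, ℂ)} {σ : Equiv.Perm (Fin 6)}

/-- The i-th term acquires the factor z_i ^ (n + 1), which is 1 because z_i is a cube root of unity
and 3 divides n + 1. The sum is then only reindexed. -/
theorem Permutes.quadSum_mulVec (h : Permutes T σ) {n : ℕ} (hn : 3 ∣ n + 1) (v : Fin 3 → ℂ) :
    (T : Matrix (Fin 3) (Fin 3) ℂ)ᵀ * quadSum n ((T : Matrix (Fin 3) (Fin 3) ℂ) *ᵥ v) * T =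
      quadSum n v := by
  obtain ⟨z, hz3, hz⟩ := h.conics
  have hzn : ∀ i, z i ^ n * z i = 1 := by
    intro i
    obtain ⟨m, hm⟩ := hn
    rw [← pow_succ, hm, pow_mul, hz3, one_pow]
  have hq : ∀ i, ((T : Matrix (Fin 3) (Fin 3) ℂ) *ᵥ v) ⬝ᵥ
      (conicMat i *ᵥ ((T : Matrix (Fin 3) (Fin 3) ℂ) *ᵥ v)) =
      z i * (v ⬝ᵥ (conicMat (σ⁻¹ i) *ᵥ v)) := by
    intro i
    rw [← smul_eq_mul, ← dotProduct_smul, ← Matrix.smul_mulVec, ← hz i, ← Matrix.mulVec_mulVec,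
      ← Matrix.mulVec_mulVec, Matrix.dotProduct_mulVec v, Matrix.vecMul_transpose]
  rw [quadSum, Finset.mul_sum, Finset.sum_mul]
  refine (Finset.sum_congr rfl fun i _ => ?_).trans
    (Equiv.sum_comp σ⁻¹ fun i => (v ⬝ᵥ (conicMat i *ᵥ v)) ^ n • conicMat i)
  rw [hq, Matrix.mul_smul, Matrix.smul_mul, hz i, smul_smul, mul_pow, mul_right_comm, hzn, one_mul]

theorem Permutes.transpose_mulVec (h : Permutes T σ) {n : ℕ} (hn : 3 ∣ n + 1) (v w : Fin 3 → ℂ) :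
    (T : Matrix (Fin 3) (Fin 3) ℂ)ᵀ *ᵥ (quadSum n ((T : Matrix (Fin 3) (Fin 3) ℂ) *ᵥ v) *ᵥ
      ((T : Matrix (Fin 3) (Fin 3) ℂ) *ᵥ w)) = quadSum n v *ᵥ w := by
  rw [Matrix.mulVec_mulVec, Matrix.mulVec_mulVec, h.quadSum_mulVec hn]

theorem Permutes.mulVec_cross (h : Permutes T σ) (v w : Fin 3 → ℂ) :
    (T : Matrix (Fin 3) (Fin 3) ℂ) *ᵥ ((quadSum 2 v *ᵥ w) ⨯₃ (quadSum 5 v *ᵥ w)) =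
      (quadSum 2 ((T : Matrix (Fin 3) (Fin 3) ℂ) *ᵥ v) *ᵥ
        ((T : Matrix (Fin 3) (Fin 3) ℂ) *ᵥ w)) ⨯₃
      (quadSum 5 ((T : Matrix (Fin 3) (Fin 3) ℂ) *ᵥ v) *ᵥ
        ((T : Matrix (Fin 3) (Fin 3) ℂ) *ᵥ w)) := by
  have h2 := h.transpose_mulVec (n := 2) (by norm_num) v w
  have h5 := h.transpose_mulVec (n := 5) (by norm_num) v w
  rw [← h2, ← h5, mulVec_cross_transpose_mulVec, T.det_coe, one_smul]

theorem Permutes.jacobian_mulVec (h : Permutes T σ) (v : Fin 3 → ℂ) :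
    jacobian ((T : Matrix (Fin 3) (Fin 3) ℂ) *ᵥ v) =
      (T : Matrix (Fin 3) (Fin 3) ℂ) *ᵥ jacobian v :=
  (h.mulVec_cross v v).symm

theorem Permutes.sylvester_mulVec (h : Permutes T σ) (v : Fin 3 → ℂ) :
    sylvester ((T : Matrix (Fin 3) (Fin 3) ℂ) *ᵥ v) =
      (T : Matrix (Fin 3) (Fin 3) ℂ) *ᵥ sylvester v := by
  rw [sylvester, h.jacobian_mulVec, sylvester, h.mulVec_cross]

end Equivariance

theorem quadSum_neg (n : ℕ) (v : Fin 3 → ℂ) : quadSum n (-v) = quadSum n v := by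
  simp only [quadSum, Matrix.mulVec_neg, neg_dotProduct_neg]

theorem jacobian_neg (v : Fin 3 → ℂ) : jacobian (-v) = jacobian v := by
  simp only [jacobian, quadSum_neg, Matrix.mulVec_neg, map_neg, LinearMap.neg_apply, neg_neg]

theorem genSL_zero_mulVec_of_eq_zero {v : Fin 3 → ℂ} (hv : v 0 = 0) :
    (genSL 0 : Matrix (Fin 3) (Fin 3) ℂ) *ᵥ v = -v := by
  rw [genSL_zero_mulVec]
  funext j
  fin_cases j <;> simp [hv]

theorem eq_smul_of_genSL_zero_mulVec {v : Fin 3 → ℂ}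
    (h : (genSL 0 : Matrix (Fin 3) (Fin 3) ℂ) *ᵥ v = v) : v = v 0 • ![1, 0, 0] := by
  rw [genSL_zero_mulVec] at h
  have h1 := congrFun h 1
  have h2 := congrFun h 2
  simp only [Matrix.cons_val, neg_eq_self] at h1 h2
  funext j
  fin_cases j <;> simp [h1, h2]

/-- The reflection sends v to -v, and `jacobian` is even. By equivariance its value is fixed by
diag(1, -1, -1). -/
theorem jacobian_of_eq_zero {v : Fin 3 → ℂ} (hv : v 0 = 0) :
    ∃ a : ℂ, jacobian v = a • ![1, 0, 0] := by
  have h := (permutes_gen 0 (by simp)).jacobian_mulVec v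
  rw [genSL_zero_mulVec_of_eq_zero hv, jacobian_neg] at h
  exact ⟨_, eq_smul_of_genSL_zero_mulVec h.symm⟩

theorem quadSum_mulVec_of_eq_zero {n : ℕ} (hn : 3 ∣ n + 1) {v : Fin 3 → ℂ} (hv : v 0 = 0) :
    ∃ a : ℂ, quadSum n v *ᵥ ![1, 0, 0] = a • ![1, 0, 0] := by
  have h := (permutes_gen 0 (by simp)).transpose_mulVec hn v ![1, 0, 0]
  have ht : (genSL 0 : Matrix (Fin 3) (Fin 3) ℂ)ᵀ = genSL 0 := by
    change M₁ᵀ = M₁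
    ext i j
    fin_cases i <;> fin_cases j <;> rfl
  have he : (genSL 0 : Matrix (Fin 3) (Fin 3) ℂ) *ᵥ ![1, 0, 0] = ![1, 0, 0] := by
    rw [genSL_zero_mulVec]
    simp
  rw [genSL_zero_mulVec_of_eq_zero hv, quadSum_neg, he, ht] at h
  exact ⟨_, eq_smul_of_genSL_zero_mulVec h⟩

/-- On the mirror the centre is an eigenvector of both quadratic sums, so the two factors of the
cross product are parallel. -/
theorem sylvester_of_eq_zero {v : Fin 3 → ℂ} (hv : v 0 = 0) : sylvester v = 0 := by
  obtain ⟨a, ha⟩ := jacobian_of_eq_zero hv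
  obtain ⟨b, hb⟩ := quadSum_mulVec_of_eq_zero (n := 2) (by norm_num) hv
  obtain ⟨c, hc⟩ := quadSum_mulVec_of_eq_zero (n := 5) (by norm_num) hv
  rw [sylvester, ha, Matrix.mulVec_smul, Matrix.mulVec_smul, hb, hc]
  simp only [map_smul, LinearMap.smul_apply, cross_self, smul_zero]

theorem exists_eq_lift_mulVec {i : ℕ} (hi : i < 45) {v : Fin 3 → ℂ} (hv : normalVec i ⬝ᵥ v = 0) :
    ∃ u : Fin 3 → ℂ, u 0 = 0 ∧ ((lift i hi).1 : Matrix (Fin 3) (Fin 3) ℂ) *ᵥ u = v := by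
  have h := mulVec_inv_mulVec (lift i hi).1 v
  exact ⟨_, (normalVec_dotProduct_eq_zero_iff i hi _).1 (h.symm ▸ hv), h⟩

theorem jacobian_eq_smul_centerVec {i : ℕ} (hi : i < 45) {v : Fin 3 → ℂ} (hv : normalVec i ⬝ᵥ v = 0) :
    ∃ a : ℂ, jacobian v = a • centerVec i := by
  obtain ⟨u, hu, rfl⟩ := exists_eq_lift_mulVec hi hv
  obtain ⟨a, ha⟩ := jacobian_of_eq_zero hu
  obtain ⟨r, -, hr⟩ := exists_lift_mulVec_eq i hi
  exact ⟨a * r, by rw [(permutes_of_mem (lift_mem i hi)).jacobian_mulVec, ha, Matrix.mulVec_smul,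
    hr, smul_smul]⟩

theorem sylvester_eq_zero {i : ℕ} (hi : i < 45) {v : Fin 3 → ℂ} (hv : normalVec i ⬝ᵥ v = 0) : sylvester v = 0 := by
  obtain ⟨u, hu, rfl⟩ := exists_eq_lift_mulVec hi hv
  rw [(permutes_of_mem (lift_mem i hi)).sylvester_mulVec, sylvester_of_eq_zero hu,
    Matrix.mulVec_zero]

theorem exists_jacobian_ne_zero {i : ℕ} (hi : i < 45) :
    ∃ e, normalVec i ⬝ᵥ e = 0 ∧ jacobian e ≠ 0 := by
  refine ⟨((lift i hi).1 : Matrix (Fin 3) (Fin 3) ℂ) *ᵥ ![0, 1, 1],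
    (normalVec_dotProduct_eq_zero_iff i hi _).2 rfl, ?_⟩
  rw [(permutes_of_mem (lift_mem i hi)).jacobian_mulVec]
  exact mulVec_ne_zero _ jacobian_ne_zero

theorem centerVec_cross_ne_zero {i j : ℕ} (hi : i < 45) (hj : j < 45) (hij : i ≠ j) :
    centerVec i ⨯₃ centerVec j ≠ 0 := by
  have h := normalVec_cross_ne_zero hi hj hij
  have h1 := map_cross (starRingEnd ℂ) (centerVec i) (centerVec j)
  intro h0
  rw [h0] at h1
  rw [normalVec_eq, normalVec_eq] at h
  refine h (h1.symm.trans ?_)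
  funext a
  simp

/-- The value is a multiple of two independent centres. -/
theorem jacobian_eq_zero {i j : ℕ} (hi : i < 45) (hj : j < 45) (hij : i ≠ j) {v : Fin 3 → ℂ}
    (hvi : normalVec i ⬝ᵥ v = 0) (hvj : normalVec j ⬝ᵥ v = 0) : jacobian v = 0 := by
  obtain ⟨a, ha⟩ := jacobian_eq_smul_centerVec hi hvi
  obtain ⟨b, hb⟩ := jacobian_eq_smul_centerVec hj hvj
  have h : a • (centerVec i ⨯₃ centerVec j) = 0 := by
    rw [← LinearMap.smul_apply, ← map_smul, ← ha, hb, map_smul, LinearMap.smul_apply, cross_self,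
      smul_zero]
  rw [ha, (smul_eq_zero.1 h).resolve_right (centerVec_cross_ne_zero hi hj hij), zero_smul]

end Wiman

/-! ### The invariant constructions as polynomials, and the mirror product. -/

namespace Wiman

open MvPolynomial TernaryForms
open scoped Matrix

theorem isHomogeneous_mulVec {M : Matrix (Fin 3) (Fin 3) (MvPolynomial (Fin 3) ℂ)}
    {w : Fin 3 → MvPolynomial (Fin 3) ℂ} {a b : ℕ} (hM : ∀ i j, (M i j).IsHomogeneous a)
    (hw : ∀ i, (w i).IsHomogeneous b) (i : Fin 3) : ((M *ᵥ w) i).IsHomogeneous (a + b) :=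
  IsHomogeneous.sum _ _ _ fun j _ => (hM i j).mul (hw j)

theorem isHomogeneous_cross {v w : Fin 3 → MvPolynomial (Fin 3) ℂ} {a b : ℕ}
    (hv : ∀ i, (v i).IsHomogeneous a) (hw : ∀ i, (w i).IsHomogeneous b) (i : Fin 3) :
    ((v ⨯₃ w) i).IsHomogeneous (a + b) := by
  rw [cross_apply]
  fin_cases i
  exacts [((hv 1).mul (hw 2)).sub ((hv 2).mul (hw 1)), ((hv 2).mul (hw 0)).sub ((hv 0).mul (hw 2)),
    ((hv 0).mul (hw 1)).sub ((hv 1).mul (hw 0))]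

/-- The quadratic form of one of the six conics. -/
noncomputable def conicForm (i : Fin 6) : MvPolynomial (Fin 3) ℂ :=
  X ⬝ᵥ ((conicMat i).map C *ᵥ X)

/-- The sum of `q_iⁿ Q_i` over the six conics. -/
noncomputable def quadSumForm (n : ℕ) : Matrix (Fin 3) (Fin 3) (MvPolynomial (Fin 3) ℂ) :=
  ∑ i, conicForm i ^ n • (conicMat i).map C

/-- The gradient, up to a scalar, of the sum of the powers `q_iⁿ⁺¹`. -/
noncomputable def gradient (n : ℕ) : Fin 3 → MvPolynomial (Fin 3) ℂ := quadSumForm n *ᵥ X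

noncomputable def jacobianForm : Fin 3 → MvPolynomial (Fin 3) ℂ := gradient 2 ⨯₃ gradient 5

noncomputable def sylvesterForm : Fin 3 → MvPolynomial (Fin 3) ℂ :=
  (quadSumForm 2 *ᵥ jacobianForm) ⨯₃ (quadSumForm 5 *ᵥ jacobianForm)

theorem eval_comp_X (v : Fin 3 → ℂ) : eval v ∘ X = v := _root_.funext fun _ => eval_X _

theorem eval_conicForm (v : Fin 3 → ℂ) (i : Fin 6) :
    eval v (conicForm i) = v ⬝ᵥ (conicMat i *ᵥ v) := by
  rw [conicForm, RingHom.map_dotProduct, eval_comp_X]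
  congr 1
  funext j
  rw [Function.comp_apply, RingHom.map_mulVec, eval_comp_X, Matrix.map_map]
  congr 2
  ext a b
  exact eval_C _

theorem map_eval_quadSumForm (n : ℕ) (v : Fin 3 → ℂ) :
    (quadSumForm n).map (eval v) = quadSum n v := by
  ext a b
  simp [quadSumForm, quadSum, Matrix.sum_apply, eval_conicForm]

theorem eval_mulVec (n : ℕ) (v : Fin 3 → ℂ) (w : Fin 3 → MvPolynomial (Fin 3) ℂ) :
    eval v ∘ (quadSumForm n *ᵥ w) = quadSum n v *ᵥ (eval v ∘ w) := by
  funext j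
  rw [Function.comp_apply, RingHom.map_mulVec, map_eval_quadSumForm]

theorem eval_gradient (n : ℕ) (v : Fin 3 → ℂ) : eval v ∘ gradient n = quadSum n v *ᵥ v := by
  rw [gradient, eval_mulVec, eval_comp_X]

theorem eval_jacobianForm (v : Fin 3 → ℂ) : eval v ∘ jacobianForm = jacobian v := by
  rw [jacobianForm, map_cross, eval_gradient, eval_gradient, jacobian]

theorem eval_sylvesterForm (v : Fin 3 → ℂ) : eval v ∘ sylvesterForm = sylvester v := by
  rw [sylvesterForm, map_cross, eval_mulVec, eval_mulVec, eval_jacobianForm, sylvester]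

theorem quadSumForm_isSymm (n : ℕ) : (quadSumForm n).IsSymm := by
  rw [Matrix.IsSymm, quadSumForm, Matrix.transpose_sum]
  refine Finset.sum_congr rfl fun i _ => ?_
  rw [Matrix.transpose_smul, ← Matrix.transpose_map, (conicMat_isSymm i).eq]

theorem conicForm_isHomogeneous (i : Fin 6) : (conicForm i).IsHomogeneous 2 :=
  IsHomogeneous.sum _ _ _ fun j _ => (isHomogeneous_X ℂ j).mul
    (isHomogeneous_mulVec (a := 0) (fun _ _ => isHomogeneous_C _ _) (isHomogeneous_X ℂ) j)

theorem quadSumForm_isHomogeneous (n : ℕ) (i j : Fin 3) :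
    (quadSumForm n i j).IsHomogeneous (2 * n) := by
  rw [quadSumForm, Matrix.sum_apply]
  refine IsHomogeneous.sum _ _ _ fun l _ => ?_
  exact ((conicForm_isHomogeneous l).pow n).mul (isHomogeneous_C _ _)

theorem gradient_isHomogeneous (n : ℕ) (i : Fin 3) : (gradient n i).IsHomogeneous (2 * n + 1) :=
  isHomogeneous_mulVec (quadSumForm_isHomogeneous n) (isHomogeneous_X ℂ) i

theorem jacobianForm_isHomogeneous (i : Fin 3) : (jacobianForm i).IsHomogeneous 16 :=
  isHomogeneous_cross (gradient_isHomogeneous 2) (gradient_isHomogeneous 5) i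

theorem sylvesterForm_isHomogeneous (i : Fin 3) : (sylvesterForm i).IsHomogeneous 46 :=
  isHomogeneous_cross (isHomogeneous_mulVec (quadSumForm_isHomogeneous 2)
    jacobianForm_isHomogeneous) (isHomogeneous_mulVec (quadSumForm_isHomogeneous 5)
    jacobianForm_isHomogeneous) i

theorem sylvesterForm_ne_zero : sylvesterForm ≠ 0 := by
  intro h
  refine sylvester_ne_zero ?_
  rw [← eval_sylvesterForm, h]
  funext j
  simp

theorem jacobianForm_ne_zero : jacobianForm ≠ 0 := by
  intro h
  refine jacobian_ne_zero ?_
  rw [← eval_jacobianForm, h]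
  funext j
  simp

/-- The product of the equations of the mirrors. -/
noncomputable def mirrorProduct : MvPolynomial (Fin 3) ℂ :=
  ∏ i ∈ Finset.range 45, linearForm (normalVec i)

theorem mirrorProduct_isHomogeneous : mirrorProduct.IsHomogeneous 45 := by
  have := IsHomogeneous.prod (Finset.range 45) (fun i => linearForm (normalVec i)) (fun _ => 1)
    fun i _ => linearForm_isHomogeneous _
  simpa [mirrorProduct] using this

theorem mirrorProduct_ne_zero : mirrorProduct ≠ 0 :=
  Finset.prod_ne_zero_iff.2 fun _ hi =>
    linearForm_ne_zero (normalVec_ne_zero (Finset.mem_range.1 hi))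

theorem eval_mirrorProduct_eq_zero_iff (v : Fin 3 → ℂ) :
    eval v mirrorProduct = 0 ↔ ∃ i < 45, normalVec i ⬝ᵥ v = 0 := by
  simp only [mirrorProduct, map_prod, Finset.prod_eq_zero_iff, Finset.mem_range, eval_linearForm]

theorem mirrorProduct_dvd {f : MvPolynomial (Fin 3) ℂ}
    (h : ∀ i < 45, ∀ v, normalVec i ⬝ᵥ v = 0 → eval v f = 0) : mirrorProduct ∣ f := by
  rw [mirrorProduct, Finset.prod_range]
  exact prod_linearForm_dvd
    (fun i j hij => normalVec_cross_ne_zero i.2 j.2 fun h => hij (Fin.ext h))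
    (fun i => normalVec_ne_zero i.2) fun i v hv => h i i.2 v hv

/-- By symmetry v·(S J) = (S v)·J for either quadratic sum S. This is zero because J is the cross
product of the two vectors S v, so both factors of `sylvester` are orthogonal to v. -/
theorem sylvesterForm_cross_X : sylvesterForm ⨯₃ X = 0 := by
  have h : ∀ n, (∀ v, (quadSum n v *ᵥ v) ⬝ᵥ jacobian v = 0) →
      ∀ v, (quadSum n v *ᵥ jacobian v) ⬝ᵥ v = 0 := by
    intro n hn v
    have hs : (quadSum n v)ᵀ = quadSum n v := by
      rw [← map_eval_quadSumForm, ← Matrix.transpose_map, (quadSumForm_isSymm n).eq]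
    rw [dotProduct_comm, Matrix.dotProduct_mulVec, ← Matrix.mulVec_transpose, hs, hn v]
  have h2 := h 2 fun v => dot_self_cross _ _
  have h5 := h 5 fun v => dot_cross_self _ _
  funext j
  refine MvPolynomial.funext fun v => ?_
  have hc := congrFun (map_cross (eval v) sylvesterForm X) j
  rw [Function.comp_apply] at hc
  rw [hc, eval_sylvesterForm, eval_comp_X, sylvester, Pi.zero_apply, map_zero]
  have h2 := h2 v
  have h5 := h5 v
  generalize quadSum 2 v *ᵥ jacobian v = a at h2 ⊢
  generalize quadSum 5 v *ᵥ jacobian v = b at h5 ⊢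
  simp only [dotProduct, Fin.sum_univ_three] at h2 h5
  fin_cases j <;> simp only [cross_apply, Matrix.cons_val, Fin.zero_eta, Fin.mk_one,
    Fin.reduceFinMk]
  · linear_combination b 0 * h2 - a 0 * h5
  · linear_combination b 1 * h2 - a 1 * h5
  · linear_combination b 2 * h2 - a 2 * h5

/-- The vector is divisible by the mirror product and parallel to X. The degrees 46 = 45 + 1 leave
only a constant. -/
theorem exists_sylvesterForm_eq : ∃ c : ℂ, c ≠ 0 ∧ sylvesterForm = (mirrorProduct * C c) • X := by
  have hdvd : ∀ j, mirrorProduct ∣ sylvesterForm j := fun j =>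
    mirrorProduct_dvd fun i hi v hv => by
      have := congrFun (eval_sylvesterForm v) j
      rwa [sylvester_eq_zero hi hv] at this
  choose y hy using hdvd
  have hy' : sylvesterForm = mirrorProduct • y := _root_.funext hy
  have hX : y ⨯₃ X = 0 := by
    have h := sylvesterForm_cross_X
    rw [hy', map_smul, LinearMap.smul_apply] at h
    exact (smul_eq_zero.1 h).resolve_left mirrorProduct_ne_zero
  obtain ⟨r, rfl⟩ := exists_eq_smul_X hX
  have hr : r ≠ 0 := by
    rintro rfl
    exact sylvesterForm_ne_zero (by rw [hy', zero_smul, smul_zero])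
  have h0 : sylvesterForm 0 = mirrorProduct * (r * X 0) := hy 0
  have hrX : r * X 0 ≠ 0 := mul_ne_zero hr (X_ne_zero 0)
  have hd := (sylvesterForm_isHomogeneous 0).totalDegree
    (by rw [h0]; exact mul_ne_zero mirrorProduct_ne_zero hrX)
  rw [h0, totalDegree_mul_of_isDomain mirrorProduct_ne_zero hrX,
    totalDegree_mul_of_isDomain hr (X_ne_zero 0), totalDegree_X,
    mirrorProduct_isHomogeneous.totalDegree mirrorProduct_ne_zero] at hd
  have hC := totalDegree_eq_zero_iff_eq_C.1 (show r.totalDegree = 0 by omega)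
  refine ⟨coeff 0 r, fun h => hr (by rw [hC, h, C_0]), ?_⟩
  rw [hy', ← hC, smul_smul]

end Wiman

/-! ### The ideal of the configuration, and the failure of containment in its square. -/

namespace Wiman

open MvPolynomial TernaryForms
open scoped Matrix

theorem jacobian_smul (s : ℂ) (v : Fin 3 → ℂ) : jacobian (s • v) = s ^ 16 • jacobian v := by
  funext j
  rw [← eval_jacobianForm, ← eval_jacobianForm, Function.comp_apply,
    eval_smul_of_isHomogeneous (jacobianForm_isHomogeneous j)]
  rfl

theorem forall_eval_jacobianForm {v : Fin 3 → ℂ} :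
    (∀ j, eval v (jacobianForm j) = 0) ↔ jacobian v = 0 := by
  rw [← eval_jacobianForm, funext_iff]
  rfl

theorem jacobian_smul_pointVec {l : List ℕ} (hl : l ∈ incidence) (s : ℂ) :
    jacobian (s • pointVec l) = 0 := by
  have h3 := three_le_length hl
  have hnd := nodup_of_mem_incidence hl
  have hlt : ∀ i ∈ l, i < 45 ∧ normalVec i ⬝ᵥ (s • pointVec l) = 0 := fun i hi => by
    obtain ⟨h1, h2⟩ := (mem_iff_of_mem_incidence hl).1 hi
    exact ⟨h1, by rw [dotProduct_smul, h2, smul_zero]⟩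
  match l with
  | [] => simp at h3
  | [_] => simp at h3
  | i :: j :: t =>
    have hi := hlt i (by simp)
    have hj := hlt j (by simp)
    refine jacobian_eq_zero hi.1 hj.1 ?_ hi.2 hj.2
    rintro rfl
    simp at hnd

/-- A zero of the jacobian on a mirror has the expected number of companions on it. -/
theorem exists_finset_zeros {i : ℕ} (hi : i < 45) {e v : Fin 3 → ℂ} (he : normalVec i ⬝ᵥ e = 0)
    (hje : jacobian e ≠ 0) (hv : normalVec i ⬝ᵥ v = 0) (hve : v ⨯₃ e ≠ 0) :
    ∃ R : Finset ℂ, 16 ≤ R.card ∧ ∀ s ∈ R, ∃ l ∈ incidence, i ∈ l ∧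
      ∃ a : ℂ, v + s • e = a • pointVec l := by
  classical
  have hex : ∀ l ∈ incidence, i ∈ l → ∃ s a : ℂ, v + s • e = a • pointVec l := by
    intro l hl hil
    have hp := ((mem_iff_of_mem_incidence hl).1 hil).2
    -- The point differs from e, where the jacobian is nonzero, so it is not the point at infinity
    -- of the parametrization v + s e.
    have hpe : e ⨯₃ pointVec l ≠ 0 := by
      intro h
      have he0 : e ≠ 0 := by
        rintro rfl
        exact hve (map_zero _)
      obtain ⟨b, hb⟩ := exists_eq_smul_of_cross he0 h
      have h0 := jacobian_smul_pointVec hl 1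
      rw [one_smul, hb, jacobian_smul] at h0
      have hb0 := pow_eq_zero_iff (by norm_num) |>.1 ((smul_eq_zero.1 h0).resolve_right hje)
      exact pointVec_ne_zero hl (by rw [hb, hb0, zero_smul])
    obtain ⟨t, ht⟩ := exists_eq_smul_cross hve (by rw [dotProduct_comm, hv])
      (by rw [dotProduct_comm, he] : e ⬝ᵥ normalVec i = 0)
    obtain ⟨t', ht'⟩ := exists_eq_smul_cross hpe (by rw [dotProduct_comm, he])
      (by rw [dotProduct_comm, hp] : pointVec l ⬝ᵥ normalVec i = 0)
    have ht0 : t ≠ 0 := by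
      rintro rfl
      exact normalVec_ne_zero hi (by rw [ht, zero_smul])
    have he0 : e ≠ 0 := by
      rintro rfl
      exact hve (map_zero _)
    have hc : e ⨯₃ (t • v + t' • pointVec l) = 0 := by
      rw [map_add, map_smul, map_smul, ← ht', ← cross_anticomm, smul_neg, ← ht, neg_add_cancel]
    obtain ⟨r, hr⟩ := exists_eq_smul_of_cross he0 hc
    refine ⟨-(t⁻¹ * r), -(t⁻¹ * t'), ?_⟩
    have h1 := congrArg (t⁻¹ • ·) hr
    simp only [smul_add, smul_smul, inv_mul_cancel₀ ht0, one_smul] at h1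
    rw [neg_smul, ← h1, neg_smul]
    abel
  choose! s a hs using hex
  set L := (incidence.filter fun l => l.contains i).toFinset with hL
  have hmem : ∀ l ∈ L, l ∈ incidence ∧ i ∈ l := by
    intro l hl
    rw [hL, List.mem_toFinset, List.mem_filter, List.contains_iff_mem] at hl
    exact hl
  refine ⟨L.image s, ?_, ?_⟩
  · rw [Finset.card_image_of_injOn, hL,
      List.toFinset_card_of_nodup (incidence_nodup.filter _), ← List.countP_eq_length_filter]
    · exact Nat.ble_eq ▸ List.all_eq_true.1 incidence_line_check i (List.mem_range.2 hi)
    · intro l hl l' hl' h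
      obtain ⟨hl, hil⟩ := hmem l hl
      obtain ⟨hl', hil'⟩ := hmem l' hl'
      have h1 := hs l hl hil
      have h2 := hs l' hl' hil'
      have h : s l = s l' := h
      rw [h, h2] at h1
      have ha : a l ≠ 0 := by
        intro ha
        rw [ha, zero_smul] at h1
        rw [h1] at h2
        refine hve ?_
        rw [eq_neg_of_add_eq_zero_left h2, map_neg, map_smul, LinearMap.neg_apply,
          LinearMap.smul_apply, cross_self, smul_zero, neg_zero]
      refine eq_of_pointVec_eq_smul hl hl' (s := (a l)⁻¹ * a l') ?_
      rw [mul_smul, h1, smul_smul, inv_mul_cancel₀ ha, one_smul]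
  · intro x hx
    obtain ⟨l, hl, rfl⟩ := Finset.mem_image.1 hx
    obtain ⟨hl, hil⟩ := hmem l hl
    exact ⟨l, hl, hil, a l, hs l hl hil⟩

theorem cross_ne_zero_of_jacobian {e v : Fin 3 → ℂ} (hje : jacobian e ≠ 0) (hv : v ≠ 0)
    (hjv : jacobian v = 0) : v ⨯₃ e ≠ 0 := by
  intro h
  obtain ⟨s, rfl⟩ := exists_eq_smul_of_cross hv h
  exact hje (by rw [jacobian_smul, hjv, smul_zero])

/-- The common zeros of the jacobian are the points of the configuration. -/
theorem exists_eq_smul_pointVec_of_jacobian {v : Fin 3 → ℂ} (hv : v ≠ 0) (hjv : jacobian v = 0) :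
    ∃ l ∈ incidence, ∃ a : ℂ, a ≠ 0 ∧ v = a • pointVec l := by
  obtain ⟨i, hi, hiv⟩ : ∃ i < 45, normalVec i ⬝ᵥ v = 0 := by
    rw [← eval_mirrorProduct_eq_zero_iff]
    obtain ⟨c, hc, h⟩ := exists_sylvesterForm_eq
    obtain ⟨j, hj⟩ := Function.ne_iff.1 hv
    have h1 := congrFun (eval_sylvesterForm v) j
    rw [h, sylvester, hjv, Matrix.mulVec_zero, Matrix.mulVec_zero, cross_self] at h1
    simp only [Function.comp_apply, Pi.smul_apply, smul_eq_mul, map_mul, eval_C, eval_X,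
      Pi.zero_apply, mul_eq_zero, hc, or_false] at h1
    exact h1.resolve_right hj
  obtain ⟨e, he, hje⟩ := exists_jacobian_ne_zero hi
  have hve := cross_ne_zero_of_jacobian hje hv hjv
  obtain ⟨R, hR, hRl⟩ := exists_finset_zeros hi he hje hiv hve
  obtain ⟨j, hj⟩ := Function.ne_iff.1 hje
  have hej : eval e (jacobianForm j) ≠ 0 := by
    rw [← eval_jacobianForm] at hj
    exact hj
  have hzero : ∀ s ∈ R, eval (v + s • e) (jacobianForm j) = 0 := by
    intro s hs
    obtain ⟨l, hl, -, a, ha⟩ := hRl s hs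
    rw [ha]
    exact forall_eval_jacobianForm.2 (jacobian_smul_pointVec hl a) j
  -- The listed points already exhaust the degree 16, so the root s = 0 belonging to v is one of
  -- them.
  have hroots := roots_along (jacobianForm_isHomogeneous j) hej hzero hR
  have h0 : (0 : ℂ) ∈ R := by
    rw [← Finset.mem_val, ← hroots, Polynomial.mem_roots
      (along_ne_zero (jacobianForm_isHomogeneous j) hej), Polynomial.IsRoot.def, eval_along,
      zero_smul, add_zero]
    exact forall_eval_jacobianForm.2 hjv j
  obtain ⟨l, hl, -, a, ha⟩ := hRl 0 h0
  rw [zero_smul, add_zero] at ha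
  refine ⟨l, hl, a, ?_, ha⟩
  rintro rfl
  exact hv (by rw [ha, zero_smul])

/-- The first-order term of the jacobian at a vector `v` in the direction of `e`. -/
noncomputable def jacobianDeriv (v e : Fin 3 → ℂ) : Fin 3 → ℂ :=
  fun j => (along v e (jacobianForm j)).coeff 1

/-- Along the mirror the jacobian stays proportional to the centre, hence so does its derivative,
which is nonzero because the zeros are simple. -/
theorem exists_jacobianDeriv_eq {i : ℕ} (hi : i < 45) {v : Fin 3 → ℂ} (hv : v ≠ 0)
    (hiv : normalVec i ⬝ᵥ v = 0) (hjv : jacobian v = 0) : ∃ e, normalVec i ⬝ᵥ e = 0 ∧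
      ∃ a : ℂ, a ≠ 0 ∧ jacobianDeriv v e = a • centerVec i := by
  obtain ⟨e, he, hje⟩ := exists_jacobian_ne_zero hi
  have hve := cross_ne_zero_of_jacobian hje hv hjv
  obtain ⟨R, hR, hRl⟩ := exists_finset_zeros hi he hje hiv hve
  obtain ⟨j, hj⟩ := Function.ne_iff.1 hje
  have hej : eval e (jacobianForm j) ≠ 0 := by
    rw [← eval_jacobianForm] at hj
    exact hj
  have hzero : ∀ s ∈ R, eval (v + s • e) (jacobianForm j) = 0 := by
    intro s hs
    obtain ⟨l, hl, -, a, ha⟩ := hRl s hs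
    rw [ha]
    exact forall_eval_jacobianForm.2 (jacobian_smul_pointVec hl a) j
  have hne := coeff_one_along_ne_zero (jacobianForm_isHomogeneous j) hej hzero hR
    (forall_eval_jacobianForm.2 hjv j)
  have hcross : centerVec i ⨯₃ jacobianDeriv v e = 0 := by
    rw [cross_eq_zero_iff]
    intro a b
    have hpoly : Polynomial.C (centerVec i a) * along v e (jacobianForm b) =
        Polynomial.C (centerVec i b) * along v e (jacobianForm a) := by
      refine Polynomial.funext fun s => ?_
      obtain ⟨c, hc⟩ := jacobian_eq_smul_centerVec hi (v := v + s • e)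
        (by rw [dotProduct_add, dotProduct_smul, hiv, he, smul_zero, add_zero])
      rw [← eval_jacobianForm] at hc
      have ha : eval (v + s • e) (jacobianForm a) = c * centerVec i a := congrFun hc a
      have hb : eval (v + s • e) (jacobianForm b) = c * centerVec i b := congrFun hc b
      rw [Polynomial.eval_mul, Polynomial.eval_mul, Polynomial.eval_C, Polynomial.eval_C,
        eval_along, eval_along, ha, hb]
      ring
    have := congrArg (fun q => q.coeff 1) hpoly
    simp only [Polynomial.coeff_C_mul] at this
    exact this
  obtain ⟨a, ha⟩ := exists_eq_smul_of_cross (centerVec_ne_zero hi) hcross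
  refine ⟨e, he, a, ?_, ha⟩
  rintro rfl
  rw [zero_smul] at ha
  exact hne (congrFun ha j)

/-- Two mirrors through a zero of the jacobian. -/
theorem exists_mirrors {v : Fin 3 → ℂ} (hv : v ≠ 0) (hjv : jacobian v = 0) : ∃ i < 45, ∃ j < 45,
    i ≠ j ∧ normalVec i ⬝ᵥ v = 0 ∧ normalVec j ⬝ᵥ v = 0 := by
  obtain ⟨l, hl, a, -, rfl⟩ := exists_eq_smul_pointVec_of_jacobian hv hjv
  have h3 := three_le_length hl
  rw [← List.toFinset_card_of_nodup (nodup_of_mem_incidence hl)] at h3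
  obtain ⟨i, hi, j, hj, hij⟩ := Finset.one_lt_card.1 (lt_of_lt_of_le (by simp) h3)
  rw [List.mem_toFinset, mem_iff_of_mem_incidence hl] at hi hj
  exact ⟨i, hi.1, j, hj.1, hij, by rw [dotProduct_smul, hi.2, smul_zero],
    by rw [dotProduct_smul, hj.2, smul_zero]⟩

/-- At its zeros the jacobian generates the ideal of the configuration locally. -/
theorem exists_mul_mem {f : MvPolynomial (Fin 3) ℂ} (hf : f ∈ projectiveIdeal points)
    {v : Fin 3 → ℂ} (hv : v ≠ 0) (hjv : jacobian v = 0) :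
    ∃ s, eval v s ≠ 0 ∧ s * f ∈ Ideal.span (Set.range jacobianForm) := by
  obtain ⟨i, hi, j, hj, hij, hiv, hjv'⟩ := exists_mirrors hv hjv
  obtain ⟨t, ht⟩ := exists_eq_smul_cross (normalVec_cross_ne_zero hi hj hij) hiv hjv'
  have ht0 : t ≠ 0 := by
    rintro rfl
    exact hv (by rw [ht, zero_smul])
  have hvm : v = (t • normalVec i) ⨯₃ normalVec j := by
    rw [map_smul, LinearMap.smul_apply, ← ht]
  obtain ⟨e, he, a, ha, hda⟩ := exists_jacobianDeriv_eq hi hv hiv hjv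
  obtain ⟨e', he', b, hb, hdb⟩ := exists_jacobianDeriv_eq hj hv hjv' hjv
  obtain ⟨l, hl, c, -, hc⟩ := exists_eq_smul_pointVec_of_jacobian hv hjv
  have hD : jacobianDeriv v e ⨯₃ jacobianDeriv v e' ≠ 0 := by
    rw [hda, hdb, map_smul, map_smul, LinearMap.smul_apply]
    exact smul_ne_zero hb (smul_ne_zero ha (centerVec_cross_ne_zero hi hj hij))
  rw [hvm] at hD
  have := exists_mul_mem_span_range (f := f) (hvm ▸ hv) (fun s => ?_) (fun j s => ?_)
    (by rw [smul_dotProduct, he, smul_zero]) he' hD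
  · rwa [← hvm] at this
  · rw [← hvm, hc, smul_smul]
    exact mem_projectiveIdeal_iff.1 hf l hl _
  · rw [← hvm, hc, smul_smul]
    exact forall_eval_jacobianForm.2 (jacobian_smul_pointVec hl _) j

/-- Membership is local: near a point of the configuration the derivatives along two mirrors
suffice, elsewhere off the origin some generator is invertible, and the origin is excluded by the
saturation of the ideal of minors. -/
theorem projectiveIdeal_points : projectiveIdeal points = Ideal.span (Set.range jacobianForm) := by
  apply le_antisymm
  · intro f hf
    obtain ⟨c, -, hc⟩ := exists_dotProduct_ne_zero
      (fun l : {l // l ∈ incidence} => pointVec l) fun l => pointVec_ne_zero l.2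
    have hunit := isUnit_of_forall_dvd jacobianForm_isHomogeneous jacobianForm_ne_zero (c := c)
      fun v hv hcv => by
        by_contra hv0
        obtain ⟨l, hl, a, ha, rfl⟩ := exists_eq_smul_pointVec_of_jacobian hv0
          (forall_eval_jacobianForm.1 hv)
        rw [dotProduct_smul] at hcv
        exact smul_ne_zero ha (hc ⟨l, hl⟩) hcv
    refine mem_of_forall_eval_eq_zero (fun v hv => ?_) fun e he =>
      mem_span_minors_of_X_mul hunit he
    by_contra hv0
    by_cases hjv : jacobian v = 0
    · obtain ⟨s, hs, hsf⟩ := exists_mul_mem hf hv0 hjv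
      exact hs (hv s hsf)
    · refine hjv (forall_eval_jacobianForm.1 fun j => hv _ ?_)
      exact Ideal.mul_mem_right _ _ (Ideal.subset_span ⟨j, rfl⟩)
  · rw [Ideal.span_le]
    rintro _ ⟨j, rfl⟩
    exact mem_projectiveIdeal_iff.2 fun l hl s =>
      forall_eval_jacobianForm.2 (jacobian_smul_pointVec hl s) j

/-- If both gradients vanished, their cross product would vanish to second order, but its derivative
along a mirror is nonzero. -/
theorem gradient_ne_zero {v : Fin 3 → ℂ} (hv : v ≠ 0) (hjv : jacobian v = 0)
    (h2 : eval v ∘ gradient 2 = 0) : eval v ∘ gradient 5 ≠ 0 := by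
  intro h5
  obtain ⟨i, hi, -, -, -, hiv, -⟩ := exists_mirrors hv hjv
  obtain ⟨e, -, a, ha, hda⟩ := exists_jacobianDeriv_eq hi hv hiv hjv
  refine smul_ne_zero ha (centerVec_ne_zero hi) ?_
  rw [← hda]
  have hc0 : ∀ f : MvPolynomial (Fin 3) ℂ, eval v f = 0 → (along v e f).coeff 0 = 0 := by
    intro f hf
    rw [Polynomial.coeff_zero_eq_eval_zero, eval_along, zero_smul, add_zero, hf]
  have hp : ∀ a b, (along v e (gradient 2 a * gradient 5 b)).coeff 1 = 0 := by
    intro a b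
    rw [map_mul, Polynomial.mul_coeff_one, hc0 _ (congrFun h2 a), hc0 _ (congrFun h5 b), zero_mul,
      mul_zero, add_zero]
  funext j
  rw [jacobianDeriv, jacobianForm, cross_apply]
  fin_cases j <;> simp [hp, -map_mul]

theorem mirrorProduct_notMem_sq : mirrorProduct ∉ projectiveIdeal points ^ 2 := by
  classical
  -- At each point at least one gradient is nonzero; t is chosen not orthogonal to that one at any
  -- of the finitely many points.
  obtain ⟨t, ht, htu⟩ := exists_dotProduct_ne_zero (fun l : {l // l ∈ incidence} =>
    if eval (pointVec l) ∘ gradient 2 = 0 then eval (pointVec l) ∘ gradient 5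
    else eval (pointVec l) ∘ gradient 2) fun l => by
      split_ifs with h
      · refine gradient_ne_zero (pointVec_ne_zero l.2) ?_ h
        have := jacobian_smul_pointVec l.2 1
        rwa [one_smul] at this
      · exact h
  obtain ⟨c, -, hc⟩ := exists_sylvesterForm_eq
  have hscale : ∀ n (a : ℂ) v, eval (a • v) ∘ gradient n = a ^ (2 * n + 1) • (eval v ∘ gradient n) :=
    fun n a v => _root_.funext fun j => eval_smul_of_isHomogeneous (gradient_isHomogeneous n j) a v
  rw [projectiveIdeal_points]
  refine sylvester_notMem_sq (quadSumForm_isSymm 2) (quadSumForm_isSymm 5) rfl rfl rfl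
    (gradient_isHomogeneous 2) (gradient_isHomogeneous 5) ht (fun v hv h2 h5 => ?_)
    mirrorProduct_ne_zero (y := (C c : MvPolynomial (Fin 3) ℂ) • X) ?_
  · by_contra hv0
    obtain ⟨l, hl, a, ha, rfl⟩ := exists_eq_smul_pointVec_of_jacobian hv0
      (forall_eval_jacobianForm.1 hv)
    have h2 : t ⬝ᵥ (eval (a • pointVec l) ∘ gradient 2) = 0 := h2
    have h5 : t ⬝ᵥ (eval (a • pointVec l) ∘ gradient 5) = 0 := h5
    rw [hscale, dotProduct_smul, smul_eq_zero, or_iff_right (pow_ne_zero _ ha)] at h2 h5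
    have := htu ⟨l, hl⟩
    split_ifs at this
    exacts [this h5, this h2]
  · rw [smul_smul]
    exact hc

end Wiman

/-! ### The mirror product lies in the third symbolic power. -/

theorem mem_symbolicPower_of_forall {R : Type*} [CommRing R] [IsNoetherianRing R] {I : Ideal R}
    {m : ℕ} {x : R} (h : ∀ Q ∈ associatedPrimes R (R ⧸ I), ∃ s ∉ Q, s * x ∈ I ^ m) :
    x ∈ symbolicPower I m := by
  simp only [symbolicPower, Ideal.mem_iInf, Ideal.mem_comap]
  intro Q hQ hprime
  obtain ⟨s, hs, hsx⟩ := h Q hQ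
  have h1 := Ideal.mem_map_of_mem (algebraMap R (Localization.AtPrime Q)) hsx
  rw [map_mul] at h1
  exact (Ideal.unit_mul_mem_iff_mem _
    (IsLocalization.map_units (Localization.AtPrime Q) (⟨s, hs⟩ : Q.primeCompl))).1 h1

theorem exists_of_mem_associatedPrimes {R : Type*} [CommRing R] [IsNoetherianRing R] {I Q : Ideal R}
    (hQ : Q ∈ associatedPrimes R (R ⧸ I)) : ∃ f ∉ I, ∀ s ∈ Q, s * f ∈ I := by
  obtain ⟨hprime, x, hx⟩ := isAssociatedPrime_iff.1 hQ
  obtain ⟨f, rfl⟩ := Ideal.Quotient.mk_surjective x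
  refine ⟨f, fun hf => hprime.ne_top ?_, fun s hs => ?_⟩
  · rw [hx, Ideal.Quotient.eq_zero_iff_mem.2 hf, Submodule.colon_singleton_zero]
  · rw [hx, Submodule.mem_colon_singleton, Submodule.mem_bot] at hs
    rw [← Ideal.Quotient.eq_zero_iff_mem, map_mul]
    exact hs

namespace Wiman

open MvPolynomial TernaryForms
open scoped Matrix

theorem prod_mem_pow_length {R : Type*} [CommRing R] {I : Ideal R} (l : List ℕ) (f : ℕ → R)
    (h : ∀ i ∈ l, f i ∈ I) : (l.map f).prod ∈ I ^ l.length := by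
  induction l with
  | nil => simp
  | cons i l ih =>
    rw [List.map_cons, List.prod_cons, List.length_cons, pow_succ']
    exact Ideal.mul_mem_mul (h i (by simp)) (ih fun j hj => h j (by simp [hj]))

/-- The product of the equations of the mirrors that do not pass through a point. -/
noncomputable def complementProduct (l : List ℕ) : MvPolynomial (Fin 3) ℂ :=
  ∏ i ∈ (Finset.range 45).filter (· ∉ l), linearForm (normalVec i)

theorem eval_complementProduct_ne_zero {l : List ℕ} (hl : l ∈ incidence) {s : ℂ} (hs : s ≠ 0) :
    eval (s • pointVec l) (complementProduct l) ≠ 0 := by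
  rw [complementProduct, map_prod, Finset.prod_ne_zero_iff]
  intro i hi
  rw [Finset.mem_filter, Finset.mem_range, mem_iff_of_mem_incidence hl, not_and] at hi
  rw [eval_linearForm, dotProduct_smul]
  exact smul_ne_zero hs (hi.2 hi.1)

/-- The linear form vanishes at the given point. Any other point lies on a mirror that misses the
given one, hence on a factor of the complementary product. -/
theorem complementProduct_mul_mem {l : List ℕ} (hl : l ∈ incidence) {i : ℕ} (hi : i ∈ l) :
    complementProduct l * linearForm (normalVec i) ∈ projectiveIdeal points := by
  refine mem_projectiveIdeal_iff.2 fun l' hl' s => ?_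
  rw [map_mul, eval_linearForm, dotProduct_smul]
  by_cases h : ∀ j ∈ l', j ∈ l
  · have h3 := three_le_length hl'
    rw [← List.toFinset_card_of_nodup (nodup_of_mem_incidence hl')] at h3
    obtain ⟨a, ha, b, hb, hab⟩ := Finset.one_lt_card.1 (lt_of_lt_of_le (by simp) h3)
    rw [List.mem_toFinset] at ha hb
    have ha' := (mem_iff_of_mem_incidence hl).1 (h a ha)
    have hb' := (mem_iff_of_mem_incidence hl).1 (h b hb)
    rw [mem_iff_of_mem_incidence hl'] at ha hb
    have hc := normalVec_cross_ne_zero ha.1 hb.1 hab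
    obtain ⟨x, hx⟩ := exists_eq_smul_cross hc ha.2 hb.2
    obtain ⟨y, hy⟩ := exists_eq_smul_cross hc ha'.2 hb'.2
    have hy0 : y ≠ 0 := by
      rintro rfl
      exact pointVec_ne_zero hl (by rw [hy, zero_smul])
    have : pointVec l' = (x * y⁻¹) • pointVec l := by
      rw [hx, hy, smul_smul, mul_assoc, inv_mul_cancel₀ hy0, mul_one]
    obtain rfl := eq_of_pointVec_eq_smul hl' hl this
    rw [((mem_iff_of_mem_incidence hl').1 hi).2, smul_zero, mul_zero]
  · push Not at h
    obtain ⟨j, hj, hjl⟩ := h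
    have hj' := (mem_iff_of_mem_incidence hl').1 hj
    rw [complementProduct, map_prod, Finset.prod_eq_zero (i := j), zero_mul]
    · rw [Finset.mem_filter, Finset.mem_range]
      exact ⟨hj'.1, hjl⟩
    · rw [eval_linearForm, dotProduct_smul, hj'.2, smul_zero]

theorem complementProduct_mul_prod {l : List ℕ} (hl : l ∈ incidence) :
    complementProduct l * (l.map fun i => linearForm (normalVec i)).prod = mirrorProduct := by
  rw [← List.prod_toFinset _ (nodup_of_mem_incidence hl), complementProduct, mirrorProduct,
    mul_comm, ← Finset.prod_filter_mul_prod_filter_not (Finset.range 45) (· ∈ l)]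
  congr 2
  ext i
  rw [Finset.mem_filter, Finset.mem_range, List.mem_toFinset]
  exact ⟨fun h => ⟨((mem_iff_of_mem_incidence hl).1 h).1, h⟩, fun h => h.2⟩

/-- Every mirror through the point supplies one element of the ideal, each with a copy of the
complementary product. One copy completes the mirror product, which explains the exponent; at least
three mirrors give the cube. -/
theorem pow_mul_mirrorProduct_mem {l : List ℕ} (hl : l ∈ incidence) :
    complementProduct l ^ (l.length - 1) * mirrorProduct ∈ projectiveIdeal points ^ 3 := by
  have h3 := three_le_length hl
  refine Ideal.pow_le_pow_right h3 ?_
  have h := prod_mem_pow_length l (fun i => complementProduct l * linearForm (normalVec i))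
    fun i hi => complementProduct_mul_mem hl hi
  rw [List.prod_map_mul, List.map_const', List.prod_replicate] at h
  rw [← complementProduct_mul_prod hl, ← mul_assoc, ← pow_succ, Nat.sub_add_cancel (by omega)]
  exact h

theorem mirrorProduct_mem_symbolicPower :
    mirrorProduct ∈ symbolicPower (projectiveIdeal points) 3 := by
  refine mem_symbolicPower_of_forall fun Q hQ => ?_
  obtain ⟨f, hf, hQf⟩ := exists_of_mem_associatedPrimes hQ
  rw [mem_projectiveIdeal_iff] at hf
  push Not at hf
  obtain ⟨l, hl, s, hs⟩ := hf
  refine ⟨_, fun hmem => ?_, pow_mul_mirrorProduct_mem hl⟩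
  -- If the power lay in Q, its product with f would vanish on the line through the point. Neither
  -- restriction to this line is zero, and polynomials in one variable have no zero divisors.
  have h1 : along 0 (pointVec l) (complementProduct l ^ (l.length - 1) * f) = 0 := by
    refine Polynomial.funext fun c => ?_
    rw [eval_along, zero_add, Polynomial.eval_zero]
    exact mem_projectiveIdeal_iff.1 (hQf _ hmem) l hl c
  rw [map_mul, map_pow, mul_eq_zero] at h1
  rcases h1 with h1 | h1
  · have h2 := congrArg (Polynomial.eval 1) (eq_zero_of_pow_eq_zero h1)
    rw [eval_along, zero_add, Polynomial.eval_zero] at h2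
    exact eval_complementProduct_ne_zero hl one_ne_zero h2
  · have h2 := congrArg (Polynomial.eval s) h1
    rw [eval_along, zero_add, Polynomial.eval_zero] at h2
    exact hs h2

theorem not_symbolicPower_le_sq :
    ¬ symbolicPower (projectiveIdeal points) 3 ≤ projectiveIdeal points ^ 2 := fun h =>
  mirrorProduct_notMem_sq (h mirrorProduct_mem_symbolicPower)

end Wiman

theorem mainTheorem1 :
    Nat.card Wiman.group = 360 ∧
    Wiman.lines.ncard = 45 ∧
    Wiman.points.ncard = 201 ∧
    {P | Wiman.multiplicity P = 3}.ncard = 120 ∧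
    {P | Wiman.multiplicity P = 4}.ncard = 45 ∧
    {P | Wiman.multiplicity P = 5}.ncard = 36 ∧
    ¬ symbolicPower (projectiveIdeal Wiman.points) 3 ≤ projectiveIdeal Wiman.points ^ 2 :=
  ⟨Wiman.card_group, Wiman.ncard_lines, Wiman.ncard_points,
    (Wiman.ncard_setOf_multiplicity (· = 3) (by omega)).trans Wiman.incidence_count_check.2.2.1,
    (Wiman.ncard_setOf_multiplicity (· = 4) (by omega)).trans Wiman.incidence_count_check.2.2.2.1,
    (Wiman.ncard_setOf_multiplicity (· = 5) (by omega)).trans Wiman.incidence_count_check.2.2.2.2,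
    Wiman.not_symbolicPower_le_sq⟩
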